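/- Let $N\in\{2,3\}$, let $\Omega\subset\mathbb R^N$ be a bounded, open, simply connected polygonal (polyhedral if $N=3$) domain with Lipschitz boundary, and let $\mu>0$, $\lambda+\mu>0$, $a>0$, $\gamma>1$, $p(\varrho)=a\varrho^\gamma$. Let $T>0$, $\Delta t>0$ with $M\Delta t=T$, $M\in\mathbb N$, $t^m=m\Delta t$, and let $\mathbf f\in \mathbf L^2((0,T)\times\Omega)$. Let $E_h$ be a (conforming) simplicial mesh of $\Omega$ with maximal element diameter $h$, $\Gamma_h$ the set of its $(N-1)$-dimensional faces, and $\Gamma_h^I$ the set of those faces that are not contained in $\partial\Omega$. On each face $\Gamma$ fix a unit normal $\nu$; for $\Gamma\in\Gamma_h^I$ let $E_-$, $E_+$ be the two elements sharing $\Gamma$, named so that $\nu$ points from $E_-$ to $E_+$, let $g_\pm$ be the trace of $g$ on $\Gamma$ from $E_\pm$, and put $[g]_\Gamma=g_+-g_-$. Write $s^+=\max\{s,0\}$, $s^-=\min\{s,0\}$. Let $Q_h$ be the space of functions that are constant on each element. Let $\mathbf V_h$ be the lowest order div-conforming space: the functions of the form $\mathbf a+b\,x$ ($\mathbf a\in\mathbb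 R^N$, $b\in\mathbb R$) on each element whose degrees of freedom $\int_\Gamma \mathbf v\cdot\nu\,dS$ agree for the elements sharing a face and vanish for the faces in $\partial\Omega$. If $N=3$, let $\mathbf W_h$ be the lowest order curl-conforming Nédélec space of the first kind: the functions of the form $\mathbf a+\mathbf b\times x$ ($\mathbf a,\mathbf b\in\mathbb R^3$) on each element whose degrees of freedom $\int_e\mathbf w\cdot\tau_e\,dS$ ($\tau_e$ a unit tangent of $e$) agree for the elements sharing an edge $e$ and vanish for the edges in $\partial\Omega$. If $N=2$, let $\mathbf W_h$ be the space of continuous scalar functions that are affine on each element and vanish at the vertices on $\partial\Omega$, with $\operatorname{curl} w=(\partial_2 w,-\partial_1 w)$. Let $\mathbf f_h^m$ be the piecewise constant function with value $\frac1{\Delta t}\int_{t^{m-1}}^{t^m}\frac1{|E|}\int_E\mathbf f(s,x)\,dx\,ds$ on the element $E$. Then for every $\varrho_h^0\in Q_h$ with $\varrho_h^0>0$ there exist $$(\varrho_h^m,\mathbf w_h^m,\mathbf u_h^m)\in Q_h\times\mathbf W_h\times\mathbf V_h,\qquad \varrho_h^m>0,\qquad m=1,\dots,M,$$ such that, for each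 $m=1,\dots,M$, for all $\phi_h\in Q_h$, $$\int_\Omega\varrho_h^m\phi_h\,dx-\Delta t\sum_{\Gamma\in\Gamma_h^I}\int_\Gamma\bigl(\varrho^m_-(\mathbf u_h^m\cdot\nu)^++\varrho^m_+(\mathbf u_h^m\cdot\nu)^-\bigr)[\phi_h]_\Gamma\,dS=\int_\Omega\varrho_h^{m-1}\phi_h\,dx,$$ and for all $(\boldsymbol\eta_h,\mathbf v_h)\in\mathbf W_h\times\mathbf V_h$, $$\int_\Omega\mu\operatorname{curl}\mathbf w_h^m\cdot\mathbf v_h+\bigl[(\mu+\lambda)\operatorname{div}\mathbf u_h^m-p(\varrho_h^m)\bigr]\operatorname{div}\mathbf v_h\,dx=\int_\Omega\mathbf f_h^m\cdot\mathbf v_h\,dx,$$ $$\int_\Omega\mathbf w_h^m\cdot\boldsymbol\eta_h-\mathbf u_h^m\cdot\operatorname{curl}\boldsymbol\eta_h\,dx=0.$$ -/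

import Mathlib

open MeasureTheory Set

/-- Euclidean space `ℝᴺ`. -/
abbrev Euc (N : ℕ) : Type := EuclideanSpace ℝ (Fin N)

/-- The boundary of the set `Ω` is Lipschitz: near each of its boundary points `Ω` is, with respect
to a suitable vertical direction `e`, the strict epigraph of a Lipschitz function of the component
orthogonal to `e`. -/
def HasLipschitzBoundary {N : ℕ} (Ω : Set (Euc N)) : Prop :=
  ∀ x₀ ∈ frontier Ω, ∃ (e : Euc N) (g : Euc N → ℝ) (L : NNReal) (U : Set (Euc N)),
    ‖e‖ = 1 ∧ LipschitzWith L g ∧ IsOpen U ∧ x₀ ∈ U ∧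
      ∀ x ∈ U, x ∈ Ω ↔ g (x - inner ℝ e x • e) < inner ℝ e x

/-! ### Differential operators -/

noncomputable section

/-- The `i`-th partial derivative. -/
def pderiv {N : ℕ} {F : Type} [NormedAddCommGroup F] [NormedSpace ℝ F]
    (i : Fin N) (g : Euc N → F) (x : Euc N) : F :=
  fderiv ℝ g x (EuclideanSpace.single i 1)

/-- The divergence of a vector field. -/
def divergence {N : ℕ} (v : Euc N → Euc N) (x : Euc N) : ℝ :=
  ∑ i, (pderiv i v x) i

/-- The curl of a scalar function in two dimensions (a vector field). -/
def curl2 (w : Euc 2 → ℝ) (x : Euc 2) : Euc 2 :=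
  !₂[pderiv 1 w x, -pderiv 0 w x]

/-- The curl of a vector field in three dimensions. -/
def curl3 (w : Euc 3 → Euc 3) (x : Euc 3) : Euc 3 :=
  !₂[(pderiv 1 w x) 2 - (pderiv 2 w x) 1,
     (pderiv 2 w x) 0 - (pderiv 0 w x) 2,
     (pderiv 0 w x) 1 - (pderiv 1 w x) 0]

end

/-! ### Meshes -/

/-- A (conforming) simplicial mesh of `Ω ⊆ ℝᴺ`: finitely many nondegenerate `N`-simplices, together
with all their faces, any two of which meet in a common face or not at all, and whose union is the
closure of `Ω`. A simplex is represented by the finite set of its vertices. -/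
structure SimplicialMesh {N : ℕ} (Ω : Set (Euc N)) extends
    Geometry.SimplicialComplex ℝ (Euc N) where
  finite_faces : faces.Finite
  exists_cell : ∀ s ∈ faces, ∃ t ∈ faces, s ⊆ t ∧ t.card = N + 1
  space_eq : toSimplicialComplex.space = closure Ω

namespace SimplicialMesh

variable {N : ℕ} {Ω : Set (Euc N)} (T : SimplicialMesh Ω)

/-- The elements of the mesh: triangles if `N = 2`, tetrahedra if `N = 3`. -/
def Cell : Type := {s : Finset (Euc N) // s ∈ T.faces ∧ s.card = N + 1}

/-- The faces of the elements, of dimension `N - 1`: edges if `N = 2`, triangles if `N = 3`. -/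
def Face : Type := {s : Finset (Euc N) // s ∈ T.faces ∧ s.card = N}

/-- The interior faces: those that are not contained in the boundary of `Ω`. -/
def InteriorFace : Type :=
  {s : Finset (Euc N) // (s ∈ T.faces ∧ s.card = N) ∧
    ¬ convexHull ℝ (s : Set (Euc N)) ⊆ frontier Ω}

/-- An interior face is a face. -/
def InteriorFace.toFace {T : SimplicialMesh Ω} (Γ : T.InteriorFace) : T.Face := ⟨Γ.1, Γ.2.1⟩

noncomputable section

instance : Fintype T.Cell :=
  (T.finite_faces.subset (fun _ h => h.1 :
    {s : Finset (Euc N) | s ∈ T.faces ∧ s.card = N + 1} ⊆ T.faces)).fintype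

instance : Fintype T.InteriorFace :=
  (T.finite_faces.subset (fun _ h => h.1.1 :
    {s : Finset (Euc N) | (s ∈ T.faces ∧ s.card = N) ∧
      ¬ convexHull ℝ (s : Set (Euc N)) ⊆ frontier Ω} ⊆ T.faces)).fintype

/-- The closed element, as a set of points. -/
def Cell.carrier {T : SimplicialMesh Ω} (K : T.Cell) : Set (Euc N) :=
  convexHull ℝ (K.1 : Set (Euc N))

/-- The closed face, as a set of points. -/
def Face.carrier {T : SimplicialMesh Ω} (Γ : T.Face) : Set (Euc N) :=
  convexHull ℝ (Γ.1 : Set (Euc N))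

/-- The integral over a face with respect to the `(N - 1)`-dimensional surface measure. -/
def Face.integral {T : SimplicialMesh Ω} (Γ : T.Face) (g : Euc N → ℝ) : ℝ :=
  ∫ x in Γ.carrier, g x ∂(Measure.euclideanHausdorffMeasure (N - 1))

/-- The integral over `Ω` of a function that is given element by element. -/
def integral (g : T.Cell → Euc N → ℝ) : ℝ :=
  ∑ K : T.Cell, ∫ x in K.carrier, g K x

/-- A choice, fixed throughout, of one of the two unit normals `ν Γ` on every face `Γ`, and the
resulting names `minus Γ` and `plus Γ` of the two elements that share an interior face:
the normal points from `minus Γ` to `plus Γ`. -/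
structure Orientation where
  ν : T.Face → Euc N
  norm_ν : ∀ Γ, ‖ν Γ‖ = 1
  ν_orthogonal : ∀ Γ, ∀ p ∈ Γ.1, ∀ q ∈ Γ.1, inner ℝ (ν Γ) (p - q) = 0
  minus : T.InteriorFace → T.Cell
  plus : T.InteriorFace → T.Cell
  subset_minus : ∀ Γ, Γ.1 ⊆ (minus Γ).1
  subset_plus : ∀ Γ, Γ.1 ⊆ (plus Γ).1
  minus_side : ∀ Γ, ∀ p ∈ (minus Γ).1, p ∉ Γ.1 → ∀ q ∈ Γ.1,
    inner ℝ (ν Γ.toFace) (p - q) < 0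
  plus_side : ∀ Γ, ∀ p ∈ (plus Γ).1, p ∉ Γ.1 → ∀ q ∈ Γ.1,
    0 < inner ℝ (ν Γ.toFace) (p - q)

/-! ### Finite element spaces

A function of a finite element space is given by the family of its restrictions to the elements,
each of which is (the restriction of) a polynomial map on `ℝᴺ`. -/

/-- Piecewise constant functions: one constant for each element. -/
abbrev Qh : Type := T.Cell → ℝ

/-- The lowest order div-conforming space. On each element the function has the form
`x ↦ a + b x` with `a ∈ ℝᴺ` and `b ∈ ℝ`; the degrees of freedom `∫_Γ v · ν` of the elements
that share a face coincide, and those of the faces on the boundary vanish. -/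
def Vh (o : T.Orientation) : Set (T.Cell → Euc N → Euc N) :=
  {v | (∀ K, ∃ (a : Euc N) (b : ℝ), ∀ x, v K x = a + b • x) ∧
    (∀ (Γ : T.Face) (K K' : T.Cell), Γ.1 ⊆ K.1 → Γ.1 ⊆ K'.1 →
      Γ.integral (fun x => inner ℝ (v K x) (o.ν Γ)) =
        Γ.integral (fun x => inner ℝ (v K' x) (o.ν Γ))) ∧
    (∀ (Γ : T.Face) (K : T.Cell), Γ.1 ⊆ K.1 → Γ.carrier ⊆ frontier Ω →
      Γ.integral (fun x => inner ℝ (v K x) (o.ν Γ)) = 0)}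

/-- The two-dimensional space `W_h`. On each triangle the function is an affine scalar
function; the values of the triangles that share a vertex coincide there, and the values at
the vertices on the boundary vanish. -/
def Wh2 {Ω : Set (Euc 2)} (T : SimplicialMesh Ω) : Set (T.Cell → Euc 2 → ℝ) :=
  {w | (∀ K, ∃ (a : Euc 2) (b : ℝ), ∀ x, w K x = inner ℝ a x + b) ∧
    (∀ (p : Euc 2) (K K' : T.Cell), p ∈ K.1 → p ∈ K'.1 → w K p = w K' p) ∧
    (∀ (p : Euc 2) (K : T.Cell), p ∈ K.1 → p ∈ frontier Ω → w K p = 0)}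

/-- The integral `∫_e w · τ` of the tangential component of `w` along the straight edge
from `p` to `q`. -/
def edgeIntegral (w : Euc 3 → Euc 3) (p q : Euc 3) : ℝ :=
  ∫ t in (0 : ℝ)..1, inner ℝ (w (p + t • (q - p))) (q - p)

/-- The three-dimensional space `W_h`, of lowest order curl-conforming functions. On each
tetrahedron the function has the form `x ↦ a + b × x`; the degrees of freedom `∫_e w · τ` of the
tetrahedra that share an edge coincide, and those of the edges on the boundary vanish. -/
def Wh3 {Ω : Set (Euc 3)} (T : SimplicialMesh Ω) : Set (T.Cell → Euc 3 → Euc 3) :=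
  {w | (∀ K, ∃ a b : Euc 3, ∀ x, w K x = a + WithLp.toLp 2 (crossProduct b.ofLp x.ofLp)) ∧
    (∀ (p q : Euc 3) (K K' : T.Cell), p ∈ K.1 → q ∈ K.1 → p ∈ K'.1 → q ∈ K'.1 →
      edgeIntegral (w K) p q = edgeIntegral (w K') p q) ∧
    (∀ (p q : Euc 3) (K : T.Cell), p ∈ K.1 → q ∈ K.1 → segment ℝ p q ⊆ frontier Ω →
      edgeIntegral (w K) p q = 0)}

/-! ### The numerical method -/

/-- The discrete force `f_h^m`: on the element `K`, the average over the time interval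
`(t^{m-1}, t^m)`, `t^m = m Δt`, of the average over `K` of `f`. -/
def discreteForce (dt : ℝ) (f : ℝ → Euc N → Euc N) (m : ℕ) (K : T.Cell) : Euc N :=
  (1 / dt) • ∫ s in (((m : ℝ) - 1) * dt)..((m : ℝ) * dt), ⨍ x in K.carrier, f s x

/-- The upwind flux term
`∑_Γ ∫_Γ (ρ₋ (u · ν)⁺ + ρ₊ (u · ν)⁻) [φ]_Γ` over the interior faces, where `(·)⁺ = max(·, 0)`,
`(·)⁻ = min(·, 0)` and `[φ]_Γ = φ₊ - φ₋`. The normal component of `u ∈ V_h` is the same on both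
sides of `Γ`; it is evaluated here from the minus side. -/
def upwindTerm (o : T.Orientation) (ρ : T.Qh) (u : T.Cell → Euc N → Euc N) (φ : T.Qh) : ℝ :=
  ∑ Γ : T.InteriorFace, Γ.toFace.integral fun x =>
    (ρ (o.minus Γ) * max (inner ℝ (u (o.minus Γ) x) (o.ν Γ.toFace)) 0 +
      ρ (o.plus Γ) * min (inner ℝ (u (o.minus Γ) x) (o.ν Γ.toFace)) 0) *
        (φ (o.plus Γ) - φ (o.minus Γ))

/-- The discrete continuity equation for the new density `ρ` and velocity `u`, given the
density `ρ'` at the previous time level. -/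
def ContinuityScheme (o : T.Orientation) (dt : ℝ) (ρ' ρ : T.Qh)
    (u : T.Cell → Euc N → Euc N) : Prop :=
  ∀ φ : T.Qh,
    T.integral (fun K _ => ρ K * φ K) - dt * T.upwindTerm o ρ u φ =
      T.integral (fun K _ => ρ' K * φ K)

/-- The discrete velocity equations, with pressure `p` and piecewise constant force `g`. The
vorticity space `W` and the operator `curl` are those of the dimension at hand. -/
def VelocityScheme (o : T.Orientation) {F : Type} [NormedAddCommGroup F] [InnerProductSpace ℝ F]
    (W : Set (T.Cell → Euc N → F)) (curl : (Euc N → F) → Euc N → Euc N)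
    (mu lam : ℝ) (p : ℝ → ℝ) (g : T.Cell → Euc N)
    (ρ : T.Qh) (w : T.Cell → Euc N → F) (u : T.Cell → Euc N → Euc N) : Prop :=
  (∀ v ∈ T.Vh o,
    T.integral (fun K x => mu * inner ℝ (curl (w K) x) (v K x) +
        ((mu + lam) * divergence (u K) x - p (ρ K)) * divergence (v K) x) =
      T.integral (fun K x => inner ℝ (g K) (v K x))) ∧
  (∀ η ∈ W,
    T.integral (fun K x => inner ℝ (w K x) (η K x) - inner ℝ (u K x) (curl (η K) x)) = 0)

/-- `(ρ^m, w^m, u^m)`, `m = 1, …, M`, is a solution of the numerical method with time step `dt`,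
initial density `ρ0`, force `f` and pressure `p(ρ) = a ρ^γ`. The values `w 0` and `u 0` play
no role. -/
def IsNumericalSolution (o : T.Orientation) {F : Type} [NormedAddCommGroup F]
    [InnerProductSpace ℝ F]
    (W : Set (T.Cell → Euc N → F)) (curl : (Euc N → F) → Euc N → Euc N)
    (mu lam a γ dt : ℝ) (M : ℕ) (f : ℝ → Euc N → Euc N) (ρ0 : T.Qh)
    (ρ : ℕ → T.Qh) (w : ℕ → T.Cell → Euc N → F) (u : ℕ → T.Cell → Euc N → Euc N) : Prop :=
  ρ 0 = ρ0 ∧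
  ∀ m : ℕ, 1 ≤ m → m ≤ M →
    w m ∈ W ∧ u m ∈ T.Vh o ∧
    T.ContinuityScheme o dt (ρ (m - 1)) (ρ m) (u m) ∧
    T.VelocityScheme o W curl mu lam (fun r => a * r ^ γ) (T.discreteForce dt f m)
      (ρ m) (w m) (u m)

end

end SimplicialMesh

/-! A time step splits into two linear problems, and Brouwer's theorem closes the loop. For a frozen
pressure the velocity equations form a square, uniquely solvable linear system, so the velocity is
affine in the pressure (`exists_velocity`). For frozen fluxes the upwind scheme is linear in the
density. Its transposed matrix obeys a minimum principle, so the new density exists, is positive and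
depends continuously on the fluxes (`exists_continuous_upwind_solution`); conservation of mass
bounds it. The composite density → pressure → velocity → density is continuous and bounded, and its
fixed point solves the step (`exists_step`).

The hard point is uniqueness in the velocity equations (`form_injective`). An energy identity
removes the vorticity and the divergence. What is left is a piecewise constant field `U` with
continuous normal components, zero on the boundary, orthogonal to all curls of the vorticity space.
That `U` vanishes is exactness of the discrete complex, and it depends on the topology of `Ω`.

The proof (`eq_zero_of_orthogonal`) writes the pairing of `U` with a conservative field as a sum
over interior faces of the flux times a number `c Γ`. If `c` is the jump of a piecewise constant
function, the pairing of `U` with itself vanishes by a discrete divergence theorem. Around a ridge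
(a vertex if `N = 2`, an edge if `N = 3`) the basis function attached to it has a curl circulating
around the ridge, and orthogonality to that curl yields a local potential for `c` by a dimension
count (`hasPotential_of_flux`). Local potentials differ by a Čech cocycle on the cover by closed
elements. It is a coboundary because nonvanishing complex functions on a simply connected open set
have continuous logarithms (`exists_real_coboundary`). For `N = 3` the potentials around vertices
come from the same argument on a punctured ball. -/

/-! ### Brouwer's fixed point theorem, by the volume polynomial argument -/

/-- The degree bound lets finitely many small values of `t` determine the value at `t = 1`. -/
lemma ContinuousLinearMap.exists_polynomial_det {E : Type*} [NormedAddCommGroup E]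
    [NormedSpace ℝ E] [FiniteDimensional ℝ E] (A : E →L[ℝ] E) :
    ∃ P : Polynomial ℝ, P.natDegree ≤ Module.finrank ℝ E ∧
      ∀ t : ℝ, P.eval t = (ContinuousLinearMap.id ℝ E + t • A).det := by
  classical
  let b := Module.finBasis ℝ E
  let M := LinearMap.toMatrix b b (A : E →ₗ[ℝ] E)
  refine ⟨Matrix.det ((Polynomial.X : Polynomial ℝ) • M.map Polynomial.C +
    (1 : Matrix _ _ ℝ).map Polynomial.C), ?_, fun t => ?_⟩
  · simpa using Polynomial.natDegree_det_X_add_C_le M 1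
  · have h1 : (ContinuousLinearMap.id ℝ E + t • A).det = (1 + t • M).det := by
      rw [ContinuousLinearMap.det, ← LinearMap.det_toMatrix b]
      simp [M]
    rw [h1, ← Polynomial.coe_evalRingHom, RingHom.map_det]
    congr 1
    ext i j
    simp [Matrix.map_apply, Matrix.one_apply, apply_ite, add_comm]
    ring

/-- For `0 ≤ s ≤ t` the map `id + s • A` is injective because `s • A` has norm below one. The
determinant thus has no zero on `[0, t]`, and it starts from 1. -/
lemma ContinuousLinearMap.det_id_add_smul_pos {E : Type*} [NormedAddCommGroup E]
    [NormedSpace ℝ E] [FiniteDimensional ℝ E] (A : E →L[ℝ] E) {t C : ℝ} (ht : 0 ≤ t)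
    (hA : ‖A‖ ≤ C) (htC : t * C < 1) : 0 < (ContinuousLinearMap.id ℝ E + t • A).det := by
  obtain ⟨P, -, hP⟩ := A.exists_polynomial_det
  have hne : ∀ s ∈ Icc 0 t, P.eval s ≠ 0 := by
    intro s hs h0
    rw [hP, ContinuousLinearMap.det] at h0
    have hker := LinearMap.bot_lt_ker_of_det_eq_zero h0
    obtain ⟨v, hv, hv0⟩ := Submodule.exists_mem_ne_zero_of_ne_bot hker.ne'
    have hv1 : v = -(s • A v) := by
      have : v + s • A v = 0 := by simpa using hv
      exact eq_neg_of_add_eq_zero_left this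
    have h2 : ‖v‖ ≤ s * (C * ‖v‖) := by
      calc ‖v‖ = ‖s • A v‖ := by rw [← norm_neg (s • A v), ← hv1]
        _ = s * ‖A v‖ := by rw [norm_smul, Real.norm_of_nonneg hs.1]
        _ ≤ s * (C * ‖v‖) := by
          have := A.le_of_opNorm_le hA v
          exact mul_le_mul_of_nonneg_left this hs.1
    have hvpos : 0 < ‖v‖ := norm_pos_iff.2 hv0
    have hC : 0 ≤ C := (norm_nonneg _).trans hA
    have : s * C ≤ t * C := mul_le_mul_of_nonneg_right hs.2 hC
    nlinarith
  rw [← hP]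
  by_contra hcon
  push Not at hcon
  have h0 : P.eval 0 = 1 := by rw [hP]; simp [ContinuousLinearMap.det]
  obtain ⟨s, hs, hs0⟩ := intermediate_value_Icc' ht (P.continuous.continuousOn)
    (show (0 : ℝ) ∈ Icc (P.eval t) (P.eval 0) from ⟨hcon, by rw [h0]; norm_num⟩)
  exact hne s hs hs0

/-- A function that is Lipschitz on the closed unit ball and vanishes on the unit sphere stays
Lipschitz when it is extended by zero. -/
lemma LipschitzOnWith.indicator_closedBall {E : Type*} [NormedAddCommGroup E] [NormedSpace ℝ E]
    {g : E → E} {C : NNReal} (hg : LipschitzOnWith C g (Metric.closedBall 0 1))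
    (h0 : ∀ x, ‖x‖ = 1 → g x = 0) :
    LipschitzWith C ((Metric.closedBall (0 : E) 1).indicator g) := by
  have key : ∀ x y : E, ‖x‖ ≤ 1 → 1 < ‖y‖ → ‖g x‖ ≤ C * dist x y := by
    intro x y hx hy
    have hc : ContinuousOn (fun t : ℝ => ‖AffineMap.lineMap x y t‖) (Icc 0 1) := by
      have : Continuous (fun t : ℝ => AffineMap.lineMap (k := ℝ) x y t) :=
        AffineMap.lineMap_continuous
      exact this.norm.continuousOn
    -- The segment from `x` to `y` meets the sphere, where `g` vanishes, at a point no farther from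
    -- `x` than `y`.
    obtain ⟨t, ht, ht1⟩ := intermediate_value_Icc (zero_le_one' ℝ) hc
      (show (1 : ℝ) ∈ Icc _ _ by simpa using ⟨hx, hy.le⟩)
    have h1 := hg.dist_le_mul x (by simpa using hx) (AffineMap.lineMap x y t)
      (by simpa using ht1.le)
    rw [h0 _ ht1, dist_zero_right, dist_comm, dist_lineMap_left, Real.norm_of_nonneg ht.1] at h1
    refine h1.trans ?_
    have : t * dist x y ≤ 1 * dist x y := mul_le_mul_of_nonneg_right ht.2 dist_nonneg
    have hC : (0 : ℝ) ≤ C := C.2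
    nlinarith
  refine LipschitzWith.of_dist_le_mul fun x y => ?_
  by_cases hx : x ∈ Metric.closedBall (0 : E) 1 <;> by_cases hy : y ∈ Metric.closedBall (0 : E) 1
  · rw [indicator_of_mem hx, indicator_of_mem hy]
    exact hg.dist_le_mul x hx y hy
  · rw [indicator_of_mem hx, indicator_of_notMem hy, dist_zero_right]
    exact key x y (by simpa using hx) (by simpa using hy)
  · rw [indicator_of_notMem hx, indicator_of_mem hy, dist_zero_left, dist_comm]
    exact key y x (by simpa using hy) (by simpa using hx)
  · rw [indicator_of_notMem hx, indicator_of_notMem hy, dist_self]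
    positivity

/-- A solution is a fixed point of the contraction `x ↦ y - t • g x`. -/
lemma LipschitzWith.surjective_add_smul {E : Type*} [NormedAddCommGroup E] [NormedSpace ℝ E]
    [CompleteSpace E] {g : E → E} {C : NNReal} (hg : LipschitzWith C g) {t : NNReal}
    (ht : t * C < 1) (y : E) : ∃ x, x + (t : ℝ) • g x = y := by
  have hc : ContractingWith (t * C) (fun x => y - (t : ℝ) • g x) := by
    refine ⟨ht, LipschitzWith.of_dist_le_mul fun a b => ?_⟩
    rw [dist_sub_left, dist_smul₀]
    have := hg.dist_le_mul a b
    have h2 : ‖(t : ℝ)‖ = t := by simp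
    rw [h2]; push_cast
    have ht0 : (0 : ℝ) ≤ t := t.2
    nlinarith
  refine ⟨hc.fixedPoint, ?_⟩
  have := hc.fixedPoint_isFixedPt
  unfold Function.IsFixedPt at this
  nth_rewrite 1 [← this]
  simp

section
variable {E : Type*} [NormedAddCommGroup E] [InnerProductSpace ℝ E] [FiniteDimensional ℝ E]

/-- There is no `C¹` retraction of the closed unit ball onto the unit sphere. -/
theorem not_exists_contDiff_retraction {U : Set E} (hU : IsOpen U)
    (hBU : Metric.closedBall (0 : E) 1 ⊆ U) {f : E → E} (hf : ContDiffOn ℝ 1 f U)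
    (hnorm : ∀ x ∈ Metric.closedBall (0 : E) 1, ‖f x‖ = 1)
    (hid : ∀ x, ‖x‖ = 1 → f x = x) : False := by
  let _ : MeasurableSpace E := borel E
  have : BorelSpace E := ⟨rfl⟩
  set B := Metric.closedBall (0 : E) 1 with hB
  set O := Metric.ball (0 : E) 1 with hO
  have hOB : O ⊆ B := Metric.ball_subset_closedBall
  have hBc : IsCompact B := isCompact_closedBall _ _
  set g : E → E := fun x => f x - x with hg
  set A : E → (E →L[ℝ] E) := fun x => fderiv ℝ f x - ContinuousLinearMap.id ℝ E with hA
  have hAc : ContinuousOn A B :=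
    ((hf.continuousOn_fderiv_of_isOpen hU le_rfl).mono hBU).sub continuousOn_const
  have hdiff : ∀ x ∈ U, HasFDerivAt f (fderiv ℝ f x) x := fun x hx =>
    ((hf.differentiableOn (by simp)).differentiableAt (hU.mem_nhds hx)).hasFDerivAt
  have hgd : ∀ x ∈ U, HasFDerivAt g (A x) x := fun x hx => (hdiff x hx).sub (hasFDerivAt_id x)
  obtain ⟨C, hC⟩ := hBc.exists_bound_of_continuousOn hAc
  have hC0 : 0 ≤ C := (norm_nonneg _).trans (hC 0 (by simp [hB]))
  lift C to NNReal using hC0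
  have hlip : LipschitzOnWith C g B :=
    (convex_closedBall (0 : E) 1).lipschitzOnWith_of_nnnorm_hasFDerivWithin_le
      (fun x hx => (hgd x (hBU hx)).hasFDerivWithinAt) (fun x hx => hC x hx)
  have hg0 : ∀ x, ‖x‖ = 1 → g x = 0 := fun x hx => by simp [hg, hid x hx]
  have hlip' := hlip.indicator_closedBall hg0
  -- For small `t` the map `id + t • g` is a bijection of the open ball onto itself, so the integral
  -- of its Jacobian is the volume of the ball.
  have hvol : ∀ t : NNReal, t * C < 1 → t < 1 →
      ∫ x in O, (ContinuousLinearMap.id ℝ E + (t : ℝ) • A x).det =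
        (volume O).toReal := by
    intro t ht ht1
    have htR : (t : ℝ) * C < 1 := by exact_mod_cast ht
    have ht1R : (t : ℝ) < 1 := by exact_mod_cast ht1
    have himg : (fun x => x + (t : ℝ) • g x) '' O = O := by
      apply Subset.antisymm
      · rintro _ ⟨x, hx, rfl⟩
        have hx1 : ‖x‖ < 1 := by simpa [hO] using hx
        have : x + (t : ℝ) • g x = (1 - (t : ℝ)) • x + (t : ℝ) • f x := by
          simp only [hg]; module
        simp only [hO, mem_ball_zero_iff, this]
        calc ‖(1 - (t : ℝ)) • x + (t : ℝ) • f x‖ ≤ (1 - t) * ‖x‖ + t * 1 := by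
              refine (norm_add_le _ _).trans ?_
              rw [norm_smul, norm_smul, hnorm x (hOB hx), Real.norm_of_nonneg (by linarith),
                NNReal.norm_eq]
          _ < 1 := by nlinarith
      · intro y hy
        -- The map extended by the identity is onto the whole space. Since it fixes the sphere and
        -- everything outside, a preimage of a point of the open ball lies in the open ball.
        obtain ⟨x, hx⟩ := hlip'.surjective_add_smul ht y
        have hy1 : ‖y‖ < 1 := by simpa [hO] using hy
        have hxB : x ∈ B := by
          by_contra hxB
          rw [indicator_of_notMem hxB] at hx
          simp only [smul_zero, add_zero] at hx
          exact hxB (hOB (hx ▸ hy))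
        rw [indicator_of_mem hxB] at hx
        refine ⟨x, ?_, hx⟩
        have hx1 : ‖x‖ ≤ 1 := by simpa [hB] using hxB
        rcases hx1.lt_or_eq with h | h
        · simpa [hO] using h
        · rw [hg0 x h] at hx
          simp only [smul_zero, add_zero] at hx
          rw [hx] at h; linarith
    have hinj : InjOn (fun x => x + (t : ℝ) • g x) O := by
      intro x hx y hy hxy
      simp only at hxy
      have h1 : x - y = (t : ℝ) • (g y - g x) := by
        rw [smul_sub, sub_eq_sub_iff_add_eq_add, hxy]; abel
      have h2 := hlip.dist_le_mul y (hOB hy) x (hOB hx)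
      have h3 : dist x y ≤ t * (C * dist y x) := by
        calc dist x y = ‖x - y‖ := dist_eq_norm _ _
          _ = t * dist (g y) (g x) := by
            rw [h1, norm_smul, dist_eq_norm, NNReal.norm_eq]
          _ ≤ _ := mul_le_mul_of_nonneg_left h2 t.2
      rw [dist_comm y x] at h3
      have h4 : 0 ≤ dist x y := dist_nonneg
      have : dist x y = 0 := by nlinarith
      exact dist_eq_zero.1 this
    have hcv := lintegral_abs_det_fderiv_eq_addHaar_image volume
      (Metric.isOpen_ball.measurableSet : MeasurableSet O)
      (f := fun x => x + (t : ℝ) • g x)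
      (f' := fun x => ContinuousLinearMap.id ℝ E + (t : ℝ) • A x)
      (fun x hx => ((hasFDerivAt_id x).add
        ((hgd x (hBU (hOB hx))).const_smul (t : ℝ))).hasFDerivWithinAt) hinj
    rw [himg] at hcv
    have hpos : ∀ x ∈ O, 0 < (ContinuousLinearMap.id ℝ E + (t : ℝ) • A x).det := fun x hx =>
      ContinuousLinearMap.det_id_add_smul_pos _ t.2 (hC x (hOB hx)) htR
    have hcont : ContinuousOn (fun x => (ContinuousLinearMap.id ℝ E + (t : ℝ) • A x).det) O :=
      ContinuousLinearMap.continuous_det.comp_continuousOn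
        (continuousOn_const.add ((hAc.mono hOB).const_smul (t : ℝ)))
    rw [integral_eq_lintegral_of_nonneg_ae
      ((ae_restrict_iff' Metric.isOpen_ball.measurableSet).2
        (Filter.Eventually.of_forall fun x hx => (hpos x hx).le))
      (hcont.aestronglyMeasurable Metric.isOpen_ball.measurableSet), ← hcv]
    congr 1
    exact setLIntegral_congr_fun Metric.isOpen_ball.measurableSet fun x hx => by
      rw [abs_of_pos (hpos x hx)]
  set n := Module.finrank ℝ E
  -- These supply `n + 1` distinct admissible parameters, as many as determine a polynomial of
  -- degree at most `n`.
  let τ : ℕ → NNReal := fun i => i / ((n + 1) * (C + 1))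
  have hτinj : Function.Injective τ := by
    intro i j hij
    have hne : ((n : NNReal) + 1) * (C + 1) ≠ 0 := by positivity
    have : (i : NNReal) = j := by
      simpa [τ, div_left_inj' hne] using hij
    exact_mod_cast this
  have hτ : ∀ i ∈ Finset.range (n + 1), τ i * C < 1 ∧ τ i < 1 := by
    intro i hi
    have hi' : (i : NNReal) < n + 1 := by exact_mod_cast Finset.mem_range.1 hi
    have hn : (0 : NNReal) < n + 1 := by positivity
    have hC1 : (0 : NNReal) < C + 1 := by positivity
    constructor
    · calc τ i * C = (i / (n + 1)) * (C / (C + 1)) := by simp only [τ]; field_simp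
        _ ≤ (i / (n + 1)) * 1 := by
          gcongr
          rw [div_le_one hC1]; exact le_self_add
        _ < 1 := by rw [mul_one, div_lt_one hn]; exact hi'
    · have : τ i ≤ i / (n + 1) := by
        simp only [τ]
        gcongr
        nth_rewrite 1 [← mul_one ((n : NNReal) + 1)]
        gcongr
        exact le_add_self
      exact this.trans_lt (by rw [div_lt_one hn]; exact hi')
  let v : ℕ → ℝ := fun i => τ i
  have hv : InjOn v (Finset.range (n + 1)) := fun i _ j _ h => hτinj (NNReal.coe_injective h)
  have hexp : ∀ x, (ContinuousLinearMap.id ℝ E + (1 : ℝ) • A x).det =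
      ∑ i ∈ Finset.range (n + 1), (ContinuousLinearMap.id ℝ E + v i • A x).det *
        (Lagrange.basis (Finset.range (n + 1)) v i).eval 1 := by
    intro x
    obtain ⟨P, hPd, hP⟩ := (A x).exists_polynomial_det
    have hdeg : P.degree < (Finset.range (n + 1)).card := by
      rw [Finset.card_range]
      refine Polynomial.degree_le_natDegree.trans_lt ?_
      exact_mod_cast Nat.lt_succ_of_le hPd
    rw [← hP 1, Lagrange.eq_interpolate hv hdeg, Lagrange.interpolate_apply,
      Polynomial.eval_finsetSum]
    simp [hP]
  have hint : ∀ s : ℝ, IntegrableOn (fun x => (ContinuousLinearMap.id ℝ E + s • A x).det) O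
      volume := by
    intro s
    have hcont : ContinuousOn (fun x => (ContinuousLinearMap.id ℝ E + s • A x).det) B :=
      ContinuousLinearMap.continuous_det.comp_continuousOn
        (continuousOn_const.add (hAc.const_smul s))
    exact (hcont.integrableOn_compact hBc).mono_set hOB
  have h1 : ∫ x in O, (ContinuousLinearMap.id ℝ E + (1 : ℝ) • A x).det =
      (volume O).toReal := by
    simp_rw [hexp]
    rw [integral_finsetSum _ fun i _ => (hint (v i)).mul_const _]
    simp_rw [integral_mul_const]
    rw [Finset.sum_congr rfl fun i hi => by rw [hvol (τ i) (hτ i hi).1 (hτ i hi).2],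
      ← Finset.mul_sum, ← Polynomial.eval_finsetSum, Lagrange.sum_basis hv (by simp)]
    simp
  -- Differentiating `⟨f, f⟩ = 1` shows that `f x` is orthogonal to the range of the derivative,
  -- which is therefore not onto.
  have h2 : ∀ x ∈ O, (ContinuousLinearMap.id ℝ E + (1 : ℝ) • A x).det = 0 := by
    intro x hx
    have hxU := hBU (hOB hx)
    have : ContinuousLinearMap.id ℝ E + (1 : ℝ) • A x = fderiv ℝ f x := by simp [hA]
    rw [this]
    by_contra hne
    have hconst : (fun y => inner ℝ (f y) (f y)) =ᶠ[nhds x] fun _ => (1 : ℝ) := by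
      filter_upwards [Metric.isOpen_ball.mem_nhds hx] with y hy
      rw [real_inner_self_eq_norm_sq, hnorm y (hOB hy)]; norm_num
    have hd := ((hdiff x hxU).inner ℝ (hdiff x hxU)).congr_of_eventuallyEq hconst.symm
    have hz := hd.unique (hasFDerivAt_const (1 : ℝ) x)
    have hsurj : Function.Surjective (fderiv ℝ f x) := by
      have hu : IsUnit (LinearMap.det (fderiv ℝ f x : E →ₗ[ℝ] E)) := isUnit_iff_ne_zero.2 hne
      exact (LinearMap.equivOfDetNeZero _ hne).surjective
    obtain ⟨w, hw⟩ := hsurj (f x)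
    have hzw := congrArg (fun L => L w) hz
    simp only [ContinuousLinearMap.comp_apply, ContinuousLinearMap.prod_apply,
      fderivInnerCLM_apply, hw, _root_.zero_apply] at hzw
    rw [real_inner_self_eq_norm_sq, hnorm x (hOB hx)] at hzw
    norm_num at hzw
  rw [setIntegral_congr_fun Metric.isOpen_ball.measurableSet h2] at h1
  simp only [integral_zero] at h1
  have hp : 0 < (volume O).toReal :=
    ENNReal.toReal_pos (Metric.measure_ball_pos _ _ one_pos).ne' measure_ball_lt_top.ne
  linarith
end

section
variable {E : Type*} [NormedAddCommGroup E] [InnerProductSpace ℝ E] [FiniteDimensional ℝ E]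

/-- A smooth self-map of the closed unit ball has a fixed point: otherwise the intersection of the
ray from `h x` through `x` with the sphere would define a retraction. -/
lemma exists_fixedPoint_of_contDiff {h : E → E} (hc : ContDiff ℝ 1 h)
    (hB : ∀ x, ‖x‖ ≤ 1 → ‖h x‖ ≤ 1) : ∃ x, ‖x‖ ≤ 1 ∧ h x = x := by
  by_contra! hne
  let y : E → E := fun x => x - h x
  let a : E → ℝ := fun x => inner ℝ x (y x)
  -- `D` is a quarter of the discriminant of the quadratic equation `‖x + l • y x‖ ^ 2 = 1` in `l`,
  -- and the function `l` is its larger root.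
  let D : E → ℝ := fun x => a x ^ 2 + inner ℝ (y x) (y x) * (1 - inner ℝ x x)
  let l : E → ℝ := fun x => (-a x + √(D x)) / inner ℝ (y x) (y x)
  have hy : ContDiff ℝ 1 y := contDiff_id.sub hc
  have ha : ContDiff ℝ 1 a := contDiff_id.inner ℝ hy
  have hyy : ContDiff ℝ 1 fun x => inner ℝ (y x) (y x) := hy.inner ℝ hy
  have hD : ContDiff ℝ 1 D :=
    (ha.pow 2).add (hyy.mul (contDiff_const.sub (contDiff_id.inner ℝ contDiff_id)))
  have hy0 : ∀ x, ‖x‖ ≤ 1 → 0 < inner ℝ (y x) (y x) := fun x hx =>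
    real_inner_self_pos.2 (sub_ne_zero.2 (hne x hx).symm)
  -- This sign makes `D` positive on the sphere, so that its root is smooth there, and makes the
  -- larger root zero there.
  have hsphere : ∀ x, ‖x‖ = 1 → 0 < a x := by
    intro x hx
    have h1 : a x = 1 - inner ℝ x (h x) := by
      simp only [a, y, inner_sub_right, real_inner_self_eq_norm_sq, hx]; norm_num
    have h2 : inner ℝ x (h x) ≤ 1 := by
      refine (real_inner_le_norm _ _).trans ?_
      rw [hx, one_mul]; exact hB x hx.le
    have h3 : inner ℝ x (h x) ≠ 1 := by
      intro h3
      apply hne x hx.le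
      have h4 : ‖x - h x‖ ^ 2 ≤ 0 := by
        rw [norm_sub_sq_real, h3, hx]
        have := hB x hx.le
        nlinarith [norm_nonneg (h x)]
      have h5 : ‖x - h x‖ = 0 := by nlinarith [norm_nonneg (x - h x)]
      exact (sub_eq_zero.1 (norm_eq_zero.1 h5)).symm
    rw [h1]
    linarith [lt_of_le_of_ne h2 h3]
  have hD0 : ∀ x, ‖x‖ ≤ 1 → 0 < D x := by
    intro x hx
    have h1 := hy0 x hx
    rcases hx.lt_or_eq with hlt | heq
    · have h2 : 0 < 1 - inner ℝ x x := by
        rw [real_inner_self_eq_norm_sq]; nlinarith [norm_nonneg x]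
      have := mul_pos h1 h2
      simp only [D]; positivity
    · have h2 := hsphere x heq
      have h3 : (1 : ℝ) - inner ℝ x x = 0 := by
        rw [real_inner_self_eq_norm_sq, heq]; norm_num
      simp only [D, h3, mul_zero, add_zero]; positivity
  have hopen : IsOpen ({x | 0 < D x} ∩ {x | 0 < inner ℝ (y x) (y x)}) :=
    (isOpen_lt continuous_const hD.continuous).inter (isOpen_lt continuous_const hyy.continuous)
  refine not_exists_contDiff_retraction hopen (f := fun x => x + l x • y x) ?_ ?_ ?_ ?_
  · intro x hx
    have hx : ‖x‖ ≤ 1 := by simpa using hx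
    exact ⟨hD0 x hx, hy0 x hx⟩
  · intro x hx
    have h1 : ContDiffAt ℝ 1 l x :=
      (ha.contDiffAt.neg.add (hD.contDiffAt.sqrt hx.1.ne')).div hyy.contDiffAt hx.2.ne'
    exact (contDiffAt_id.add (h1.smul hy.contDiffAt)).contDiffWithinAt
  · intro x hx
    have hx : ‖x‖ ≤ 1 := by simpa using hx
    have h1 := hy0 x hx
    have h2 := Real.sq_sqrt (hD0 x hx).le
    have h4 : ‖x + l x • y x‖ ^ 2 = 1 := by
      rw [norm_add_sq_real, norm_smul, mul_pow, inner_smul_right, Real.norm_eq_abs, sq_abs,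
        ← real_inner_self_eq_norm_sq, ← real_inner_self_eq_norm_sq]
      have h5 : l x * inner ℝ (y x) (y x) = -a x + √(D x) := div_mul_cancel₀ _ h1.ne'
      have h6 : inner ℝ (y x) (y x) * (inner ℝ x x + 2 * (l x * a x) +
          l x ^ 2 * inner ℝ (y x) (y x) - 1) = 0 := by
        have : inner ℝ (y x) (y x) * (inner ℝ x x + 2 * (l x * a x) +
          l x ^ 2 * inner ℝ (y x) (y x) - 1) = (l x * inner ℝ (y x) (y x) + a x) ^ 2 - D x := by
          simp only [D]; ring
        rw [this, h5]; linear_combination h2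
      have := (mul_eq_zero.1 h6).resolve_left h1.ne'
      change inner ℝ x x + 2 * (l x * a x) + l x ^ 2 * inner ℝ (y x) (y x) = 1
      linarith
    exact (pow_eq_one_iff_of_nonneg (norm_nonneg _) two_ne_zero).1 h4
  · intro x hx
    have h1 : D x = a x ^ 2 := by
      have h3 : (1 : ℝ) - inner ℝ x x = 0 := by
        rw [real_inner_self_eq_norm_sq, hx]; norm_num
      simp only [D, h3, mul_zero, add_zero]
    have h2 : l x = 0 := by
      simp only [l, h1, Real.sqrt_sq (hsphere x hx).le]; simp
    simp [h2]

/-- Without a fixed point, `h` would move every point of the ball by at least some `δ > 0`. A smooth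
approximation within `δ / 4`, divided by `1 + δ / 4` so as to preserve the ball, has a fixed point,
and `h` moves that point by less than `δ`. -/
lemma exists_fixedPoint_of_norm_le_one {h : E → E} (hc : Continuous h) (hB : ∀ x, ‖h x‖ ≤ 1) :
    ∃ x, h x = x := by
  by_contra! hne
  obtain ⟨x₀, -, hx₀⟩ := (isCompact_closedBall (0 : E) 1).exists_isMinOn ⟨0, by simp⟩
    (f := fun x => ‖h x - x‖) (hc.sub continuous_id).norm.continuousOn
  set δ := ‖h x₀ - x₀‖ with hδ
  have hδ0 : 0 < δ := norm_pos_iff.2 (sub_ne_zero.2 (hne x₀))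
  have hmin : ∀ x, ‖x‖ ≤ 1 → δ ≤ ‖h x - x‖ := fun x hx => hx₀ (by simpa using hx)
  have hdense := ContinuousMap.dense_setOfPred_contDiff (E := E) (F := E) ⟨h, hc⟩
  rw [mem_closure_iff_nhds_basis (nhds_basis_uniformity
    Metric.uniformity_basis_dist.compactConvergenceUniformity)] at hdense
  obtain ⟨g, hg, hgh⟩ := hdense (Metric.closedBall 0 1, δ / 4)
    ⟨isCompact_closedBall _ _, by positivity⟩
  have hgh' : ∀ x, ‖x‖ ≤ 1 → ‖g x - h x‖ < δ / 4 := by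
    intro x hx
    have := hgh x (by simpa using hx)
    simpa [dist_eq_norm, norm_sub_rev] using this
  have hg1 : ∀ x, ‖x‖ ≤ 1 → ‖g x‖ ≤ 1 + δ / 4 := by
    intro x hx
    calc ‖g x‖ = ‖(g x - h x) + h x‖ := by rw [sub_add_cancel]
      _ ≤ ‖g x - h x‖ + ‖h x‖ := norm_add_le _ _
      _ ≤ _ := by linarith [hgh' x hx, hB x]
  have hε : 0 < 1 + δ / 4 := by positivity
  obtain ⟨x, hx, hfix⟩ := exists_fixedPoint_of_contDiff (h := fun x => (1 + δ / 4)⁻¹ • g x)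
    (((show ContDiff ℝ ((⊤ : ℕ∞) : WithTop ℕ∞) g from hg).of_le
      (by exact_mod_cast le_top)).const_smul _) (fun x hx => by
      rw [norm_smul, Real.norm_of_nonneg (by positivity), inv_mul_le_iff₀ hε, mul_one]
      exact hg1 x hx)
  have h1 : g x = (1 + δ / 4) • x := by
    nth_rewrite 2 [← hfix]
    rw [smul_inv_smul₀ hε.ne']
  have h2 : h x - x = (h x - g x) + (δ / 4) • x := by rw [h1]; module
  have h3 : ‖h x - x‖ < δ := by
    rw [h2]
    refine (norm_add_le _ _).trans_lt ?_
    rw [norm_smul, Real.norm_of_nonneg (by positivity), norm_sub_rev]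
    have := hgh' x hx
    nlinarith
  linarith [hmin x hx]
end

/-- **Brouwer's fixed point theorem**, for a bounded continuous map of a finite-dimensional
space to itself. -/
theorem exists_fixedPoint_of_bounded {E : Type*} [NormedAddCommGroup E] [NormedSpace ℝ E]
    [FiniteDimensional ℝ E] {F : E → E} (hF : Continuous F)
    (hb : ∃ R, ∀ x, ‖F x‖ ≤ R) : ∃ x, F x = x := by
  obtain ⟨R, hR⟩ := hb
  let e := toEuclidean (E := E)
  let C := ‖e.toContinuousLinearMap‖ * R + 1
  have hR0 : 0 ≤ R := (norm_nonneg _).trans (hR 0)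
  have hC : 0 < C := by positivity
  obtain ⟨x, hx⟩ := exists_fixedPoint_of_norm_le_one
    (h := fun x => C⁻¹ • e (F (e.symm (C • x))))
    (by fun_prop)
    (fun x => by
      rw [norm_smul, Real.norm_of_nonneg (by positivity), inv_mul_le_iff₀ hC, mul_one]
      have h1 := e.toContinuousLinearMap.le_opNorm_of_le (hR (e.symm (C • x)))
      exact h1.trans (by simp [C]))
  refine ⟨e.symm (C • x), ?_⟩
  apply e.injective
  rw [e.apply_symm_apply]
  nth_rewrite 2 [← hx]
  rw [smul_inv_smul₀ hC.ne']

/-! ### Continuous logarithms, in the role of vanishing first cohomology -/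

/-- Every nonvanishing continuous complex-valued function on `X` has a continuous logarithm. -/
def HasLogarithms {E : Type*} [TopologicalSpace E] (X : Set E) : Prop :=
  ∀ g : E → ℂ, ContinuousOn g X → (∀ x ∈ X, g x ≠ 0) →
    ∃ f : E → ℂ, ContinuousOn f X ∧ ∀ x ∈ X, Complex.exp (f x) = g x

/-- Maps from a simply connected, locally path connected set lift through the covering `exp` of the
punctured plane. -/
lemma IsSimplyConnected.hasLogarithms {E : Type*} [TopologicalSpace E]
    [LocallyPathConnectedSpace E] {X : Set E} (hX : IsSimplyConnected X) (hXo : IsOpen X) :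
    HasLogarithms X := by
  intro g hg h0
  obtain ⟨f, hf, hfg⟩ := Complex.exists_continuousOn_eqOn_exp_comp hX hXo hg
    (by rintro ⟨x, hx, hx0⟩; exact h0 x hx hx0)
  exact ⟨f, hf, fun x hx => hfg hx⟩

/-- `f` takes values in the discrete group generated by `2πi`. -/
lemma IsPreconnected.eq_of_exp_eq_one {E : Type*} [TopologicalSpace E] {S : Set E}
    (hS : IsPreconnected S) {f : E → ℂ} (hf : ContinuousOn f S)
    (h1 : ∀ x ∈ S, Complex.exp (f x) = 1) {x y : E} (hx : x ∈ S) (hy : y ∈ S) : f x = f y := by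
  have hd : DiscreteTopology
      (AddSubgroup.zmultiples (2 * Real.pi * Complex.I : ℂ) : Set ℂ) :=
    inferInstanceAs (DiscreteTopology (AddSubgroup.zmultiples (2 * Real.pi * Complex.I : ℂ)))
  refine hS.constant_of_mapsTo
    (T := (AddSubgroup.zmultiples (2 * Real.pi * Complex.I : ℂ) : Set ℂ)) ⟨hd⟩
    hf (fun z hz => ?_) hx hy
  obtain ⟨n, hn⟩ := Complex.exp_eq_one_iff.1 (h1 z hz)
  exact ⟨n, by simp [hn]⟩

/-- This is the Mayer–Vietoris argument: on a connected overlap two logarithms differ by a constant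
period, which can be added to one of them. -/
lemma HasLogarithms.union {E : Type*} [TopologicalSpace E] {A B : Set E}
    (hA : HasLogarithms A) (hB : HasLogarithms B) (hAo : IsOpen A) (hBo : IsOpen B)
    (hAB : IsPreconnected (A ∩ B)) : HasLogarithms (A ∪ B) := by
  classical
  intro g hg h0
  obtain ⟨fA, hfA, hA'⟩ := hA g (hg.mono subset_union_left) fun x hx => h0 x (Or.inl hx)
  obtain ⟨fB, hfB, hB'⟩ := hB g (hg.mono subset_union_right) fun x hx => h0 x (Or.inr hx)
  have hconst : ∃ c, Complex.exp c = 1 ∧ ∀ x ∈ A ∩ B, fA x = fB x + c := by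
    have h1 : ∀ x ∈ A ∩ B, Complex.exp (fA x - fB x) = 1 := fun x hx => by
      rw [Complex.exp_sub, hA' x hx.1, hB' x hx.2, div_self (h0 x (Or.inl hx.1))]
    rcases (A ∩ B).eq_empty_or_nonempty with h | ⟨y, hy⟩
    · exact ⟨0, by simp, by simp [h]⟩
    · refine ⟨fA y - fB y, h1 y hy, fun x hx => ?_⟩
      have := hAB.eq_of_exp_eq_one (f := fun x => fA x - fB x)
        ((hfA.mono inter_subset_left).sub (hfB.mono inter_subset_right)) h1 hx hy
      linear_combination this
  obtain ⟨c, hc1, hc⟩ := hconst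
  let f : E → ℂ := fun x => if x ∈ A then fA x else fB x + c
  have hfa : EqOn f fA A := fun x hx => if_pos hx
  have hfb : EqOn f (fun x => fB x + c) B := fun x hx => by
    by_cases hxA : x ∈ A
    · rw [hfa hxA]; exact hc x ⟨hxA, hx⟩
    · exact if_neg hxA
  refine ⟨f, ContinuousOn.union_of_isOpen (hfA.congr hfa)
    ((hfB.add continuousOn_const).congr hfb) hAo hBo, ?_⟩
  rintro x (hx | hx)
  · rw [hfa hx, hA' x hx]
  · rw [hfb hx, Complex.exp_add, hB' x hx, hc1, mul_one]

/-! ### Punctured balls in dimension at least three -/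

section PuncturedBall
variable {E : Type*} [NormedAddCommGroup E] [NormedSpace ℝ E]

/-- The slit ball is star-shaped about `p - s • e`, a point on the opposite half-line at half the
radius, so it is contractible. -/
lemma hasLogarithms_ball_diff_ray {p e : E} {r : ℝ} (hr : 0 < r) (he : e ≠ 0) :
    IsOpen (Metric.ball p r \ (fun t : ℝ => p + t • e) '' Ici 0) ∧
    HasLogarithms (Metric.ball p r \ (fun t : ℝ => p + t • e) '' Ici 0) := by
  have hcl : IsClosed ((fun t : ℝ => p + t • e) '' Ici 0) := by
    have h1 : IsClosed ((fun t : ℝ => t • e) '' Ici 0) :=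
      (isClosedEmbedding_smul_left he).isClosedMap _ isClosed_Ici
    have h2 := (Homeomorph.addLeft p).isClosedMap _ h1
    rwa [image_image] at h2
  have hopen := Metric.isOpen_ball (x := p) (ε := r) |>.sdiff hcl
  refine ⟨hopen, ?_⟩
  set s := r / (2 * ‖e‖)
  have hen : 0 < ‖e‖ := norm_pos_iff.2 he
  have hs : 0 < s := by positivity
  have hcenter : p - s • e ∈ Metric.ball p r := by
    rw [mem_ball_iff_norm, sub_sub_cancel_left, norm_neg, norm_smul, Real.norm_of_nonneg hs.le]
    have : s * ‖e‖ = r / 2 := by simp only [s]; field_simp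
    rw [this]; linarith
  have hstar : StarConvex ℝ (p - s • e)
      (Metric.ball p r \ (fun t : ℝ => p + t • e) '' Ici 0) := by
    intro y hy a b ha hb hab
    refine ⟨(convex_ball p r) hcenter hy.1 ha hb hab, ?_⟩
    rintro ⟨t, ht, hte⟩
    simp only [mem_Ici] at ht
    simp only at hte
    rcases hb.eq_or_lt with rfl | hb
    · have ha1 : a = 1 := by linarith
      subst ha1
      have h1 : (t + s) • e = 0 := by
        have : p + t • e = p - s • e := by simpa using hte
        rw [add_smul]; rw [sub_eq_add_neg] at this
        rw [add_left_cancel this]; simp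
      rcases smul_eq_zero.1 h1 with h | h
      · linarith
      · exact he h
    · apply hy.2
      refine ⟨(t + a * s) / b, by simp only [mem_Ici]; positivity, ?_⟩
      have ha' : a = 1 - b := by linarith
      have h1 : b • y = b • p + (t + a * s) • e := by
        have : b • y = (p + t • e) - a • (p - s • e) := by rw [hte]; abel
        rw [this, ha']; module
      have h2 : y = b⁻¹ • (b • y) := (inv_smul_smul₀ hb.ne' y).symm
      simp only
      rw [h2, h1, smul_add, inv_smul_smul₀ hb.ne', smul_smul, div_eq_inv_mul]
  have hc := hstar.contractibleSpace ⟨p - s • e, hcenter, by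
    rintro ⟨t, ht, hte⟩
    simp only [mem_Ici] at ht
    simp only at hte
    have h1 : (t + s) • e = 0 := by
      rw [sub_eq_add_neg] at hte
      rw [add_smul, add_left_cancel hte]; simp
    rcases smul_eq_zero.1 h1 with h | h
    · linarith
    · exact he h⟩
  have hsc : IsSimplyConnected (Metric.ball p r \ (fun t : ℝ => p + t • e) '' Ici 0) := by
    unfold IsSimplyConnected
    exact SimplyConnectedSpace.ofContractible _
  exact hsc.hasLogarithms hopen

/-- The complement of the line is connected since its codimension exceeds one. The radial map `φ`
carries the space onto the ball and respects lines through the centre. -/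
lemma isPreconnected_ball_diff_line [FiniteDimensional ℝ E] (hE : 2 < Module.finrank ℝ E)
    (p e : E) {r : ℝ} (hr : 0 < r) :
    IsPreconnected {x ∈ Metric.ball p r | x - p ∉ Submodule.span ℝ {e}} := by
  have hcod : 1 < Module.rank ℝ (E ⧸ Submodule.span ℝ {e}) := by
    have h1 := Submodule.finrank_quotient_add_finrank (Submodule.span ℝ {e})
    have h2 : Module.finrank ℝ (Submodule.span ℝ {e}) ≤ 1 := by
      simpa using finrank_span_le_card ({e} : Set E)
    rw [← Module.finrank_eq_rank]
    exact_mod_cast (show 1 < Module.finrank ℝ (E ⧸ Submodule.span ℝ {e}) by omega)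
  have hconn := (isConnected_compl_of_one_lt_codim hcod).isPreconnected
  let φ : E → E := fun x => p + r • ((√(1 + ‖x‖ ^ 2))⁻¹ • x)
  have hφ : Continuous φ := by
    have : ∀ x : E, √(1 + ‖x‖ ^ 2) ≠ 0 := fun x => by positivity
    fun_prop (disch := assumption)
  convert! hconn.image φ hφ.continuousOn using 1
  ext z
  constructor
  · rintro ⟨hz, hzl⟩
    have hz' : ‖z - p‖ < r := mem_ball_iff_norm.1 hz
    -- The preimage of `z` under `φ` is `(z - p) / √d`.
    set d := r ^ 2 - ‖z - p‖ ^ 2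
    have hd : 0 < d := by
      have := norm_nonneg (z - p)
      simp only [d]; nlinarith
    refine ⟨(√d)⁻¹ • (z - p), fun hmem => hzl ?_, ?_⟩
    · have := (Submodule.span ℝ {e}).smul_mem (√d) hmem
      rwa [smul_inv_smul₀ (Real.sqrt_pos.2 hd).ne'] at this
    · have h1 : 1 + ‖(√d)⁻¹ • (z - p)‖ ^ 2 = (r / √d) ^ 2 := by
        rw [norm_smul, mul_pow, norm_inv, inv_pow, Real.norm_of_nonneg (Real.sqrt_nonneg _),
          div_pow, Real.sq_sqrt hd.le]
        field_simp
        simp only [d]; ring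
      simp only [φ]
      rw [h1, Real.sqrt_sq (by positivity), smul_smul, smul_smul, inv_div]
      have : r * (√d / r) * (√d)⁻¹ = 1 := by
        have := (Real.sqrt_pos.2 hd).ne'
        field_simp
      rw [this, one_smul]; abel
  · rintro ⟨x, hx, rfl⟩
    have hpos : 0 < √(1 + ‖x‖ ^ 2) := by positivity
    refine ⟨?_, fun hmem => hx ?_⟩
    · simp only [φ]
      rw [mem_ball_iff_norm, add_sub_cancel_left, norm_smul, norm_smul,
        Real.norm_of_nonneg hr.le, Real.norm_of_nonneg (by positivity)]
      have h1 : ‖x‖ < √(1 + ‖x‖ ^ 2) := Real.lt_sqrt_of_sq_lt (by linarith)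
      have h2 : (√(1 + ‖x‖ ^ 2))⁻¹ * ‖x‖ < 1 := by
        rw [inv_mul_lt_iff₀ hpos, mul_one]; exact h1
      nlinarith
    · simp only [φ, add_sub_cancel_left] at hmem
      have := (Submodule.span ℝ {e}).smul_mem (√(1 + ‖x‖ ^ 2) * r⁻¹) hmem
      rw [smul_smul, smul_smul] at this
      have h3 : √(1 + ‖x‖ ^ 2) * r⁻¹ * r * (√(1 + ‖x‖ ^ 2))⁻¹ = 1 := by field_simp
      rwa [h3, one_smul] at this

/-- Two balls slit along opposite rays cover the punctured ball, and they meet in the ball without a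
line, which is connected. -/
lemma hasLogarithms_ball_diff_singleton [FiniteDimensional ℝ E] (hE : 2 < Module.finrank ℝ E)
    (p : E) {r : ℝ} (hr : 0 < r) : HasLogarithms (Metric.ball p r \ {p}) := by
  have : Nontrivial E := Module.nontrivial_of_finrank_pos (R := ℝ) (by omega)
  obtain ⟨e, he⟩ := exists_ne (0 : E)
  obtain ⟨hAo, hA⟩ := hasLogarithms_ball_diff_ray (p := p) hr he
  obtain ⟨hBo, hB⟩ := hasLogarithms_ball_diff_ray (p := p) hr (neg_ne_zero.2 he)
  have hU := hA.union hB hAo hBo (by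
    convert! isPreconnected_ball_diff_line hE p e hr using 1
    ext z
    constructor
    · rintro ⟨⟨hz, h1⟩, ⟨-, h2⟩⟩
      refine ⟨hz, fun hmem => ?_⟩
      obtain ⟨t, ht⟩ := Submodule.mem_span_singleton.1 hmem
      rcases le_total 0 t with h | h
      · exact h1 ⟨t, h, by simp only; rw [ht]; abel⟩
      · exact h2 ⟨-t, by simpa using h, by simp only [neg_smul_neg]; rw [ht]; abel⟩
    · rintro ⟨hz, hzl⟩
      refine ⟨⟨hz, ?_⟩, hz, ?_⟩
      · rintro ⟨t, -, rfl⟩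
        exact hzl (Submodule.mem_span_singleton.2 ⟨t, by simp⟩)
      · rintro ⟨t, -, rfl⟩
        exact hzl (Submodule.mem_span_singleton.2 ⟨-t, by simp⟩))
  convert! hU using 1
  ext z
  constructor
  · rintro ⟨hz, hzp⟩
    by_cases h : z ∈ (fun t : ℝ => p + t • e) '' Ici 0
    · right
      refine ⟨hz, ?_⟩
      obtain ⟨t, ht, rfl⟩ := h
      rintro ⟨t', ht', h'⟩
      simp only [mem_Ici] at ht ht'
      simp only [smul_neg] at h'
      apply hzp
      have h1 : (t' + t) • e = 0 := by
        have := add_left_cancel h'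
        rw [add_smul, ← this]; simp
      rcases smul_eq_zero.1 h1 with h | h
      · have : t = 0 := by linarith
        simp [this]
      · exact absurd h he
    · exact Or.inl ⟨hz, h⟩
  · rintro (⟨hz, h⟩ | ⟨hz, h⟩) <;>
    · refine ⟨hz, ?_⟩
      rintro rfl
      exact h ⟨0, by simp, by simp⟩
end PuncturedBall

/-! ### Čech cocycles on finite closed covers -/

section Cech
variable {E : Type*} [MetricSpace E] {ι : Type*} [Finite ι] {X : Set E} {K : ι → Set E}

/-- An integral cocycle on a finite closed cover with connected members is a coboundary if all
nonvanishing functions have logarithms. -/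
lemma HasLogarithms.exists_int_coboundary (hX : HasLogarithms X) (hcl : ∀ i, IsClosed (K i))
    (hne : ∀ i, (K i).Nonempty) (hcov : X ⊆ ⋃ i, K i) (hconn : ∀ i, IsPreconnected (K i ∩ X))
    {c : ι → ι → ℤ}
    (hc : ∀ x ∈ X, ∀ i j k, x ∈ K i → x ∈ K j → x ∈ K k → c i j + c j k = c i k) :
    ∃ n : ι → ℤ, ∀ i j, (K i ∩ K j ∩ X).Nonempty → c i j = n j - n i := by
  classical
  have := Fintype.ofFinite ι
  rcases isEmpty_or_nonempty ι with hι | hι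
  · exact ⟨fun _ => 0, fun i => isEmptyElim i⟩
  -- These are the simplices of the nerve: families of members with a common point in `X`.
  let good : Finset (Finset ι) :=
    Finset.univ.filter fun S => (∃ i, i ∈ S) ∧ ∃ x ∈ X, ∀ i ∈ S, x ∈ K i
  have hgood : ∀ S ∈ good, (∃ i, i ∈ S) ∧ ∃ x ∈ X, ∀ i ∈ S, x ∈ K i := fun S hS => by
    simpa [good] using hS
  choose! pick hpick using fun S hS => (hgood S hS).1
  -- The weight `ψ S` vanishes on every `K i` with `i ∉ S`. Where it is nonzero, `S` contains the
  -- index of every member through `y`.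
  let ψ : Finset ι → E → ℝ := fun S y => ∏ i ∈ Sᶜ, Metric.infDist y (K i)
  have hψc : ∀ S, Continuous (ψ S) := fun S =>
    continuous_finsetProd _ fun i _ => Metric.continuous_infDist_pt _
  have hψ0 : ∀ S y, 0 ≤ ψ S y := fun S y => Finset.prod_nonneg fun i _ => Metric.infDist_nonneg
  have hψmem : ∀ S y i, ψ S y ≠ 0 → y ∈ K i → i ∈ S := by
    intro S y i hS hy
    by_contra hi
    exact hS (Finset.prod_eq_zero (Finset.mem_compl.2 hi) (Metric.infDist_zero_of_mem hy))
  let σ : E → ℝ := fun y => ∑ S ∈ good, ψ S y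
  have hσc : Continuous σ := continuous_finsetSum _ fun S _ => hψc S
  have hσ : ∀ y ∈ X, σ y ≠ 0 := by
    intro y hy
    let S : Finset ι := Finset.univ.filter fun i => y ∈ K i
    have hS : S ∈ good := by
      obtain ⟨i, hi⟩ := mem_iUnion.1 (hcov hy)
      simp only [good, S, Finset.mem_filter, Finset.mem_univ, true_and]
      exact ⟨⟨i, hi⟩, y, hy, fun j hj => hj⟩
    have hpos : 0 < ψ S y := Finset.prod_pos fun i hi =>
      ((hcl i).notMem_iff_infDist_pos (hne i)).1 (by simpa [S] using hi)
    exact (Finset.sum_pos' (fun T _ => hψ0 T y) ⟨S, hS, hpos⟩).ne'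
  -- Averaging the cocycle makes it a coboundary of continuous real functions: on `K i ∩ K j`, a
  -- weight alive at `y` has `i`, `j` and `pick S` in `S`, and the cocycle identity applies to these
  -- three.
  let g : ι → E → ℝ := fun i y => (∑ S ∈ good, ψ S y * c i (pick S)) / σ y
  have hgc : ∀ i, ContinuousOn (g i) X := fun i =>
    (continuous_finsetSum _ fun S _ => (hψc S).mul continuous_const).continuousOn.div
      hσc.continuousOn hσ
  have hgg : ∀ y ∈ X, ∀ i j, y ∈ K i → y ∈ K j → g i y - g j y = c i j := by
    intro y hy i j hi hj
    have : (∑ S ∈ good, ψ S y * (c i (pick S) : ℝ)) - ∑ S ∈ good, ψ S y * (c j (pick S) : ℝ) =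
        c i j * σ y := by
      rw [← Finset.sum_sub_distrib, Finset.mul_sum]
      refine Finset.sum_congr rfl fun S hS => ?_
      by_cases h0 : ψ S y = 0
      · simp [h0]
      · obtain ⟨x, hx, hxS⟩ := (hgood S hS).2
        have := hc x hx i j (pick S) (hxS i (hψmem S y i h0 hi)) (hxS j (hψmem S y j h0 hj))
          (hxS _ (hpick S hS))
        rw [← this]; push_cast; ring
    simp only [g]
    rw [← sub_div, this, mul_div_cancel_right₀ _ (hσ y hy)]
  have hidx : ∀ y ∈ X, ∃ i, y ∈ K i := fun y hy => mem_iUnion.1 (hcov hy)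
  choose! idx hidx using hidx
  have hper : ∀ y ∈ X, ∀ i j, y ∈ K i → y ∈ K j →
      Complex.exp (2 * Real.pi * Complex.I * g i y) =
        Complex.exp (2 * Real.pi * Complex.I * g j y) := by
    intro y hy i j hi hj
    rw [Complex.exp_eq_exp_iff_exists_int]
    refine ⟨c i j, ?_⟩
    have : (g i y : ℂ) - g j y = c i j := by exact_mod_cast congrArg (fun r : ℝ => (r : ℂ)) (hgg y hy i j hi hj)
    linear_combination (2 * Real.pi * Complex.I) * this
  -- Since the `c i j` are integers, the exponentials of the `g i` agree on overlaps and glue to one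
  -- function.
  let G : E → ℂ := fun y => Complex.exp (2 * Real.pi * Complex.I * g (idx y) y)
  have hG : ContinuousOn G X := by
    rw [continuousOn_iff_continuous_domRestrict]
    refine (locallyFinite_of_finite fun i => (Subtype.val ⁻¹' K i : Set X)).continuous ?_
      (fun i => (hcl i).preimage continuous_subtype_val) fun i => ?_
    · refine eq_univ_of_forall fun y => ?_
      exact mem_iUnion.2 ⟨idx y, hidx y y.2⟩
    · have h1 : ContinuousOn (fun y : X => Complex.exp (2 * Real.pi * Complex.I * g i y))
          (Subtype.val ⁻¹' K i) := by
        have h2 : Continuous fun y : X => g i y := (hgc i).domRestrict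
        exact (Complex.continuous_exp.comp
          (continuous_const.mul (Complex.continuous_ofReal.comp h2))).continuousOn
      exact h1.congr fun y hy => hper y y.2 _ _ (hidx y y.2) hy
  obtain ⟨f, hf, hfG⟩ := hX G hG fun y _ => Complex.exp_ne_zero _
  have hone : ∀ i, ∀ y ∈ K i ∩ X,
      Complex.exp (f y - 2 * Real.pi * Complex.I * g i y) = 1 := by
    intro i y hy
    rw [Complex.exp_sub, hfG y hy.2, hper y hy.2 i _ hy.1 (hidx y hy.2),
      div_self (Complex.exp_ne_zero _)]
  -- On the connected set `K i ∩ X` the logarithm of `G` differs from `2πi g i` by a constant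
  -- period. These periods form the integral cochain sought.
  have hn : ∀ i, ∃ n : ℤ, ∀ y ∈ K i ∩ X, f y - 2 * Real.pi * Complex.I * g i y =
      n * (2 * Real.pi * Complex.I) := by
    intro i
    rcases (K i ∩ X).eq_empty_or_nonempty with h | ⟨x, hx⟩
    · exact ⟨0, by simp [h]⟩
    · obtain ⟨n, hn⟩ := Complex.exp_eq_one_iff.1 (hone i x hx)
      refine ⟨n, fun y hy => ?_⟩
      rw [← hn]
      refine (hconn i).eq_of_exp_eq_one
        (f := fun y => f y - 2 * Real.pi * Complex.I * g i y)
        ((hf.mono inter_subset_right).sub (continuousOn_const.mul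
          (Complex.continuous_ofReal.comp_continuousOn ((hgc i).mono inter_subset_right))))
        (hone i) hy hx
  choose n hn using hn
  refine ⟨n, fun i j ⟨y, ⟨hi, hj⟩, hy⟩ => ?_⟩
  have h1 := hn i y ⟨hi, hy⟩
  have h2 := hn j y ⟨hj, hy⟩
  have h3 : (g i y : ℂ) - g j y = c i j := by
    exact_mod_cast congrArg (fun r : ℝ => (r : ℂ)) (hgg y hy i j hi hj)
  have h4 : (2 * Real.pi * Complex.I : ℂ) ≠ 0 := Complex.two_pi_I_ne_zero
  have h5 : (c i j : ℂ) = n j - n i := by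
    apply mul_left_cancel₀ h4
    rw [← h3]
    linear_combination h2 - h1
  exact_mod_cast h5

/-- Multiplication by a common denominator reduces this to integral cocycles. -/
lemma HasLogarithms.exists_rat_coboundary (hX : HasLogarithms X) (hcl : ∀ i, IsClosed (K i))
    (hne : ∀ i, (K i).Nonempty) (hcov : X ⊆ ⋃ i, K i) (hconn : ∀ i, IsPreconnected (K i ∩ X))
    {c : ι → ι → ℚ}
    (hc : ∀ x ∈ X, ∀ i j k, x ∈ K i → x ∈ K j → x ∈ K k → c i j + c j k = c i k) :
    ∃ n : ι → ℚ, ∀ i j, (K i ∩ K j ∩ X).Nonempty → c i j = n j - n i := by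
  obtain ⟨b, hb⟩ := IsLocalization.exist_integer_multiples_of_finite (nonZeroDivisors ℤ)
    (fun p : ι × ι => c p.1 p.2)
  choose z hz using hb
  have hb0 : ((b : ℤ) : ℚ) ≠ 0 := by exact_mod_cast nonZeroDivisors.ne_zero b.2
  have hz' : ∀ i j, (z (i, j) : ℚ) = (b : ℤ) * c i j := fun i j => by
    simpa [Submonoid.smul_def] using hz (i, j)
  obtain ⟨n, hn⟩ := hX.exists_int_coboundary hcl hne hcov hconn (c := fun i j => z (i, j))
    (fun x hx i j k hi hj hk => by
      have : (z (i, j) : ℚ) + z (j, k) = z (i, k) := by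
        rw [hz', hz', hz', ← hc x hx i j k hi hj hk]; ring
      exact_mod_cast this)
  refine ⟨fun i => n i / (b : ℤ), fun i j hij => ?_⟩
  have h1 : (z (i, j) : ℚ) = n j - n i := by exact_mod_cast congrArg (fun r : ℤ => (r : ℚ)) (hn i j hij)
  rw [hz'] at h1
  field_simp
  linarith

/-- A real cocycle on a finite closed cover with connected members is a coboundary if all
nonvanishing functions have logarithms. -/
theorem HasLogarithms.exists_real_coboundary (hX : HasLogarithms X) (hcl : ∀ i, IsClosed (K i))
    (hne : ∀ i, (K i).Nonempty) (hcov : X ⊆ ⋃ i, K i) (hconn : ∀ i, IsPreconnected (K i ∩ X))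
    {c : ι → ι → ℝ}
    (hc : ∀ x ∈ X, ∀ i j k, x ∈ K i → x ∈ K j → x ∈ K k → c i j + c j k = c i k) :
    ∃ n : ι → ℝ, ∀ i j, (K i ∩ K j ∩ X).Nonempty → c i j = n j - n i := by
  classical
  have := Fintype.ofFinite ι
  -- Each coordinate in a Hamel basis is a rational cocycle, and only finitely many coordinates
  -- occur.
  let b := Module.Basis.ofVectorSpace ℚ ℝ
  have h : ∀ e, ∃ n : ι → ℚ, ∀ i j, (K i ∩ K j ∩ X).Nonempty → b.repr (c i j) e = n j - n i :=
    fun e => hX.exists_rat_coboundary hcl hne hcov hconn fun x hx i j k hi hj hk => by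
      rw [← hc x hx i j k hi hj hk, map_add, Finsupp.add_apply]
  choose n hn using h
  let s := Finset.univ.biUnion fun p : ι × ι => (b.repr (c p.1 p.2)).support
  refine ⟨fun i => ∑ e ∈ s, n e i • b e, fun i j hij => ?_⟩
  rw [← Finset.sum_sub_distrib]
  calc c i j = ∑ e ∈ s, b.repr (c i j) e • b e := by
        conv_lhs => rw [← b.linearCombination_repr (c i j), Finsupp.linearCombination_apply]
        refine Finsupp.sum_of_support_subset _ ?_ _ (by simp)
        exact Finset.subset_biUnion_of_mem (fun p : ι × ι => (b.repr (c p.1 p.2)).support)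
          (Finset.mem_univ (i, j))
    _ = _ := Finset.sum_congr rfl fun e _ => by rw [hn e i j hij, sub_smul]
end Cech

/-! ### Barycentric coordinates and the geometry of elements -/

namespace SimplicialMesh
variable {N : ℕ} {Ω : Set (Euc N)} {T : SimplicialMesh Ω}

noncomputable section
open Classical in
instance : DecidableEq T.Cell := fun _ _ => Classical.propDecidable _

namespace Cell

lemma ext {K K' : T.Cell} (h : K.1 = K'.1) : K = K' := Subtype.ext h

lemma affineSpan_eq_top (K : T.Cell) : affineSpan ℝ (range ((↑) : K.1 → Euc N)) = ⊤ := by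
  rw [(T.indep K.2.1).affineSpan_eq_top_iff_card_eq_finrank_add_one]
  simpa using K.2.2

/-- The vertices of an element, as an affine basis of the space. -/
def affineBasis (K : T.Cell) : AffineBasis K.1 ℝ (Euc N) :=
  ⟨(↑), T.indep K.2.1, K.affineSpan_eq_top⟩

lemma affineBasis_apply (K : T.Cell) (i : K.1) : K.affineBasis i = i := rfl

open Classical in
/-- The barycentric coordinate of `x` in the element `K` for the vertex `p` of `K`
(zero if `p` is not a vertex of `K`). -/
def bary (K : T.Cell) (p x : Euc N) : ℝ :=
  if h : p ∈ K.1 then K.affineBasis.coord ⟨p, h⟩ x else 0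

lemma bary_of_mem (K : T.Cell) {p : Euc N} (h : p ∈ K.1) (x : Euc N) :
    K.bary p x = K.affineBasis.coord ⟨p, h⟩ x := dif_pos h

lemma bary_of_notMem (K : T.Cell) {p : Euc N} (h : p ∉ K.1) (x : Euc N) :
    K.bary p x = 0 := dif_neg h

lemma exists_grad (K : T.Cell) (p : Euc N) :
    ∃ g : Euc N, ∀ x y, K.bary p x - K.bary p y = inner ℝ g (x - y) := by
  by_cases h : p ∈ K.1
  · refine ⟨(InnerProductSpace.toDual ℝ _).symm
      (K.affineBasis.coord ⟨p, h⟩).linear.toContinuousLinearMap, fun x y => ?_⟩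
    rw [InnerProductSpace.toDual_symm_apply, K.bary_of_mem h, K.bary_of_mem h]
    exact ((K.affineBasis.coord ⟨p, h⟩).linearMap_vsub x y).symm
  · exact ⟨0, fun x y => by simp [K.bary_of_notMem h]⟩

/-- The gradient of a barycentric coordinate. -/
def grad (K : T.Cell) (p : Euc N) : Euc N := (K.exists_grad p).choose

lemma bary_sub_bary (K : T.Cell) (p x y : Euc N) :
    K.bary p x - K.bary p y = inner ℝ (K.grad p) (x - y) := (K.exists_grad p).choose_spec x y

lemma bary_eq (K : T.Cell) (p x : Euc N) :
    K.bary p x = inner ℝ (K.grad p) x + K.bary p 0 := by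
  have := K.bary_sub_bary p x 0
  rw [sub_zero] at this; linarith

lemma continuous_bary (K : T.Cell) (p : Euc N) : Continuous (K.bary p) := by
  rw [funext (K.bary_eq p)]
  fun_prop

open Classical in
lemma bary_vertex (K : T.Cell) {p q : Euc N} (hp : p ∈ K.1) (hq : q ∈ K.1) :
    K.bary p q = if p = q then 1 else 0 := by
  have := K.affineBasis.coord_apply ⟨p, hp⟩ ⟨q, hq⟩
  rw [K.bary_of_mem hp]
  simpa [affineBasis_apply] using this

lemma bary_self (K : T.Cell) {p : Euc N} (hp : p ∈ K.1) : K.bary p p = 1 := by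
  rw [K.bary_vertex hp hp, if_pos rfl]

lemma bary_vertex_of_ne (K : T.Cell) {p q : Euc N} (hq : q ∈ K.1) (h : p ≠ q) :
    K.bary p q = 0 := by
  by_cases hp : p ∈ K.1
  · rw [K.bary_vertex hp hq, if_neg h]
  · exact K.bary_of_notMem hp q

lemma sum_bary (K : T.Cell) (x : Euc N) : ∑ p ∈ K.1, K.bary p x = 1 := by
  rw [← Finset.sum_coe_sort, ← K.affineBasis.sum_coord_apply_eq_one x]
  exact Finset.sum_congr rfl fun p _ => K.bary_of_mem p.2 x

lemma sum_bary_smul (K : T.Cell) (x : Euc N) : ∑ p ∈ K.1, K.bary p x • p = x := by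
  conv_rhs => rw [← K.affineBasis.linear_combination_coord_eq_self x]
  rw [← Finset.sum_coe_sort]
  exact Finset.sum_congr rfl fun p _ => by rw [K.bary_of_mem p.2 x, affineBasis_apply]

lemma sum_inner_grad (K : T.Cell) (v : Euc N) : ∑ p ∈ K.1, inner ℝ (K.grad p) v = 0 := by
  have h := fun p => K.bary_sub_bary p v 0
  simp only [sub_zero] at h
  simp only [← h, Finset.sum_sub_distrib, sum_bary, sub_self]

lemma sum_inner_grad_smul (K : T.Cell) (v : Euc N) :
    ∑ p ∈ K.1, inner ℝ (K.grad p) v • p = v := by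
  have h := fun p => K.bary_sub_bary p v 0
  simp only [sub_zero] at h
  simp only [← h, sub_smul, Finset.sum_sub_distrib, sum_bary_smul, sub_zero]

lemma range_affineBasis (K : T.Cell) : range K.affineBasis = (K.1 : Set (Euc N)) :=
  Subtype.range_coe

lemma mem_carrier (K : T.Cell) {x : Euc N} : x ∈ K.carrier ↔ ∀ p ∈ K.1, 0 ≤ K.bary p x := by
  have := K.affineBasis.convexHull_eq_nonneg_coord
  rw [range_affineBasis] at this
  rw [carrier, this]
  simp only [Set.mem_ofPred_eq, Subtype.forall]
  exact forall₂_congr fun p hp => by rw [K.bary_of_mem hp]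

lemma mem_interior (K : T.Cell) {x : Euc N} :
    x ∈ interior K.carrier ↔ ∀ p ∈ K.1, 0 < K.bary p x := by
  have := K.affineBasis.interior_convexHull
  rw [range_affineBasis] at this
  rw [carrier, this]
  simp only [Set.mem_ofPred_eq, Subtype.forall]
  exact forall₂_congr fun p hp => by rw [K.bary_of_mem hp]

lemma isCompact_carrier (K : T.Cell) : IsCompact K.carrier :=
  K.1.finite_toSet.isCompact_convexHull ℝ

lemma convex_carrier (K : T.Cell) : Convex ℝ K.carrier := convex_convexHull ℝ _

lemma subset_carrier (K : T.Cell) : (K.1 : Set (Euc N)) ⊆ K.carrier := subset_convexHull ℝ _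

lemma interior_nonempty (K : T.Cell) : (interior K.carrier).Nonempty := by
  rw [carrier, interior_convexHull_nonempty_iff_affineSpan_eq_top]
  have := K.affineSpan_eq_top
  rwa [Subtype.range_coe] at this

lemma subset_closure_interior (K : T.Cell) : K.carrier ⊆ closure (interior K.carrier) := by
  rw [K.convex_carrier.closure_interior_eq_closure_of_nonempty_interior K.interior_nonempty]
  exact subset_closure

/-- A point of the hull of some vertices of an element has no other barycentric coordinates. -/
lemma bary_eq_zero_of_mem_convexHull (K : T.Cell) {s : Set (Euc N)} (hs : s ⊆ K.1) {x p : Euc N}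
    (hx : x ∈ convexHull ℝ s) (hp : p ∉ s) : K.bary p x = 0 := by
  have hconv : Convex ℝ {x | K.bary p x = 0} := by
    have : {x | K.bary p x = 0} =
        {x | (innerSL ℝ (K.grad p)) x = -K.bary p 0} := by
      ext x; simp only [Set.mem_ofPred_eq, K.bary_eq p x, innerSL_apply_apply]
      exact add_eq_zero_iff_eq_neg
    rw [this]
    exact convex_hyperplane (innerSL ℝ (K.grad p)).toLinearMap.isLinear _
  refine convexHull_min (fun q hq => ?_) hconv hx
  exact K.bary_vertex_of_ne (hs hq) (fun h => hp (h ▸ hq))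

/-- Two elements are equal if one contains an interior point of the other. -/
lemma eq_of_mem_interior {K K' : T.Cell} {x : Euc N} (hx : x ∈ interior K.carrier)
    (hx' : x ∈ K'.carrier) : K = K' := by
  classical
  have hmem := T.inter_subset_convexHull K.2.1 K'.2.1 ⟨interior_subset hx, hx'⟩
  -- `x` lies in the hull of the common vertices, so its coordinate for any other vertex of `K`
  -- would be zero.
  have hsub : K.1 ⊆ K'.1 := by
    intro p hp
    by_contra hp'
    have := K.bary_eq_zero_of_mem_convexHull (s := (K.1 ∩ K'.1 : Set (Euc N)))
      inter_subset_left hmem (p := p) (fun h => hp' h.2)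
    linarith [K.mem_interior.1 hx p hp]
  exact ext (Finset.eq_of_subset_of_card_le hsub (by rw [K.2.2, K'.2.2]))

/-- A vector orthogonal to the face opposite to `p` is a multiple of the gradient for `p`. -/
lemma inner_sub_eq_bary_mul (K : T.Cell) {p q n : Euc N} (hp : p ∈ K.1)
    (hn : ∀ r ∈ K.1, r ≠ p → inner ℝ n (r - q) = 0) (x : Euc N) :
    inner ℝ n (x - q) = K.bary p x * inner ℝ n (p - q) := by
  have h1 : x - q = ∑ r ∈ K.1, K.bary r x • (r - q) := by
    simp only [smul_sub, Finset.sum_sub_distrib, K.sum_bary_smul, ← Finset.sum_smul, K.sum_bary,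
      one_smul]
  rw [h1, inner_sum, Finset.sum_eq_single_of_mem p hp]
  · rw [inner_smul_right]
  · intro r hr hrp
    rw [inner_smul_right, hn r hr hrp, mul_zero]

/-- The volume of an element. -/
def vol (K : T.Cell) : ℝ := (volume K.carrier).toReal

lemma vol_pos (K : T.Cell) : 0 < K.vol :=
  ENNReal.toReal_pos
    (Measure.measure_pos_of_nonempty_interior _ K.interior_nonempty).ne' K.isCompact_carrier.measure_lt_top.ne

/-- The volumes of elements with a common face are proportional to the heights above it. -/
lemma vol_eq_abs_bary_mul_vol {K K' : T.Cell} {p p' : Euc N} (hp : p ∈ K.1) (hp' : p' ∈ K'.1)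
    (h : (K.1 : Set (Euc N)) \ {p} = (K'.1 : Set (Euc N)) \ {p'}) :
    K'.vol = |K.bary p p'| * K.vol := by
  let f : Module.Dual ℝ (Euc N) := (innerSL ℝ (K.grad p)).toLinearMap
  let d := p' - p
  -- The map `x ↦ x + K.bary p x • (p' - p)` fixes the common face and carries `p` to `p'`. Its
  -- linear part is a transvection of determinant `K.bary p p'`.
  let A : Euc N →ᵃ[ℝ] Euc N := (LinearMap.transvection f d).toAffineMap +
    AffineMap.const ℝ (Euc N) (K.bary p 0 • d)
  have hA : ∀ x, A x = x + K.bary p x • d := by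
    intro x
    rw [K.bary_eq p x]
    simp only [A, f, AffineMap.coe_add, Pi.add_apply, LinearMap.coe_toAffineMap,
      LinearMap.transvection.apply, AffineMap.coe_const, Function.const_apply,
      ContinuousLinearMap.coe_coe, innerSL_apply_apply, add_smul]
    abel
  have himg : A '' K.carrier = K'.carrier := by
    rw [carrier, carrier, AffineMap.image_convexHull]
    congr 1
    have h1 : A '' ((K.1 : Set (Euc N)) \ {p}) = (K.1 : Set (Euc N)) \ {p} := by
      refine (image_congr fun q hq => ?_).trans (image_id _)
      rw [hA, K.bary_vertex_of_ne hq.1 (fun h => hq.2 h.symm)]; simp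
    have h2 : A p = p' := by rw [hA, K.bary_self hp]; simp [d]
    have h3 : (K.1 : Set (Euc N)) = insert p ((K.1 : Set (Euc N)) \ {p}) := by
      rw [insert_sdiff_singleton, insert_eq_of_mem]; exact hp
    have h4 : (K'.1 : Set (Euc N)) = insert p' ((K'.1 : Set (Euc N)) \ {p'}) := by
      rw [insert_sdiff_singleton, insert_eq_of_mem]; exact hp'
    rw [h3, image_insert_eq, h1, h2, h, ← h4]
  have hdet : LinearMap.det (LinearMap.transvection f d) = K.bary p p' := by
    rw [LinearMap.transvection.det]
    have := K.bary_sub_bary p p' p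
    rw [K.bary_self hp] at this
    simp only [f, d, ContinuousLinearMap.coe_coe, innerSL_apply_apply]
    linarith
  have hvol : volume K'.carrier = ENNReal.ofReal |K.bary p p'| * volume K.carrier := by
    rw [← himg, ← hdet, ← Measure.addHaar_image_linearMap]
    have : A '' K.carrier = (fun y => y + K.bary p 0 • d) ''
        (LinearMap.transvection f d '' K.carrier) := by
      rw [image_image]; rfl
    rw [this, image_add_right, measure_preimage_add_right]
  rw [vol, vol, hvol, ENNReal.toReal_mul, ENNReal.toReal_ofReal (abs_nonneg _)]

end Cell
end
lemma nonempty_of_mem_faces {τ : Finset (Euc N)} (hτ : τ ∈ T.faces) : τ.Nonempty :=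
  T.toSimplicialComplex.nonempty_of_mem_faces hτ

lemma exists_cell_superset {τ : Finset (Euc N)} (hτ : τ ∈ T.faces) : ∃ K : T.Cell, τ ⊆ K.1 := by
  obtain ⟨t, ht, hτt, hc⟩ := T.exists_cell τ hτ
  exact ⟨⟨t, ht, hc⟩, hτt⟩

lemma exists_cell_mem {x : Euc N} (hx : x ∈ Ω) : ∃ K : T.Cell, x ∈ K.carrier := by
  have h := subset_closure hx
  rw [← T.space_eq, Geometry.SimplicialComplex.mem_space_iff] at h
  obtain ⟨s, hs, hxs⟩ := h
  obtain ⟨K, hK⟩ := exists_cell_superset hs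
  exact ⟨K, convexHull_mono (by exact_mod_cast hK) hxs⟩

lemma Cell.carrier_subset_closure (K : T.Cell) : K.carrier ⊆ closure Ω := by
  rw [← T.space_eq]
  exact Geometry.SimplicialComplex.convexHull_subset_space K.2.1

/-- The boundary of an open set that is locally an epigraph has the set on one side only. -/
lemma _root_.HasLipschitzBoundary.interior_closure (hΩ : IsOpen Ω) (hL : HasLipschitzBoundary Ω) :
    interior (closure Ω) = Ω := by
  refine Subset.antisymm (fun x hx => ?_) (interior_maximal subset_closure hΩ)
  by_contra hxΩ
  have hfr : x ∈ frontier Ω := by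
    rw [hΩ.frontier_eq]; exact ⟨interior_subset hx, hxΩ⟩
  obtain ⟨e, g, L, U, he, hg, hU, hxU, hUx⟩ := hL x hfr
  have hxg : inner ℝ e x ≤ g (x - inner ℝ e x • e) := not_lt.1 fun h => hxΩ ((hUx x hxU).2 h)
  have hee : inner ℝ e e = (1 : ℝ) := by rw [real_inner_self_eq_norm_sq, he]; norm_num
  have hev : ∀ᶠ t : ℝ in nhdsWithin 0 (Ioi 0), x - t • e ∈ interior (closure Ω) ∩ U := by
    have hc : Filter.Tendsto (fun t : ℝ => x - t • e) (nhdsWithin 0 (Ioi 0)) (nhds x) := by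
      have : Continuous fun t : ℝ => x - t • e := by fun_prop
      have h2 := this.tendsto 0
      simp only [zero_smul, sub_zero] at h2
      exact h2.mono_left nhdsWithin_le_nhds
    exact hc.eventually (((isOpen_interior).inter hU).mem_nhds ⟨hx, hxU⟩)
  obtain ⟨t, ⟨hti, htU⟩, ht⟩ := (hev.and self_mem_nhdsWithin).exists
  replace ht : 0 < t := ht
  -- The points of `U` strictly below the graph form an open set disjoint from `Ω`. A point slightly
  -- below `x` lies in it, yet also in the closure of `Ω`.
  let W : Set (Euc N) := U ∩ {y | inner ℝ e y < g (y - inner ℝ e y • e)}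
  have hWo : IsOpen W := hU.inter (isOpen_lt (by fun_prop)
    (hg.continuous.comp (by fun_prop)))
  have hmem : x - t • e ∈ W := by
    refine ⟨htU, ?_⟩
    have h1 : inner ℝ e (x - t • e) = inner ℝ e x - t := by
      rw [inner_sub_right, inner_smul_right, hee, mul_one]
    simp only [Set.mem_ofPred_eq, h1]
    have h2 : x - t • e - (inner ℝ e x - t) • e = x - inner ℝ e x • e := by module
    rw [h2]; linarith
  obtain ⟨y, hyW, hyΩ⟩ := mem_closure_iff.1 (interior_subset hti) W hWo hmem
  have := (hUx y hyW.1).1 hyΩ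
  exact absurd this (not_lt.2 (le_of_lt hyW.2))

/-- The barycenter of a finite set of points. -/
noncomputable def barycenter (τ : Finset (Euc N)) : Euc N := ∑ q ∈ τ, (τ.card : ℝ)⁻¹ • q

lemma sum_inv_card {τ : Finset (Euc N)} (hτ : τ.Nonempty) : ∑ _q ∈ τ, (τ.card : ℝ)⁻¹ = 1 := by
  rw [Finset.sum_const, nsmul_eq_mul]
  exact mul_inv_cancel₀ (by exact_mod_cast hτ.card_pos.ne')

lemma barycenter_mem {τ : Finset (Euc N)} (hτ : τ.Nonempty) :
    barycenter τ ∈ convexHull ℝ (τ : Set (Euc N)) :=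
  (convex_convexHull ℝ _).sum_mem (fun _ _ => by positivity) (sum_inv_card hτ)
    fun q hq => subset_convexHull ℝ _ hq

lemma Cell.bary_barycenter (K : T.Cell) {τ : Finset (Euc N)} (hτK : τ ⊆ K.1) {p : Euc N}
    (hp : p ∈ τ) : 0 < K.bary p (barycenter τ) := by
  have hτ : τ.Nonempty := ⟨p, hp⟩
  have h1 : K.bary p (barycenter τ) = ∑ q ∈ τ, (τ.card : ℝ)⁻¹ * K.bary p q := by
    rw [K.bary_eq, barycenter, inner_sum]
    have h2 : K.bary p 0 = ∑ _q ∈ τ, (τ.card : ℝ)⁻¹ * K.bary p 0 := by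
      rw [← Finset.sum_mul, sum_inv_card hτ, one_mul]
    rw [h2, ← Finset.sum_add_distrib]
    refine Finset.sum_congr rfl fun q _ => ?_
    rw [K.bary_eq p q, inner_smul_right]; ring
  rw [h1]
  have hcard : (0 : ℝ) < τ.card := by exact_mod_cast hτ.card_pos
  refine Finset.sum_pos' (fun q hq => ?_) ⟨p, hp, ?_⟩
  · rw [K.bary_vertex (hτK hp) (hτK hq)]; split_ifs <;> positivity
  · rw [K.bary_self (hτK hp)]; positivity

lemma Cell.bary_add_smul (K : T.Cell) (p x y : Euc N) (t : ℝ) :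
    K.bary p (x + t • (y - x)) = (1 - t) * K.bary p x + t * K.bary p y := by
  have h1 := K.bary_sub_bary p (x + t • (y - x)) x
  have h2 := K.bary_sub_bary p y x
  rw [add_sub_cancel_left, inner_smul_right, ← h2] at h1
  linarith

/-- Two elements with a common face `Γ` whose remaining vertices lie on the same side of it
are equal. -/
lemma Cell.eq_of_same_side {K K' : T.Cell} {Γ : Finset (Euc N)} (hΓ : Γ.Nonempty)
    {p p' n : Euc N} (hK : ∀ r, r ∈ K.1 ↔ r = p ∨ r ∈ Γ) (hK' : ∀ r, r ∈ K'.1 ↔ r = p' ∨ r ∈ Γ)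
    (hp' : p' ∉ Γ) (hn : ∀ r ∈ Γ, ∀ q ∈ Γ, inner ℝ n (r - q) = 0)
    (hside : ∀ q ∈ Γ, 0 < inner ℝ n (p - q) * inner ℝ n (p' - q)) : K = K' := by
  obtain ⟨q, hq⟩ := hΓ
  have hΓK' : Γ ⊆ K'.1 := fun r hr => (hK' r).2 (Or.inr hr)
  have hΓK : Γ ⊆ K.1 := fun r hr => (hK r).2 (Or.inr hr)
  have hp'K : p' ∈ K'.1 := (hK' p').2 (Or.inl rfl)
  have hpK : p ∈ K.1 := (hK p).2 (Or.inl rfl)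
  set y := barycenter Γ
  have hy := barycenter_mem ⟨q, hq⟩
  have h1 := K'.inner_sub_eq_bary_mul (q := q) (n := n) hp'K
    (fun r hr hrp => hn r (((hK' r).1 hr).resolve_left hrp) q hq) p
  have hpos : 0 < K'.bary p' p := by
    have h2 := hside q hq
    rw [h1, mul_assoc] at h2
    exact pos_of_mul_pos_left h2 (mul_self_nonneg _)
  -- Near the barycenter of `Γ` the coordinates for the vertices of `Γ` stay positive, and moving
  -- towards `p` makes the one for `p'` positive. Such a point of `K` is thus interior to `K'`.
  have hev : ∀ᶠ t : ℝ in nhdsWithin 0 (Ioi 0), ∀ r ∈ Γ, 0 < K'.bary r (y + t • (p - y)) := by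
    rw [Filter.eventually_all_finset]
    intro r hr
    have hc : Continuous fun t : ℝ => K'.bary r (y + t • (p - y)) :=
      (K'.continuous_bary r).comp (by fun_prop)
    have := hc.tendsto 0
    simp only [zero_smul, add_zero] at this
    exact (this.mono_left nhdsWithin_le_nhds).eventually
      (lt_mem_nhds (K'.bary_barycenter hΓK' hr))
  have h1' : ∀ᶠ t : ℝ in nhdsWithin 0 (Ioi 0), t < 1 :=
    nhdsWithin_le_nhds (gt_mem_nhds one_pos)
  obtain ⟨t, ⟨ht, ht1⟩, ht0⟩ := ((hev.and h1').and self_mem_nhdsWithin).exists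
  replace ht0 : 0 < t := ht0
  have hmem : y + t • (p - y) ∈ K.carrier := by
    have := K.convex_carrier (convexHull_mono (by exact_mod_cast hΓK) hy) (K.subset_carrier hpK)
      (sub_nonneg.2 ht1.le) ht0.le (by ring)
    convert! this using 1; module
  have hint : y + t • (p - y) ∈ interior K'.carrier := by
    rw [K'.mem_interior]
    intro r hr
    rcases (hK' r).1 hr with rfl | hr
    · have h0 : K'.bary r y = 0 :=
        K'.bary_eq_zero_of_mem_convexHull (by exact_mod_cast hΓK') hy (by exact_mod_cast hp')
      rw [K'.bary_add_smul, h0]; nlinarith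
    · exact ht r hr
  exact (Cell.eq_of_mem_interior hint hmem).symm

/-- The vertex of an element opposite to one of its faces. -/
lemma Cell.exists_apex (K : T.Cell) {Γ : Finset (Euc N)} (hΓ : Γ.card = N) (h : Γ ⊆ K.1) :
    ∃ p, p ∉ Γ ∧ p ∈ K.1 ∧ ∀ r, r ∈ K.1 ↔ r = p ∨ r ∈ Γ := by
  classical
  have hc : (K.1 \ Γ).card = 1 := by
    rw [Finset.card_sdiff_of_subset h, K.2.2, hΓ]; omega
  obtain ⟨p, hp⟩ := Finset.card_eq_one.1 hc
  have hp' : p ∈ K.1 \ Γ := by rw [hp]; exact Finset.mem_singleton_self p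
  rw [Finset.mem_sdiff] at hp'
  refine ⟨p, hp'.2, hp'.1, fun r => ⟨fun hr => ?_, ?_⟩⟩
  · by_cases hrΓ : r ∈ Γ
    · exact Or.inr hrΓ
    · left
      have : r ∈ K.1 \ Γ := Finset.mem_sdiff.2 ⟨hr, hrΓ⟩
      rwa [hp, Finset.mem_singleton] at this
  · rintro (rfl | hr)
    · exact hp'.1
    · exact h hr

namespace Orientation
variable (o : T.Orientation)

lemma minus_ne_plus (Γ : T.InteriorFace) : o.minus Γ ≠ o.plus Γ := by
  intro h
  obtain ⟨p, hp, hpK, -⟩ := (o.minus Γ).exists_apex Γ.2.1.2 (o.subset_minus Γ)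
  obtain ⟨q, hq⟩ := nonempty_of_mem_faces Γ.2.1.1
  have h1 := o.minus_side Γ p hpK hp q hq
  have h2 := o.plus_side Γ p (h ▸ hpK) hp q hq
  linarith

/-- An interior face belongs to no elements other than the two that are given. -/
lemma eq_minus_or_eq_plus (Γ : T.InteriorFace) {K : T.Cell} (h : Γ.1 ⊆ K.1) :
    K = o.minus Γ ∨ K = o.plus Γ := by
  have hne := nonempty_of_mem_faces Γ.2.1.1
  obtain ⟨p, hp, hpK, hK⟩ := K.exists_apex Γ.2.1.2 h
  obtain ⟨p₁, hp₁, hpK₁, hK₁⟩ := (o.minus Γ).exists_apex Γ.2.1.2 (o.subset_minus Γ)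
  obtain ⟨p₂, hp₂, hpK₂, hK₂⟩ := (o.plus Γ).exists_apex Γ.2.1.2 (o.subset_plus Γ)
  have hn : ∀ r ∈ Γ.1, ∀ q ∈ Γ.1, inner ℝ (o.ν Γ.toFace) (r - q) = 0 :=
    fun r hr q hq => o.ν_orthogonal Γ.toFace r hr q hq
  obtain ⟨q, hq⟩ := id hne
  have hne0 : inner ℝ (o.ν Γ.toFace) (p - q) ≠ 0 := by
    intro h0
    have h1 := K.inner_sub_eq_bary_mul (q := q) (n := o.ν Γ.toFace) hpK
      (fun r hr hrp => hn r (((hK r).1 hr).resolve_left hrp) q hq) (q + o.ν Γ.toFace)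
    rw [h0, mul_zero, add_sub_cancel_left, real_inner_self_eq_norm_sq, o.norm_ν] at h1
    norm_num at h1
  have hsame : ∀ q' ∈ Γ.1, inner ℝ (o.ν Γ.toFace) (p - q') = inner ℝ (o.ν Γ.toFace) (p - q) := by
    intro q' hq'
    rw [← sub_add_sub_cancel p q q', inner_add_right, hn q hq q' hq', add_zero]
  rcases lt_or_gt_of_ne hne0 with hlt | hgt
  · left
    exact Cell.eq_of_same_side hne hK hK₁ hp₁ hn fun q' hq' => by
      rw [hsame q' hq']
      exact mul_pos_of_neg_of_neg hlt (o.minus_side Γ p₁ hpK₁ hp₁ q' hq')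
  · right
    exact Cell.eq_of_same_side hne hK hK₂ hp₂ hn fun q' hq' => by
      rw [hsame q' hq']
      exact mul_pos hgt (o.plus_side Γ p₂ hpK₂ hp₂ q' hq')

end Orientation

/-! ### The elements around a face -/

/-- A face that meets `Ω` contains a point of `Ω` which lies only in the elements that have the
whole face. -/
lemma exists_mem_forall_subset (hΩ : IsOpen Ω) {τ : Finset (Euc N)} (hτ : τ ∈ T.faces)
    (hτΩ : (convexHull ℝ (τ : Set (Euc N)) ∩ Ω).Nonempty) :
    ∃ x ∈ convexHull ℝ (τ : Set (Euc N)) ∩ Ω, ∀ K : T.Cell, x ∈ K.carrier → τ ⊆ K.1 := by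
  obtain ⟨y, hy, hyΩ⟩ := hτΩ
  have hne := nonempty_of_mem_faces hτ
  -- A small move towards the barycenter stays in `Ω` and makes the coordinates for all vertices of
  -- `τ` positive. An element through the new point must then contain every vertex of `τ`.
  have hev : ∀ᶠ t : ℝ in nhdsWithin 0 (Ioi 0), y + t • (barycenter τ - y) ∈ Ω := by
    have hc : Continuous fun t : ℝ => y + t • (barycenter τ - y) := by fun_prop
    have := hc.tendsto 0
    simp only [zero_smul, add_zero] at this
    exact (this.mono_left nhdsWithin_le_nhds).eventually (hΩ.mem_nhds hyΩ)
  have h1' : ∀ᶠ t : ℝ in nhdsWithin 0 (Ioi 0), t < 1 :=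
    nhdsWithin_le_nhds (gt_mem_nhds one_pos)
  obtain ⟨t, ⟨ht, ht1⟩, ht0⟩ := ((hev.and h1').and self_mem_nhdsWithin).exists
  replace ht0 : 0 < t := ht0
  have hmem : y + t • (barycenter τ - y) ∈ convexHull ℝ (τ : Set (Euc N)) := by
    have := (convex_convexHull ℝ (τ : Set (Euc N))) hy (barycenter_mem hne)
      (sub_nonneg.2 ht1.le) ht0.le (by ring)
    convert! this using 1; module
  refine ⟨_, ⟨hmem, ht⟩, fun K' hK' p hp => ?_⟩
  obtain ⟨K, hK⟩ := exists_cell_superset hτ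
  by_contra hpK'
  have h2 := T.inter_subset_convexHull hτ K'.2.1 ⟨hmem, hK'⟩
  have h3 := K.bary_eq_zero_of_mem_convexHull (p := p)
    (inter_subset_left.trans (by exact_mod_cast hK)) h2 (fun h => hpK' h.2)
  rw [K.bary_add_smul] at h3
  have h4 := K.bary_barycenter hK hp
  have h5 := K.mem_carrier.1 (convexHull_mono (by exact_mod_cast hK) hy) p (hK hp)
  nlinarith

/-- An interior face, from a face that contains a point of `Ω`. -/
lemma exists_interiorFace (hΩ : IsOpen Ω) {s : Finset (Euc N)} (hs : s ∈ T.faces)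
    (hc : s.card = N) (h : (convexHull ℝ (s : Set (Euc N)) ∩ Ω).Nonempty) :
    ∃ Γ : T.InteriorFace, Γ.1 = s := by
  obtain ⟨x, hx, hxΩ⟩ := h
  exact ⟨⟨s, ⟨hs, hc⟩, fun hsub => by
    have := hsub hx
    rw [hΩ.frontier_eq] at this
    exact this.2 hxΩ⟩, rfl⟩

lemma affineSpan_ne_top_of_card_le {s : Finset (Euc N)} (hs : s.card ≤ N) :
    affineSpan ℝ (s : Set (Euc N)) ≠ ⊤ := by
  rcases s.eq_empty_or_nonempty with rfl | hne
  · simp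
  intro h
  obtain ⟨n, hn⟩ : ∃ n, s.card = n + 1 := ⟨s.card - 1, by have := hne.card_pos; omega⟩
  have h1 := finrank_vectorSpan_image_finset_le ℝ (id : Euc N → Euc N) s hn
  have h2 : vectorSpan ℝ (s : Set (Euc N)) = ⊤ := by
    rw [← direction_affineSpan, h, AffineSubspace.direction_top]
  have h3 : (s.image (id : Euc N → Euc N) : Set (Euc N)) = s := by simp
  rw [h3, h2, finrank_top, finrank_euclideanSpace_fin] at h1
  omega

/-- The elements that contain a given face meeting `Ω` are connected to each other through
interior faces that contain it. -/
theorem eq_of_forall_jump_eq_zero (hΩ : IsOpen Ω) (hN : 0 < N) (o : T.Orientation)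
    {τ : Finset (Euc N)} (hτ : τ ∈ T.faces)
    (hτΩ : (convexHull ℝ (τ : Set (Euc N)) ∩ Ω).Nonempty) {φ : T.Cell → ℝ}
    (hφ : ∀ Γ : T.InteriorFace, τ ⊆ Γ.1 → φ (o.plus Γ) = φ (o.minus Γ)) {K K' : T.Cell}
    (hK : τ ⊆ K.1) (hK' : τ ⊆ K'.1) : φ K = φ K' := by
  classical
  obtain ⟨x, ⟨hxτ, hxΩ⟩, hx⟩ := exists_mem_forall_subset hΩ hτ hτΩ
  let F : Set (Euc N) := ⋃ J : {J : T.Cell // x ∉ J.carrier}, J.1.carrier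
  have hF : IsClosed F := isClosed_iUnion_of_finite fun J => J.1.isCompact_carrier.isClosed
  have hxF : x ∈ Ω ∩ Fᶜ := by
    refine ⟨hxΩ, fun h => ?_⟩
    obtain ⟨J, hJ⟩ := mem_iUnion.1 h
    exact J.2 hJ
  obtain ⟨r, hr, hB⟩ := Metric.isOpen_iff.1 (hΩ.inter hF.isOpen_compl) x hxF
  have hstar : ∀ z ∈ Metric.ball x r, ∀ J : T.Cell, z ∈ J.carrier → τ ⊆ J.1 := by
    intro z hz J hJ
    by_contra hcon
    exact (hB hz).2 (mem_iUnion.2 ⟨⟨J, fun h => hcon (hx J h)⟩, hJ⟩)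
  have hmeet : ∀ J : T.Cell, τ ⊆ J.1 → (Metric.ball x r ∩ interior J.carrier).Nonempty := by
    intro J hJ
    exact mem_closure_iff.1 (J.subset_closure_interior (convexHull_mono (by exact_mod_cast hJ) hxτ))
      _ Metric.isOpen_ball (Metric.mem_ball_self hr)
  obtain ⟨y, hyB, hyK⟩ := hmeet K hK
  -- The affine span of `y` and a face of codimension two is a null set. A generic `z` in `K'` is
  -- therefore joined to `y` by a segment that misses all these faces.
  let R : Set (Finset (Euc N)) := {σ | σ ∈ T.faces ∧ σ.card = N - 1}
  have hR : R.Finite := T.finite_faces.subset fun σ h => h.1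
  have hnull : volume (⋃ σ ∈ R, (affineSpan ℝ (insert y σ : Set (Euc N)) : Set (Euc N))) = 0 := by
    rw [measure_biUnion_null_iff hR.countable]
    intro σ hσ
    apply Measure.addHaar_affineSubspace
    have := affineSpan_ne_top_of_card_le (N := N) (s := insert y σ) (by
      have := Finset.card_insert_le y σ
      have := hσ.2
      omega)
    simpa using this
  obtain ⟨z, ⟨hzB, hzK'⟩, hz⟩ : ((Metric.ball x r ∩ interior K'.carrier) \
      ⋃ σ ∈ R, (affineSpan ℝ (insert y σ : Set (Euc N)) : Set (Euc N))).Nonempty := by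
    refine nonempty_of_measure_ne_zero (μ := volume) ?_
    rw [measure_sdiff_null hnull]
    exact (((Metric.isOpen_ball).inter isOpen_interior).measure_pos volume (hmeet K' hK')).ne'
  let γ : ℝ → Euc N := fun t => y + t • (z - y)
  have hγc : Continuous γ := by fun_prop
  have hγB : ∀ t ∈ Icc (0 : ℝ) 1, γ t ∈ Metric.ball x r := by
    intro t ht
    have := (convex_ball x r) hyB hzB (sub_nonneg.2 ht.2) ht.1 (by ring)
    convert! this using 1; simp only [γ]; module
  have hwell : ∀ t ∈ Icc (0 : ℝ) 1, ∀ J J' : T.Cell, γ t ∈ J.carrier → γ t ∈ J'.carrier →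
      φ J = φ J' := by
    intro t ht J J' hJ hJ'
    by_cases hJJ : J = J'
    · rw [hJJ]
    rcases ht.1.eq_or_lt with rfl | ht0
    · have hy0 : γ 0 = y := by simp [γ]
      rw [hy0] at hJ hJ'
      rw [← Cell.eq_of_mem_interior hyK hJ, ← Cell.eq_of_mem_interior hyK hJ']
    have hmem := T.inter_subset_convexHull J.2.1 J'.2.1 ⟨hJ, hJ'⟩
    rw [← Finset.coe_inter] at hmem
    have hne : (J.1 ∩ J'.1).Nonempty :=
      Finset.coe_nonempty.1 (convexHull_nonempty_iff.1 ⟨_, hmem⟩)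
    have hle : (J.1 ∩ J'.1).card ≤ N := by
      by_contra hcon
      have h1 : J.1 ∩ J'.1 = J.1 := Finset.eq_of_subset_of_card_le Finset.inter_subset_left
        (by rw [J.2.2]; omega)
      exact hJJ (Cell.ext (Finset.eq_of_subset_of_card_le (Finset.inter_eq_left.1 h1)
        (by rw [J.2.2, J'.2.2])))
    -- Otherwise `γ t` lies in a face of codimension two, and `z`, being on the line through `y` and
    -- `γ t`, lies in an excluded span.
    have hcard : (J.1 ∩ J'.1).card = N := by
      by_contra hcon
      obtain ⟨σ, hσ1, hσ2, hσc⟩ := Finset.exists_subsuperset_card_eq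
        (Finset.inter_subset_left : J.1 ∩ J'.1 ⊆ J.1) (n := N - 1) (by omega)
        (by rw [J.2.2]; omega)
      have hσ : σ ∈ R := ⟨T.down_closed J.2.1 hσ2 (hne.mono hσ1), hσc⟩
      apply hz
      refine mem_biUnion hσ ?_
      have h1 : γ t ∈ affineSpan ℝ (insert y σ : Set (Euc N)) :=
        affineSpan_mono ℝ (subset_insert _ _)
          (convexHull_subset_affineSpan _ (convexHull_mono (by exact_mod_cast hσ1) hmem))
      have h2 : y ∈ affineSpan ℝ (insert y σ : Set (Euc N)) :=
        mem_affineSpan ℝ (mem_insert _ _)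
      have h3 := AffineMap.lineMap_mem t⁻¹ h2 h1
      have h4 : AffineMap.lineMap y (γ t) t⁻¹ = z := by
        simp only [γ, AffineMap.lineMap_apply, vsub_eq_sub, add_sub_cancel_left, vadd_eq_add]
        rw [inv_smul_smul₀ ht0.ne']; abel
      rwa [h4] at h3
    obtain ⟨Γ, hΓ⟩ := exists_interiorFace hΩ (T.down_closed J.2.1 Finset.inter_subset_left hne)
      hcard ⟨_, hmem, (hB (hγB t ht)).1⟩
    have hτΓ : τ ⊆ Γ.1 := hΓ ▸ Finset.subset_inter (hstar _ (hγB t ht) J hJ)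
      (hstar _ (hγB t ht) J' hJ')
    have h := hφ Γ hτΓ
    rcases o.eq_minus_or_eq_plus Γ (hΓ ▸ Finset.inter_subset_left : Γ.1 ⊆ J.1) with h1 | h1 <;>
    rcases o.eq_minus_or_eq_plus Γ (hΓ ▸ Finset.inter_subset_right : Γ.1 ⊆ J'.1) with h2 | h2 <;>
    simp [h1, h2, h]
  by_contra hne
  -- The parameters at which `φ` does or does not take the value `φ K` form two closed sets covering
  -- the interval. By connectedness they meet, against `hwell`.
  let C₁ : Set ℝ := ⋃ J : {J : T.Cell // φ J = φ K}, γ ⁻¹' J.1.carrier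
  let C₂ : Set ℝ := ⋃ J : {J : T.Cell // φ J ≠ φ K}, γ ⁻¹' J.1.carrier
  have hC₁ : IsClosed C₁ := isClosed_iUnion_of_finite fun J =>
    J.1.isCompact_carrier.isClosed.preimage hγc
  have hC₂ : IsClosed C₂ := isClosed_iUnion_of_finite fun J =>
    J.1.isCompact_carrier.isClosed.preimage hγc
  obtain ⟨t, ht, ht1, ht2⟩ := isPreconnected_closed_iff.1 (isPreconnected_Icc (a := (0 : ℝ)) (b := 1))
    C₁ C₂ hC₁ hC₂ (fun t ht => by
      obtain ⟨J, hJ⟩ := exists_cell_mem (T := T) (hB (hγB t ht)).1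
      by_cases h : φ J = φ K
      · exact Or.inl (mem_iUnion.2 ⟨⟨J, h⟩, hJ⟩)
      · exact Or.inr (mem_iUnion.2 ⟨⟨J, h⟩, hJ⟩))
    ⟨0, by simp, mem_iUnion.2 ⟨⟨K, rfl⟩, by simpa [γ] using interior_subset hyK⟩⟩
    ⟨1, by simp, mem_iUnion.2 ⟨⟨K', fun h => hne h.symm⟩, by
      simpa [γ] using interior_subset hzK'⟩⟩
  obtain ⟨J, hJ⟩ := mem_iUnion.1 ht1
  obtain ⟨J', hJ'⟩ := mem_iUnion.1 ht2
  exact J'.2 ((hwell t ht J'.1 J.1 hJ' hJ).trans J.2)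

/-! ### Local potentials and their globalization -/

/-- There is a function on the elements whose jumps over the interior faces containing `τ`
are prescribed by `c`. -/
def HasPotential (o : T.Orientation) (c : T.InteriorFace → ℝ) (τ : Finset (Euc N)) : Prop :=
  ∃ φ : T.Cell → ℝ, ∀ Γ : T.InteriorFace, τ ⊆ Γ.1 → φ (o.plus Γ) - φ (o.minus Γ) = c Γ

/-- At most one interior face contains `τ`, and its jump can be placed on the element on its plus
side. -/
lemma hasPotential_of_le_card (o : T.Orientation) (c : T.InteriorFace → ℝ) {τ : Finset (Euc N)}
    (hτ : N ≤ τ.card) : HasPotential o c τ := by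
  classical
  by_cases h : ∃ Γ : T.InteriorFace, τ ⊆ Γ.1
  · obtain ⟨Γ, hΓ⟩ := h
    refine ⟨fun K => if K = o.plus Γ then c Γ else 0, fun Γ' hΓ' => ?_⟩
    have h1 := Finset.eq_of_subset_of_card_le hΓ (by rw [Γ.2.1.2]; exact hτ)
    have h2 := Finset.eq_of_subset_of_card_le hΓ' (by rw [Γ'.2.1.2]; exact hτ)
    have : Γ' = Γ := Subtype.ext (h2.symm.trans h1)
    simp only [this, if_true, if_neg (o.minus_ne_plus Γ), sub_zero]
  · exact ⟨fun _ => 0, fun Γ hΓ => (h ⟨Γ, hΓ⟩).elim⟩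

/-- Around a ridge `σ` a potential exists as soon as `c` annihilates one nonzero divergence-free
flux. -/
lemma hasPotential_of_flux (hΩ : IsOpen Ω) (o : T.Orientation) (c : T.InteriorFace → ℝ)
    {σ : Finset (Euc N)} (hσ : σ ∈ T.faces) (hσc : σ.card + 1 = N)
    (hσΩ : (convexHull ℝ (σ : Set (Euc N)) ∩ Ω).Nonempty) (V : T.InteriorFace → ℝ)
    (hV0 : ∀ Γ : T.InteriorFace, ¬ σ ⊆ Γ.1 → V Γ = 0) (hV : ∃ Γ, V Γ ≠ 0)
    (hdiv : ∀ φ : T.Cell → ℝ, ∑ Γ, V Γ * (φ (o.plus Γ) - φ (o.minus Γ)) = 0)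
    (hVc : ∑ Γ, V Γ * c Γ = 0) : HasPotential o c σ := by
  classical
  let S := {K : T.Cell // σ ⊆ K.1}
  let G := {Γ : T.InteriorFace // σ ⊆ Γ.1}
  -- Double counting: a face through `σ` lies in at least two elements through `σ`, while such an
  -- element has at most two faces through `σ`, opposite to its two vertices outside `σ`.
  have hle : Fintype.card G ≤ Fintype.card S := by
    have := Finset.card_mul_le_card_mul (s := (Finset.univ : Finset G))
      (t := (Finset.univ : Finset S)) (fun Γ K => Γ.1.1 ⊆ K.1.1) (m := 2) (n := 2)
      (fun Γ _ => by
        let m : S := ⟨o.minus Γ.1, Γ.2.trans (o.subset_minus _)⟩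
        let p : S := ⟨o.plus Γ.1, Γ.2.trans (o.subset_plus _)⟩
        have hmp : m ≠ p := fun h => o.minus_ne_plus Γ.1 (congrArg Subtype.val h)
        rw [← Finset.card_pair hmp]
        refine Finset.card_le_card fun K hK => ?_
        rw [Finset.mem_insert, Finset.mem_singleton] at hK
        rw [Finset.mem_bipartiteAbove]
        rcases hK with rfl | rfl
        · exact ⟨Finset.mem_univ _, o.subset_minus _⟩
        · exact ⟨Finset.mem_univ _, o.subset_plus _⟩)
      (fun K _ => by
        have hcard : (K.1.1 \ σ).card = 2 := by
          rw [Finset.card_sdiff_of_subset K.2, K.1.2.2]; omega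
        rw [← hcard]
        refine (Finset.card_le_card_of_injOn (fun Γ : G => Γ.1.1)
          (t := (K.1.1 \ σ).image fun p => K.1.1.erase p) ?_ ?_).trans Finset.card_image_le
        · intro Γ hΓ
          rw [Finset.mem_coe, Finset.mem_bipartiteBelow] at hΓ
          obtain ⟨p, hp, hpK, h⟩ := K.1.exists_apex Γ.1.2.1.2 hΓ.2
          rw [Finset.mem_coe, Finset.mem_image]
          refine ⟨p, Finset.mem_sdiff.2 ⟨hpK, fun h => hp (Γ.2 h)⟩, ?_⟩
          ext r
          rw [Finset.mem_erase, h]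
          constructor
          · rintro ⟨h1, h2⟩; exact h2.resolve_left h1
          · intro hr; exact ⟨fun h => hp (h ▸ hr), Or.inr hr⟩
        · intro Γ _ Γ' _ h
          exact Subtype.ext (Subtype.ext h))
    simpa using this
  let δ : (S → ℝ) →ₗ[ℝ] (G → ℝ) :=
    { toFun := fun φ Γ => φ ⟨o.plus Γ.1, Γ.2.trans (o.subset_plus _)⟩ -
        φ ⟨o.minus Γ.1, Γ.2.trans (o.subset_minus _)⟩
      map_add' := fun φ ψ => by ext Γ; simp only [Pi.add_apply]; ring
      map_smul' := fun r φ => by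
        ext Γ; simp only [Pi.smul_apply, smul_eq_mul, RingHom.id_apply]; ring }
  let v : (G → ℝ) →ₗ[ℝ] ℝ := ∑ Γ : G, V Γ.1 • LinearMap.proj Γ
  have hv : ∀ g, v g = ∑ Γ : G, V Γ.1 * g Γ := fun g => by simp [v]
  have hsum : ∀ g : T.InteriorFace → ℝ, ∑ Γ : G, V Γ.1 * g Γ.1 = ∑ Γ, V Γ * g Γ := by
    intro g
    rw [← Finset.sum_subtype (Finset.univ.filter fun Γ : T.InteriorFace => σ ⊆ Γ.1)
      (fun Γ => by simp) (fun Γ => V Γ * g Γ)]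
    refine Finset.sum_filter_of_ne fun Γ _ h => ?_
    by_contra hcon
    exact h (by rw [hV0 Γ hcon, zero_mul])
  have hrange : LinearMap.range δ ≤ LinearMap.ker v := by
    rintro _ ⟨φ, rfl⟩
    rw [LinearMap.mem_ker, hv]
    let φ' : T.Cell → ℝ := fun K => if h : σ ⊆ K.1 then φ ⟨K, h⟩ else 0
    have h := hdiv φ'
    rw [← hsum] at h
    rw [← h]
    refine Finset.sum_congr rfl fun Γ _ => ?_
    simp only [φ', δ, LinearMap.coe_mk, AddHom.coe_mk]
    rw [dif_pos (Γ.2.trans (o.subset_plus _)), dif_pos (Γ.2.trans (o.subset_minus _))]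
  obtain ⟨K₀, hK₀⟩ := exists_cell_superset hσ
  have hker : Module.finrank ℝ (LinearMap.ker δ) ≤ 1 := by
    refine (finrank_le_one (⟨fun _ => 1, by ext Γ; simp [δ]⟩ : LinearMap.ker δ) fun φ => ?_)
    refine ⟨φ.1 ⟨K₀, hK₀⟩, Subtype.ext (funext fun K => ?_)⟩
    change φ.1 ⟨K₀, hK₀⟩ * 1 = φ.1 K
    rw [mul_one]
    let φ' : T.Cell → ℝ := fun K => if h : σ ⊆ K.1 then φ.1 ⟨K, h⟩ else 0
    have h := eq_of_forall_jump_eq_zero hΩ (by omega) o hσ hσΩ (φ := φ') (fun Γ hΓ => by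
      have := congrFun φ.2 ⟨Γ, hΓ⟩
      simp only [φ']
      rw [dif_pos (hΓ.trans (o.subset_plus _)), dif_pos (hΓ.trans (o.subset_minus _))]
      exact sub_eq_zero.1 this) hK₀ K.2
    simpa only [φ', dif_pos hK₀, dif_pos K.2] using h
  have hvne : v ≠ 0 := by
    obtain ⟨Γ, hΓ⟩ := hV
    have hσΓ : σ ⊆ Γ.1 := by
      by_contra h
      exact hΓ (hV0 Γ h)
    intro h
    have := LinearMap.congr_fun h (Pi.single ⟨Γ, hσΓ⟩ 1)
    rw [hv] at this
    rw [Finset.sum_eq_single_of_mem ⟨Γ, hσΓ⟩ (Finset.mem_univ _)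
      (fun Γ' _ h => by rw [Pi.single_eq_of_ne h, mul_zero])] at this
    rw [Pi.single_eq_same, mul_one] at this
    exact hΓ this
  -- The kernel of `δ` consists of constants, so its range has dimension at least `card S - 1 ≥ card
  -- G - 1`, and the last number is the dimension of `ker v`.
  have hrk : LinearMap.range δ = LinearMap.ker v := by
    refine Submodule.eq_of_le_of_finrank_le hrange ?_
    have h1 := LinearMap.finrank_range_add_finrank_ker δ
    have h2 := LinearMap.finrank_range_add_finrank_ker v
    rw [Module.finrank_fintype_fun_eq_card] at h1 h2
    have h3 : 0 < Module.finrank ℝ (LinearMap.range v) := by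
      rw [Module.finrank_pos_iff, Submodule.nontrivial_iff_ne_bot]
      exact fun h => hvne (LinearMap.range_eq_bot.1 h)
    omega
  have hcmem : (fun Γ : G => c Γ.1) ∈ LinearMap.range δ := by
    rw [hrk, LinearMap.mem_ker, hv, hsum, hVc]
  obtain ⟨φ, hφ⟩ := hcmem
  refine ⟨fun K => if h : σ ⊆ K.1 then φ ⟨K, h⟩ else 0, fun Γ hΓ => ?_⟩
  simp only [dif_pos (hΓ.trans (o.subset_plus Γ)), dif_pos (hΓ.trans (o.subset_minus Γ))]
  exact congrFun hφ ⟨Γ, hΓ⟩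

lemma Cell.carrier_nonempty (K : T.Cell) : K.carrier.Nonempty :=
  K.interior_nonempty.mono interior_subset

/-- Local potentials fit together on a subset `X` of `Ω` on which functions have logarithms. -/
theorem exists_potential_on (hΩ : IsOpen Ω) (hN : 0 < N) (o : T.Orientation)
    (c : T.InteriorFace → ℝ) {X : Set (Euc N)} (hXΩ : X ⊆ Ω) (hX : HasLogarithms X)
    (hconn : ∀ K : T.Cell, IsPreconnected (K.carrier ∩ X))
    (hloc : ∀ τ ∈ T.faces, (convexHull ℝ (τ : Set (Euc N)) ∩ X).Nonempty → HasPotential o c τ) :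
    ∃ n : T.Cell → ℝ, ∀ Γ : T.InteriorFace, (convexHull ℝ (Γ.1 : Set (Euc N)) ∩ X).Nonempty →
      n (o.plus Γ) - n (o.minus Γ) = c Γ := by
  classical
  have hmem : ∀ x ∈ X, ∀ s ∈ T.faces, ∀ t ∈ T.faces, x ∈ convexHull ℝ (s : Set (Euc N)) →
      x ∈ convexHull ℝ (t : Set (Euc N)) → s ∩ t ∈ T.faces ∧
        x ∈ convexHull ℝ ((s ∩ t : Finset (Euc N)) : Set (Euc N)) := by
    intro x hx s hs t ht hxs hxt
    have h1 := T.inter_subset_convexHull hs ht ⟨hxs, hxt⟩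
    rw [← Finset.coe_inter] at h1
    exact ⟨T.down_closed hs Finset.inter_subset_left
      (Finset.coe_nonempty.1 (convexHull_nonempty_iff.1 ⟨_, h1⟩)), h1⟩
  let Φ : Finset (Euc N) → T.Cell → ℝ := fun τ =>
    if h : HasPotential o c τ then h.choose else 0
  have hΦ : ∀ τ, HasPotential o c τ → ∀ Γ : T.InteriorFace, τ ⊆ Γ.1 →
      Φ τ (o.plus Γ) - Φ τ (o.minus Γ) = c Γ := by
    intro τ h
    simp only [Φ, dif_pos h]
    exact h.choose_spec
  -- `C K K'` is the increment of a local potential from `K` to `K'`. By `hC` it may be computed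
  -- from the potential of any smaller common face; that of a triple intersection yields the cocycle
  -- identity.
  let C : T.Cell → T.Cell → ℝ := fun K K' => Φ (K.1 ∩ K'.1) K' - Φ (K.1 ∩ K'.1) K
  have hC : ∀ x ∈ X, ∀ τ, HasPotential o c τ → ∀ K K' : T.Cell, x ∈ K.carrier → x ∈ K'.carrier →
      τ ⊆ K.1 → τ ⊆ K'.1 → C K K' = Φ τ K' - Φ τ K := by
    intro x hx τ hτ K K' hxK hxK' hK hK'
    obtain ⟨hf, hxf⟩ := hmem x hx K.1 K.2.1 K'.1 K'.2.1 hxK hxK'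
    have hp := hloc _ hf ⟨x, hxf, hx⟩
    have := eq_of_forall_jump_eq_zero hΩ hN o hf ⟨x, hxf, hXΩ hx⟩
      (φ := fun J => Φ (K.1 ∩ K'.1) J - Φ τ J) (fun Γ hΓ => by
        have h1 := hΦ _ hp Γ hΓ
        have h2 := hΦ τ hτ Γ ((Finset.subset_inter hK hK').trans hΓ)
        linarith) Finset.inter_subset_left Finset.inter_subset_right
    simp only [C]
    linarith
  obtain ⟨n, hn⟩ := hX.exists_real_coboundary (K := fun K : T.Cell => K.carrier)
    (fun K => K.isCompact_carrier.isClosed) (fun K => K.carrier_nonempty)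
    (fun x hx => mem_iUnion.2 (exists_cell_mem (hXΩ hx))) hconn (c := C)
    (fun x hx i j k hi hj hk => by
      obtain ⟨hf, hxf⟩ := hmem x hx i.1 i.2.1 j.1 j.2.1 hi hj
      obtain ⟨hf3, hxf3⟩ := hmem x hx _ hf k.1 k.2.1 hxf hk
      have hp := hloc _ hf3 ⟨x, hxf3, hx⟩
      have h1 : i.1 ∩ j.1 ∩ k.1 ⊆ i.1 := Finset.inter_subset_left.trans Finset.inter_subset_left
      have h2 : i.1 ∩ j.1 ∩ k.1 ⊆ j.1 := Finset.inter_subset_left.trans Finset.inter_subset_right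
      have h3 : i.1 ∩ j.1 ∩ k.1 ⊆ k.1 := Finset.inter_subset_right
      rw [hC x hx _ hp i j hi hj h1 h2, hC x hx _ hp j k hj hk h2 h3,
        hC x hx _ hp i k hi hk h1 h3]
      ring)
  refine ⟨n, fun Γ ⟨x, hxΓ, hx⟩ => ?_⟩
  have hxm : x ∈ (o.minus Γ).carrier := convexHull_mono (by exact_mod_cast o.subset_minus Γ) hxΓ
  have hxp : x ∈ (o.plus Γ).carrier := convexHull_mono (by exact_mod_cast o.subset_plus Γ) hxΓ
  have hp := hloc Γ.1 Γ.2.1.1 ⟨x, hxΓ, hx⟩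
  rw [← hn _ _ ⟨x, ⟨hxm, hxp⟩, hx⟩, hC x hx Γ.1 hp _ _ hxm hxp (o.subset_minus Γ) (o.subset_plus Γ)]
  exact hΦ _ hp Γ subset_rfl

/-- A small punctured ball around `p` has logarithms in dimension at least three, and the faces
meeting it have at least two vertices, so their potentials are given. Globalizing over it produces a
potential around `p`. -/
lemma hasPotential_singleton (hΩ : IsOpen Ω) (hN : 2 < N) (o : T.Orientation)
    (c : T.InteriorFace → ℝ) {p : Euc N} (hpΩ : p ∈ Ω)
    (hloc : ∀ τ ∈ T.faces, 2 ≤ τ.card → (convexHull ℝ (τ : Set (Euc N)) ∩ Ω).Nonempty →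
      HasPotential o c τ) : HasPotential o c {p} := by
  classical
  have hfin := T.finite_faces
  let F : Set (Euc N) := ⋃ τ ∈ {τ ∈ T.faces | p ∉ convexHull ℝ (τ : Set (Euc N))},
    convexHull ℝ (τ : Set (Euc N))
  have hF : IsClosed F := (hfin.subset fun τ h => h.1).isClosed_biUnion fun τ _ =>
    (τ.finite_toSet.isCompact_convexHull ℝ).isClosed
  have hpF : p ∈ Ω ∩ Fᶜ := by
    refine ⟨hpΩ, fun h => ?_⟩
    obtain ⟨τ, hτ, hpτ⟩ := mem_iUnion₂.1 h
    exact hτ.2 hpτ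
  obtain ⟨r, hr, hB⟩ := Metric.isOpen_iff.1 (hΩ.inter hF.isOpen_compl) p hpF
  have hnear : ∀ τ ∈ T.faces, ∀ x ∈ Metric.ball p r, x ∈ convexHull ℝ (τ : Set (Euc N)) →
      p ∈ convexHull ℝ (τ : Set (Euc N)) := by
    intro τ hτ x hx hxτ
    by_contra hcon
    exact (hB hx).2 (mem_biUnion (show τ ∈ {τ ∈ T.faces | _} from ⟨hτ, hcon⟩) hxτ)
  by_cases hvert : ∃ Γ : T.InteriorFace, {p} ⊆ Γ.1
  swap
  · exact ⟨fun _ => 0, fun Γ h => (hvert ⟨Γ, h⟩).elim⟩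
  obtain ⟨Γ₀, hΓ₀⟩ := hvert
  have hpface : {p} ∈ T.faces := T.down_closed Γ₀.2.1.1 hΓ₀ (Finset.singleton_nonempty p)
  have hpvert : ∀ K : T.Cell, p ∈ K.carrier → p ∈ K.1 := by
    intro K hK
    have h := T.inter_subset_convexHull hpface K.2.1 ⟨by simp, hK⟩
    obtain ⟨q, hq1, hq2⟩ := convexHull_nonempty_iff.1 ⟨_, h⟩
    have : q = p := by simpa using hq1
    exact this ▸ hq2
  obtain ⟨n, hn⟩ := exists_potential_on hΩ (by omega) o c (X := Metric.ball p r \ {p})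
    (fun x hx => (hB hx.1).1)
    (hasLogarithms_ball_diff_singleton (by simpa using hN) p hr)
    (fun K => by
      by_cases hpK : p ∈ K.carrier
      · have hpK1 := hpvert K hpK
        obtain ⟨q, hq, hqp⟩ := Finset.exists_mem_ne (s := K.1) (by rw [K.2.2]; omega) p
        have hconv : Convex ℝ (interior K.carrier ∩ Metric.ball p r) :=
          K.convex_carrier.interior.inter (convex_ball p r)
        -- The set lies between a convex set and its closure: the vertex `p` is not an interior
        -- point of `K`.
        refine hconv.isPreconnected.subset_closure ?_ ?_
        · rintro x ⟨hx, hxB⟩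
          refine ⟨interior_subset hx, hxB, ?_⟩
          rintro rfl
          have := K.mem_interior.1 hx q hq
          rw [K.bary_vertex_of_ne hpK1 hqp] at this
          exact this.false
        · rintro x ⟨hx, hxB, -⟩
          rw [inter_comm]
          exact Metric.isOpen_ball.inter_closure ⟨hxB, K.subset_closure_interior hx⟩
      · have : K.carrier ∩ (Metric.ball p r \ {p}) = ∅ := by
          refine eq_empty_of_forall_notMem fun x hx => hpK (hnear K.1 K.2.1 x hx.2.1 hx.1)
        rw [this]; exact isPreconnected_empty)
    (fun τ hτ ⟨x, hxτ, hxB, hxp⟩ => by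
      refine hloc τ hτ ?_ ⟨x, hxτ, (hB hxB).1⟩
      by_contra hcard
      have h1 : τ.card = 1 := by
        have := (nonempty_of_mem_faces hτ).card_pos
        omega
      obtain ⟨q, rfl⟩ := Finset.card_eq_one.1 h1
      have h2 := hnear _ hτ x hxB hxτ
      simp only [Finset.coe_singleton, convexHull_singleton, mem_singleton_iff] at h2 hxτ
      exact hxp (by rw [hxτ, ← h2]; rfl))
  refine ⟨n, fun Γ hΓ => hn Γ ?_⟩
  have hpΓ : p ∈ Γ.1 := hΓ (Finset.mem_singleton_self p)
  -- A point close to `p` on the edge towards `q` witnesses that `Γ` meets the punctured ball.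
  obtain ⟨q, hq, hqp⟩ := Finset.exists_mem_ne (s := Γ.1) (by rw [Γ.2.1.2]; omega) p
  have hev : ∀ᶠ t : ℝ in nhdsWithin 0 (Ioi 0), p + t • (q - p) ∈ Metric.ball p r := by
    have hc : Continuous fun t : ℝ => p + t • (q - p) := by fun_prop
    have := hc.tendsto 0
    simp only [zero_smul, add_zero] at this
    exact (this.mono_left nhdsWithin_le_nhds).eventually (Metric.ball_mem_nhds p hr)
  have h1' : ∀ᶠ t : ℝ in nhdsWithin 0 (Ioi 0), t < 1 :=
    nhdsWithin_le_nhds (gt_mem_nhds one_pos)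
  obtain ⟨t, ⟨ht, ht1⟩, ht0⟩ := ((hev.and h1').and self_mem_nhdsWithin).exists
  replace ht0 : 0 < t := ht0
  refine ⟨p + t • (q - p), ?_, ht, ?_⟩
  · have := (convex_convexHull ℝ (Γ.1 : Set (Euc N))) (subset_convexHull ℝ _ hpΓ)
      (subset_convexHull ℝ _ hq) (sub_nonneg.2 ht1.le) ht0.le (by ring)
    convert! this using 1; module
  · intro h
    have h2 : t • (q - p) = 0 := by simpa using h
    rcases smul_eq_zero.1 h2 with h3 | h3
    · exact ht0.ne' h3
    · exact hqp (sub_eq_zero.1 h3)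

/-- On a mesh of a simply connected domain, potentials around the ridges yield a global one. -/
theorem exists_potential (hN : N = 2 ∨ N = 3) (hΩ : IsOpen Ω) (hsc : IsSimplyConnected Ω)
    (hL : HasLipschitzBoundary Ω) (o : T.Orientation) (c : T.InteriorFace → ℝ)
    (hridge : ∀ σ ∈ T.faces, σ.card + 1 = N → (convexHull ℝ (σ : Set (Euc N)) ∩ Ω).Nonempty →
      HasPotential o c σ) :
    ∃ n : T.Cell → ℝ, ∀ Γ : T.InteriorFace, n (o.plus Γ) - n (o.minus Γ) = c Γ := by
  have hbig : ∀ τ ∈ T.faces, N ≤ τ.card + 1 →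
      (convexHull ℝ (τ : Set (Euc N)) ∩ Ω).Nonempty → HasPotential o c τ := by
    intro τ hτ hc hτΩ
    rcases hc.eq_or_lt with h | h
    · exact hridge τ hτ h.symm hτΩ
    · exact hasPotential_of_le_card o c (by omega)
  have hall : ∀ τ ∈ T.faces, (convexHull ℝ (τ : Set (Euc N)) ∩ Ω).Nonempty →
      HasPotential o c τ := by
    intro τ hτ hτΩ
    have hpos := (nonempty_of_mem_faces hτ).card_pos
    by_cases hc : N ≤ τ.card + 1
    · exact hbig τ hτ hc hτΩ
    -- Only the vertices of a three-dimensional mesh remain.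
    · obtain ⟨p, rfl⟩ := Finset.card_eq_one.1 (show τ.card = 1 by omega)
      obtain ⟨x, hx, hxΩ⟩ := hτΩ
      have hxp : x = p := by simpa using hx
      exact hasPotential_singleton hΩ (by simp at hc; omega) o c (hxp ▸ hxΩ)
        fun τ' hτ' hc' => hbig τ' hτ' (by omega)
  obtain ⟨n, hn⟩ := exists_potential_on hΩ (by omega) o c subset_rfl (hsc.hasLogarithms hΩ)
    (fun K => by
      -- The Lipschitz boundary puts the interior of an element inside `Ω`, so `K.carrier ∩ Ω` lies
      -- between a convex set and its closure.
      refine K.convex_carrier.interior.isPreconnected.subset_closure ?_ ?_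
      · refine fun x hx => ⟨interior_subset hx, ?_⟩
        rw [← hL.interior_closure hΩ]
        exact interior_mono K.carrier_subset_closure hx
      · exact fun x hx => K.subset_closure_interior hx.1) hall
  refine ⟨n, fun Γ => hn Γ ?_⟩
  by_contra hcon
  rw [not_nonempty_iff_eq_empty] at hcon
  refine Γ.2.2 fun x hx => ?_
  rw [hΩ.frontier_eq]
  refine ⟨?_, fun hxΩ => ?_⟩
  · rw [← T.space_eq]
    exact Geometry.SimplicialComplex.convexHull_subset_space Γ.2.1.1 hx
  · have : x ∈ convexHull ℝ (Γ.1 : Set (Euc N)) ∩ Ω := ⟨hx, hxΩ⟩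
    rw [hcon] at this
    exact this

/-! ### Normal components on faces and conservative fields -/

noncomputable section

/-- The surface measure of a face. -/
def Face.area (Γ : T.Face) : ℝ :=
  (Measure.euclideanHausdorffMeasure (N - 1) : Measure (Euc N)).real Γ.carrier

lemma Face.isCompact_carrier (Γ : T.Face) : IsCompact Γ.carrier :=
  Γ.1.finite_toSet.isCompact_convexHull ℝ

/-- An isometric chart on the direction space turns the Hausdorff measure into Lebesgue measure and
the face into a set with interior. Positivity allows face integrals to be replaced by values of the
normal component. -/
lemma Face.area_pos (Γ : T.Face) : 0 < Γ.area := by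
  classical
  obtain ⟨q, hq⟩ := nonempty_of_mem_faces Γ.2.1
  let D := vectorSpan ℝ (Γ.1 : Set (Euc N))
  have hind := T.indep Γ.2.1
  have hN : N = (N - 1) + 1 := by
    have := (nonempty_of_mem_faces Γ.2.1).card_pos
    rw [Γ.2.2] at this; omega
  have hD : Module.finrank ℝ D = N - 1 := by
    have h := hind.finrank_vectorSpan (n := N - 1) (by
      rw [Fintype.card_coe, Γ.2.2]; exact hN)
    rwa [Subtype.range_coe_subtype] at h
  let φ : D →ᵃ[ℝ] Euc N := D.subtype.toAffineMap + AffineMap.const ℝ D q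
  have hφ : ∀ d, φ d = (d : Euc N) + q := fun d => rfl
  have hiso : Isometry φ := Isometry.of_dist_eq fun a b => by
    rw [hφ, hφ, dist_add_right]; rfl
  let s : Set D := φ ⁻¹' Γ.carrier
  have hsub : Γ.carrier ⊆ range φ := by
    have hconv : Convex ℝ (range φ) := by
      rw [← image_univ]; exact convex_univ.affine_image φ
    refine convexHull_min (fun x hx => ?_) hconv
    exact ⟨⟨x - q, vsub_mem_vectorSpan ℝ hx hq⟩, by rw [hφ]; simp⟩
  have hvol : (Measure.euclideanHausdorffMeasure (N - 1) : Measure (Euc N)) Γ.carrier =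
      volume s := by
    rw [← image_preimage_eq_of_subset hsub, hiso.euclideanHausdorffMeasure_image, ← hD,
      InnerProductSpace.euclideanHausdorffMeasure_eq_volume]
  have hcomp : IsCompact s := hiso.isClosedEmbedding.isCompact_preimage Γ.isCompact_carrier
  let P : Γ.1 → D := fun x => ⟨x - q, vsub_mem_vectorSpan ℝ x.2 hq⟩
  have hP : ∀ x, φ (P x) = x := fun x => by rw [hφ]; simp [P]
  have hPind : AffineIndependent ℝ P := by
    apply AffineIndependent.of_comp φ
    have : φ ∘ P = ((↑) : Γ.1 → Euc N) := funext hP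
    rwa [this]
  have htop : affineSpan ℝ (range P) = ⊤ := by
    rw [hPind.affineSpan_eq_top_iff_card_eq_finrank_add_one, Fintype.card_coe, Γ.2.2, hD]
    exact hN
  have hint : (interior s).Nonempty := by
    refine ((interior_convexHull_nonempty_iff_affineSpan_eq_top).2 htop).mono (interior_mono ?_)
    have hconv : Convex ℝ s := (convex_convexHull ℝ _).affine_preimage φ
    refine convexHull_min ?_ hconv
    rintro _ ⟨x, rfl⟩
    change φ (P x) ∈ Γ.carrier
    rw [hP]
    exact subset_convexHull ℝ _ x.2
  rw [Face.area, measureReal_def, hvol]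
  exact ENNReal.toReal_pos (Measure.measure_pos_of_nonempty_interior _ hint).ne'
    hcomp.measure_lt_top.ne

lemma Face.integral_eq_of_forall_eq (Γ : T.Face) {g : Euc N → ℝ} {r : ℝ}
    (h : ∀ x ∈ Γ.carrier, g x = r) : Γ.integral g = Γ.area * r := by
  rw [Face.integral, setIntegral_congr_fun Γ.isCompact_carrier.measurableSet h, setIntegral_const,
    smul_eq_mul, Face.area]

lemma Orientation.inner_ν_eq (o : T.Orientation) (Γ : T.Face) {q x : Euc N} (hq : q ∈ Γ.1)
    (hx : x ∈ Γ.carrier) : inner ℝ x (o.ν Γ) = inner ℝ q (o.ν Γ) := by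
  have hconv : Convex ℝ {x : Euc N | inner ℝ x (o.ν Γ) = inner ℝ q (o.ν Γ)} := by
    have h := convex_hyperplane (r := inner ℝ q (o.ν Γ)) (innerSL ℝ (o.ν Γ)).toLinearMap.isLinear
    convert! h using 3
    rw [real_inner_comm]; rfl
  refine convexHull_min (fun r hr => ?_) hconv hx
  have := o.ν_orthogonal Γ r hr q hq
  rw [real_inner_comm, inner_sub_left] at this
  exact sub_eq_zero.1 this

/-- The normal component of a Raviart–Thomas function is constant on a face. -/
lemma Orientation.inner_affine_ν_eq (o : T.Orientation) (Γ : T.Face) {v : Euc N → Euc N}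
    {a : Euc N} {b : ℝ} (hv : ∀ x, v x = a + b • x) {q x : Euc N} (hq : q ∈ Γ.1)
    (hx : x ∈ Γ.carrier) : inner ℝ (v x) (o.ν Γ) = inner ℝ (v q) (o.ν Γ) := by
  rw [hv, hv, inner_add_left, inner_add_left, inner_smul_left, inner_smul_left,
    o.inner_ν_eq Γ hq hx]

lemma inner_ν_eq_of_mem_Vh {o : T.Orientation} {v : T.Cell → Euc N → Euc N} (hv : v ∈ T.Vh o)
    (Γ : T.Face) {K K' : T.Cell} (hK : Γ.1 ⊆ K.1) (hK' : Γ.1 ⊆ K'.1) {q : Euc N} (hq : q ∈ Γ.1) :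
    inner ℝ (v K q) (o.ν Γ) = inner ℝ (v K' q) (o.ν Γ) := by
  obtain ⟨hform, hcont, -⟩ := hv
  obtain ⟨a, b, hab⟩ := hform K
  obtain ⟨a', b', hab'⟩ := hform K'
  have h := hcont Γ K K' hK hK'
  rw [Γ.integral_eq_of_forall_eq fun x hx => o.inner_affine_ν_eq Γ hab hq hx,
    Γ.integral_eq_of_forall_eq fun x hx => o.inner_affine_ν_eq Γ hab' hq hx] at h
  exact mul_left_cancel₀ Γ.area_pos.ne' h

lemma inner_ν_eq_zero_of_mem_Vh {o : T.Orientation} {v : T.Cell → Euc N → Euc N}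
    (hv : v ∈ T.Vh o) (Γ : T.Face) (hΓ : Γ.carrier ⊆ frontier Ω) {K : T.Cell} (hK : Γ.1 ⊆ K.1)
    {q : Euc N} (hq : q ∈ Γ.1) : inner ℝ (v K q) (o.ν Γ) = 0 := by
  obtain ⟨hform, -, hbd⟩ := hv
  obtain ⟨a, b, hab⟩ := hform K
  have h := hbd Γ K hK hΓ
  rw [Γ.integral_eq_of_forall_eq fun x hx => o.inner_affine_ν_eq Γ hab hq hx] at h
  exact (mul_eq_zero.1 h).resolve_left Γ.area_pos.ne'

/-- The normal of a face is a multiple of the gradient of the opposite barycentric coordinate. -/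
lemma Orientation.inner_ν (o : T.Orientation) (Γ : T.Face) {K : T.Cell} {p q : Euc N}
    (hp : p ∈ K.1) (hK : ∀ r, r ∈ K.1 ↔ r = p ∨ r ∈ Γ.1) (hq : q ∈ Γ.1) (v : Euc N) :
    inner ℝ (o.ν Γ) v = inner ℝ (o.ν Γ) (p - q) * inner ℝ (K.grad p) v := by
  have h := fun x => K.inner_sub_eq_bary_mul (q := q) (n := o.ν Γ) hp
    (fun r hr hrp => o.ν_orthogonal Γ r (((hK r).1 hr).resolve_left hrp) q hq) x
  have h1 := h v
  have h2 := h 0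
  have h3 := K.bary_sub_bary p v 0
  rw [sub_zero] at h3
  rw [inner_sub_right] at h1 h2
  rw [inner_zero_right] at h2
  rw [← h3]
  linear_combination h1 - h2

lemma Orientation.inner_ν_ne_zero (o : T.Orientation) (Γ : T.Face) {K : T.Cell} {p q : Euc N}
    (hp : p ∈ K.1) (hK : ∀ r, r ∈ K.1 ↔ r = p ∨ r ∈ Γ.1) (hq : q ∈ Γ.1) :
    inner ℝ (o.ν Γ) (p - q) ≠ 0 := by
  intro h0
  have h1 := o.inner_ν Γ hp hK hq (o.ν Γ)
  rw [h0, zero_mul, real_inner_self_eq_norm_sq, o.norm_ν] at h1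
  norm_num at h1

namespace Orientation
variable (o : T.Orientation)

/-- The vertex of the element `plus Γ` opposite to `Γ`. -/
def plusApex (Γ : T.InteriorFace) : Euc N :=
  ((o.plus Γ).exists_apex Γ.2.1.2 (o.subset_plus Γ)).choose

/-- The vertex of the element `minus Γ` opposite to `Γ`. -/
def minusApex (Γ : T.InteriorFace) : Euc N :=
  ((o.minus Γ).exists_apex Γ.2.1.2 (o.subset_minus Γ)).choose

lemma plusApex_spec (Γ : T.InteriorFace) : o.plusApex Γ ∉ Γ.1 ∧ o.plusApex Γ ∈ (o.plus Γ).1 ∧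
    ∀ r, r ∈ (o.plus Γ).1 ↔ r = o.plusApex Γ ∨ r ∈ Γ.1 :=
  ((o.plus Γ).exists_apex Γ.2.1.2 (o.subset_plus Γ)).choose_spec

lemma minusApex_spec (Γ : T.InteriorFace) : o.minusApex Γ ∉ Γ.1 ∧
    o.minusApex Γ ∈ (o.minus Γ).1 ∧ ∀ r, r ∈ (o.minus Γ).1 ↔ r = o.minusApex Γ ∨ r ∈ Γ.1 :=
  ((o.minus Γ).exists_apex Γ.2.1.2 (o.subset_minus Γ)).choose_spec

lemma eq_of_mem_iff {K : T.Cell} {Γ : Finset (Euc N)} {p p' : Euc N} (hp : p ∉ Γ)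
    (h : ∀ r, r ∈ K.1 ↔ r = p ∨ r ∈ Γ) (h' : ∀ r, r ∈ K.1 ↔ r = p' ∨ r ∈ Γ) :
    p = p' := by
  have h1 : p ∈ K.1 := (h p).2 (Or.inl rfl)
  exact ((h' p).1 h1).resolve_right hp

open Classical in
/-- A sum over the faces of all elements, as a sum over the interior faces. -/
lemma sum_vertices_eq_sum_faces (X : T.Cell → Euc N → ℝ)
    (hX : ∀ K : T.Cell, ∀ p ∈ K.1, (∀ Γ : T.InteriorFace, Γ.1 ≠ K.1.erase p) → X K p = 0) :
    ∑ K : T.Cell, ∑ p ∈ K.1, X K p =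
      ∑ Γ : T.InteriorFace, (X (o.plus Γ) (o.plusApex Γ) + X (o.minus Γ) (o.minusApex Γ)) := by
  -- Each interior face occurs twice, opposite to one vertex of either neighbour. `X` vanishes on
  -- the remaining pairs.
  let i : T.InteriorFace × Bool → (_ : T.Cell) × Euc N := fun x =>
    if x.2 then ⟨o.plus x.1, o.plusApex x.1⟩ else ⟨o.minus x.1, o.minusApex x.1⟩
  have herase : ∀ x, (i x).1.1.erase (i x).2 = x.1.1 := by
    rintro ⟨Γ, b⟩
    ext r
    rw [Finset.mem_erase]
    cases b
    · obtain ⟨h1, h2, h3⟩ := o.minusApex_spec Γ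
      change r ≠ o.minusApex Γ ∧ r ∈ (o.minus Γ).1 ↔ r ∈ Γ.1
      rw [h3]
      exact ⟨fun h => h.2.resolve_left h.1, fun h => ⟨fun h' => h1 (h' ▸ h), Or.inr h⟩⟩
    · obtain ⟨h1, h2, h3⟩ := o.plusApex_spec Γ
      change r ≠ o.plusApex Γ ∧ r ∈ (o.plus Γ).1 ↔ r ∈ Γ.1
      rw [h3]
      exact ⟨fun h => h.2.resolve_left h.1, fun h => ⟨fun h' => h1 (h' ▸ h), Or.inr h⟩⟩
  have hinj : Function.Injective i := by
    rintro ⟨Γ, b⟩ ⟨Γ', b'⟩ h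
    have h1 : Γ = Γ' := Subtype.ext (by rw [← herase (Γ, b), h, herase])
    subst h1
    have h2 : (i (Γ, b)).1 = (i (Γ, b')).1 := congrArg Sigma.fst h
    cases b <;> cases b'
    · rfl
    · exact absurd h2 (o.minus_ne_plus Γ)
    · exact absurd h2.symm (o.minus_ne_plus Γ)
    · rfl
  rw [Finset.sum_sigma' Finset.univ (fun K : T.Cell => K.1) fun K p => X K p]
  rw [← Finset.sum_subset (s₁ := Finset.univ.image i)]
  · rw [Finset.sum_image hinj.injOn, Fintype.sum_prod_type]
    refine Finset.sum_congr rfl fun Γ _ => ?_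
    rw [Fintype.sum_bool]
    rfl
  · intro y hy
    obtain ⟨⟨Γ, b⟩, -, rfl⟩ := Finset.mem_image.1 hy
    rw [Finset.mem_sigma]
    cases b
    · exact ⟨Finset.mem_univ _, (o.minusApex_spec Γ).2.1⟩
    · exact ⟨Finset.mem_univ _, (o.plusApex_spec Γ).2.1⟩
  · rintro ⟨K, p⟩ hK hnot
    have hp : p ∈ K.1 := (Finset.mem_sigma.1 hK).2
    refine hX K p hp fun Γ hΓ => hnot ?_
    have hKΓ : ∀ r, r ∈ K.1 ↔ r = p ∨ r ∈ Γ.1 := by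
      intro r
      rw [hΓ, Finset.mem_erase]
      by_cases h : r = p
      · simp [h, hp]
      · simp [h]
    have hpΓ : p ∉ Γ.1 := by rw [hΓ]; simp
    rw [Finset.mem_image]
    rcases o.eq_minus_or_eq_plus Γ (K := K) (hΓ ▸ Finset.erase_subset p K.1) with rfl | rfl
    · refine ⟨(Γ, false), Finset.mem_univ _, ?_⟩
      change (⟨o.minus Γ, o.minusApex Γ⟩ : (_ : T.Cell) × Euc N) = _
      rw [eq_of_mem_iff (o.minusApex_spec Γ).1 (o.minusApex_spec Γ).2.2 hKΓ]
    · refine ⟨(Γ, true), Finset.mem_univ _, ?_⟩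
      change (⟨o.plus Γ, o.plusApex Γ⟩ : (_ : T.Cell) × Euc N) = _
      rw [eq_of_mem_iff (o.plusApex_spec Γ).1 (o.plusApex_spec Γ).2.2 hKΓ]

open Classical in
/-- A piecewise constant vector field with continuous normal components that vanish on the
boundary. -/
structure IsConservative (V : T.Cell → Euc N) : Prop where
  inner_ν_eq : ∀ Γ : T.InteriorFace,
    inner ℝ (o.ν Γ.toFace) (V (o.plus Γ)) = inner ℝ (o.ν Γ.toFace) (V (o.minus Γ))
  eq_zero : ∀ K : T.Cell, ∀ p ∈ K.1, (∀ Γ : T.InteriorFace, Γ.1 ≠ K.1.erase p) →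
    inner ℝ (K.grad p) (V K) = 0

/-- The flux of a field through an interior face (up to a constant factor). -/
def flux (V : T.Cell → Euc N) (Γ : T.InteriorFace) : ℝ :=
  (o.plus Γ).vol * inner ℝ ((o.plus Γ).grad (o.plusApex Γ)) (V (o.plus Γ))

variable {o}

/-- Volumes are proportional to the heights above the common face and gradients inversely so. Volume
times gradient is therefore the same normal vector from both sides, up to sign. -/
lemma IsConservative.flux_eq {V : T.Cell → Euc N} (hV : o.IsConservative V)
    (Γ : T.InteriorFace) :
    (o.minus Γ).vol * inner ℝ ((o.minus Γ).grad (o.minusApex Γ)) (V (o.minus Γ)) =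
      -o.flux V Γ := by
  obtain ⟨q, hq⟩ := nonempty_of_mem_faces Γ.2.1.1
  obtain ⟨h1, h2, h3⟩ := o.minusApex_spec Γ
  obtain ⟨h1', h2', h3'⟩ := o.plusApex_spec Γ
  have hm := o.minus_side Γ _ h2 h1 q hq
  have hp := o.plus_side Γ _ h2' h1' q hq
  have e1 := o.inner_ν Γ.toFace h2 h3 hq (V (o.minus Γ))
  have e2 := o.inner_ν Γ.toFace h2' h3' hq (V (o.plus Γ))
  have e3 := (o.plus Γ).inner_sub_eq_bary_mul (q := q) (n := o.ν Γ.toFace) h2'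
    (fun r hr hrp => o.ν_orthogonal Γ.toFace r (((h3' r).1 hr).resolve_left hrp) q hq)
    (o.minusApex Γ)
  have hvol := Cell.vol_eq_abs_bary_mul_vol h2' h2 (K := o.plus Γ) (K' := o.minus Γ) (by
    ext r
    have a1 := h3 r
    have a2 := h3' r
    simp only [mem_sdiff, Finset.mem_coe, mem_singleton_iff, a1, a2]
    constructor
    · rintro ⟨h, h'⟩
      have := h.resolve_left h'
      exact ⟨Or.inr this, fun h4 => h1 (h4 ▸ this)⟩
    · rintro ⟨h, h'⟩
      have := h.resolve_left h'
      exact ⟨Or.inr this, fun h4 => h1' (h4 ▸ this)⟩)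
  have hc := hV.inner_ν_eq Γ
  rw [e1, e2] at hc
  set Hm := inner ℝ (o.ν Γ.toFace) (o.minusApex Γ - q)
  set Hp := inner ℝ (o.ν Γ.toFace) (o.plusApex Γ - q)
  have hneg : (o.plus Γ).bary (o.plusApex Γ) (o.minusApex Γ) < 0 := by
    by_contra hcon
    push Not at hcon
    have := mul_nonneg hcon hp.le
    linarith
  rw [abs_of_neg hneg] at hvol
  set β := (o.plus Γ).bary (o.plusApex Γ) (o.minusApex Γ)
  rw [flux, hvol]
  have : Hp * (β * inner ℝ ((o.minus Γ).grad (o.minusApex Γ)) (V (o.minus Γ)) -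
      inner ℝ ((o.plus Γ).grad (o.plusApex Γ)) (V (o.plus Γ))) = 0 := by
    rw [mul_sub, ← mul_assoc, mul_comm Hp β, ← e3, hc]; ring
  have := (mul_eq_zero.1 this).resolve_left hp.ne'
  linear_combination (-(o.plus Γ).vol) * this

lemma IsConservative.sum_eq {V : T.Cell → Euc N} (hV : o.IsConservative V)
    (ψ : T.Cell → Euc N → ℝ) :
    ∑ K : T.Cell, ∑ p ∈ K.1, K.vol * inner ℝ (K.grad p) (V K) * ψ K p =
      ∑ Γ, o.flux V Γ * (ψ (o.plus Γ) (o.plusApex Γ) - ψ (o.minus Γ) (o.minusApex Γ)) := by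
  classical
  rw [o.sum_vertices_eq_sum_faces (fun K p => K.vol * inner ℝ (K.grad p) (V K) * ψ K p)
    fun K p hp h => by rw [hV.eq_zero K p hp h]; ring]
  refine Finset.sum_congr rfl fun Γ _ => ?_
  rw [hV.flux_eq Γ, flux]; ring

/-- This is the discrete divergence theorem; it rests on the barycentric gradients of an element
summing to zero. -/
lemma IsConservative.sum_flux_mul_jump {V : T.Cell → Euc N} (hV : o.IsConservative V)
    (φ : T.Cell → ℝ) : ∑ Γ, o.flux V Γ * (φ (o.plus Γ) - φ (o.minus Γ)) = 0 := by
  rw [← hV.sum_eq fun K _ => φ K]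
  refine Finset.sum_eq_zero fun K _ => ?_
  rw [← Finset.sum_mul, ← Finset.mul_sum, K.sum_inner_grad]; ring

/-- Expanding `V K` along the vertices puts the pairing into flux form. The factor of the flux is
the function on faces whose potential is sought in `eq_zero_of_orthogonal`. -/
lemma IsConservative.sum_inner {V : T.Cell → Euc N} (hV : o.IsConservative V)
    (U : T.Cell → Euc N) : ∑ K : T.Cell, K.vol * inner ℝ (U K) (V K) =
      ∑ Γ, o.flux V Γ *
        (inner ℝ (U (o.plus Γ)) (o.plusApex Γ) - inner ℝ (U (o.minus Γ)) (o.minusApex Γ)) := by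
  rw [← hV.sum_eq fun K p => inner ℝ (U K) p]
  refine Finset.sum_congr rfl fun K _ => ?_
  conv_lhs => rw [← K.sum_inner_grad_smul (V K)]
  rw [inner_sum, Finset.mul_sum]
  refine Finset.sum_congr rfl fun p _ => ?_
  rw [inner_smul_right]; ring

end Orientation

/-- A conservative field on a mesh of a simply connected domain vanishes if it is orthogonal to
one conservative field circulating around each interior ridge. -/
theorem Orientation.IsConservative.eq_zero_of_orthogonal (hN : N = 2 ∨ N = 3) (hΩ : IsOpen Ω)
    (hsc : IsSimplyConnected Ω) (hL : HasLipschitzBoundary Ω) {o : T.Orientation}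
    {U : T.Cell → Euc N} (hU : o.IsConservative U)
    (hridge : ∀ σ ∈ T.faces, σ.card + 1 = N → (convexHull ℝ (σ : Set (Euc N)) ∩ Ω).Nonempty →
      ∃ C : T.Cell → Euc N, o.IsConservative C ∧ (∃ K, C K ≠ 0) ∧
        (∀ K : T.Cell, ∀ p ∈ K.1, (¬ σ ⊆ K.1 ∨ p ∈ σ) → inner ℝ (K.grad p) (C K) = 0) ∧
        ∑ K : T.Cell, K.vol * inner ℝ (U K) (C K) = 0) (K : T.Cell) : U K = 0 := by
  classical
  obtain ⟨n, hn⟩ := exists_potential hN hΩ hsc hL o (fun Γ =>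
    inner ℝ (U (o.plus Γ)) (o.plusApex Γ) - inner ℝ (U (o.minus Γ)) (o.minusApex Γ)) (by
      intro σ hσ hσc hσΩ
      obtain ⟨C, hC, ⟨K, hK⟩, hsupp, horth⟩ := hridge σ hσ hσc hσΩ
      refine hasPotential_of_flux hΩ o _ hσ hσc hσΩ (o.flux C) ?_ ?_ hC.sum_flux_mul_jump
        (by rw [← hC.sum_inner]; exact horth)
      · intro Γ hΓ
        obtain ⟨h1, h2, h3⟩ := o.plusApex_spec Γ
        rw [flux, hsupp _ _ h2, mul_zero]
        by_contra hcon
        push Not at hcon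
        refine hΓ fun r hr => ((h3 r).1 (hcon.1 hr)).resolve_left ?_
        rintro rfl
        exact hcon.2 hr
      · by_contra! hzero
        apply hK
        rw [← K.sum_inner_grad_smul (C K)]
        refine Finset.sum_eq_zero fun p hp => ?_
        suffices h : inner ℝ (K.grad p) (C K) = 0 by rw [h, zero_smul]
        by_cases hΓ : ∀ Γ : T.InteriorFace, Γ.1 ≠ K.1.erase p
        · exact hC.eq_zero K p hp hΓ
        · push Not at hΓ
          obtain ⟨Γ, hΓ⟩ := hΓ
          have hKΓ : ∀ r, r ∈ K.1 ↔ r = p ∨ r ∈ Γ.1 := by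
            intro r
            rw [hΓ, Finset.mem_erase]
            by_cases h : r = p
            · simp [h, hp]
            · simp [h]
          have hpΓ : p ∉ Γ.1 := by rw [hΓ]; simp
          rcases o.eq_minus_or_eq_plus Γ (K := K) (hΓ ▸ Finset.erase_subset p K.1) with rfl | rfl
          · have h1 := hC.flux_eq Γ
            rw [hzero, neg_zero,
              eq_of_mem_iff (o.minusApex_spec Γ).1 (o.minusApex_spec Γ).2.2 hKΓ] at h1
            exact (mul_eq_zero.1 h1).resolve_left (Cell.vol_pos _).ne'
          · have h1 := hzero Γ
            rw [flux, eq_of_mem_iff (o.plusApex_spec Γ).1 (o.plusApex_spec Γ).2.2 hKΓ] at h1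
            exact (mul_eq_zero.1 h1).resolve_left (Cell.vol_pos _).ne')
  -- The function on faces is now a jump, and the flux of `U` annihilates jumps.
  have hsum : ∑ K : T.Cell, K.vol * inner ℝ (U K) (U K) = 0 := by
    rw [hU.sum_inner, ← hU.sum_flux_mul_jump n]
    exact Finset.sum_congr rfl fun Γ _ => by rw [hn]
  have h := (Finset.sum_eq_zero_iff_of_nonneg fun K _ =>
    mul_nonneg K.vol_pos.le real_inner_self_nonneg).1 hsum K (Finset.mem_univ K)
  exact inner_self_eq_zero.1 ((mul_eq_zero.1 h).resolve_left K.vol_pos.ne')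


/-- The face of an element opposite to one of its vertices. -/
lemma Cell.erase_mem_faces (hN : 0 < N) (K : T.Cell) {p : Euc N} (hp : p ∈ K.1) :
    (letI := Classical.decEq (Euc N); K.1.erase p ∈ T.faces ∧ (K.1.erase p).card = N) := by
  classical
  have hc : (K.1.erase p).card = N := by rw [Finset.card_erase_of_mem hp, K.2.2]; rfl
  have : K.1.erase p ∈ T.faces := T.down_closed K.2.1 (Finset.erase_subset _ _)
    (Finset.card_pos.1 (by omega))
  convert! And.intro this hc

lemma isConservative_of_mem_Vh (hN : 0 < N) {o : T.Orientation} {u : T.Cell → Euc N → Euc N}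
    (hu : u ∈ T.Vh o) {U : T.Cell → Euc N} (hU : ∀ K x, u K x = U K) : o.IsConservative U := by
  classical
  refine ⟨fun Γ => ?_, fun K p hp hΓ => ?_⟩
  · obtain ⟨q, hq⟩ := nonempty_of_mem_faces Γ.2.1.1
    have := inner_ν_eq_of_mem_Vh hu Γ.toFace (o.subset_plus Γ) (o.subset_minus Γ) hq
    rw [hU, hU] at this
    rw [real_inner_comm, this, real_inner_comm]
  · have hf : K.1.erase p ∈ T.faces ∧ (K.1.erase p).card = N := by
      convert! K.erase_mem_faces hN hp
    let Γ : T.Face := ⟨K.1.erase p, hf⟩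
    have hbd : Γ.carrier ⊆ frontier Ω := by
      by_contra hcon
      exact hΓ ⟨K.1.erase p, hf, hcon⟩ (by congr!)
    have hKΓ : ∀ r, r ∈ K.1 ↔ r = p ∨ r ∈ Γ.1 := by
      intro r
      change _ ↔ r = p ∨ r ∈ K.1.erase p
      rw [Finset.mem_erase]
      by_cases h : r = p
      · simp [h, hp]
      · simp [h]
    obtain ⟨q, hq⟩ := nonempty_of_mem_faces hf.1
    have h1 := inner_ν_eq_zero_of_mem_Vh hu Γ hbd (K := K) (Finset.erase_subset p K.1) hq
    rw [hU, real_inner_comm, o.inner_ν Γ hp hKΓ hq] at h1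
    exact (mul_eq_zero.1 h1).resolve_left (o.inner_ν_ne_zero Γ hp hKΓ hq)

namespace Cell

lemma grad_of_notMem (K : T.Cell) {p : Euc N} (hp : p ∉ K.1) : K.grad p = 0 := by
  have h := K.bary_sub_bary p (K.grad p) 0
  rw [K.bary_of_notMem hp, K.bary_of_notMem hp, sub_self, sub_zero] at h
  exact inner_self_eq_zero.1 h.symm

open Classical in
lemma bary_eq_ite (K : T.Cell) {p q : Euc N} (hq : q ∈ K.1) :
    K.bary p q = if p = q then 1 else 0 := by
  by_cases h : p = q
  · subst h; rw [K.bary_self hq, if_pos rfl]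
  · rw [K.bary_vertex_of_ne hq h, if_neg h]

open Classical in
lemma inner_grad_sub (K : T.Cell) (p : Euc N) {q r : Euc N} (hq : q ∈ K.1) (hr : r ∈ K.1) :
    inner ℝ (K.grad p) (q - r) = (if p = q then 1 else 0) - (if p = r then 1 else 0) := by
  rw [← K.bary_sub_bary, K.bary_eq_ite hq, K.bary_eq_ite hr]

end Cell

/-- The tangential parts of the gradients of barycentric coordinates agree from both sides. -/
lemma Orientation.exists_grad_eq_add_smul_ν (o : T.Orientation) (Γ : T.InteriorFace)
    (s : Euc N) :
    ∃ c : ℝ, (o.plus Γ).grad s = (o.minus Γ).grad s + c • o.ν Γ.toFace := by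
  classical
  obtain ⟨q, hq⟩ := nonempty_of_mem_faces Γ.2.1.1
  obtain ⟨h1, h2, h3⟩ := o.plusApex_spec Γ
  set d := (o.plus Γ).grad s - (o.minus Γ).grad s with hd
  have hd0 : ∀ r ∈ Γ.1, inner ℝ d (r - q) = 0 := by
    intro r hr
    rw [inner_sub_left, Cell.inner_grad_sub _ _ (o.subset_plus Γ hr) (o.subset_plus Γ hq),
      Cell.inner_grad_sub _ _ (o.subset_minus Γ hr) (o.subset_minus Γ hq), sub_self]
  have h4 := (o.plus Γ).inner_sub_eq_bary_mul (q := q) (n := d) h2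
    (fun r hr hrp => hd0 r (((h3 r).1 hr).resolve_left hrp))
  have h5 : ∀ v, inner ℝ d v = inner ℝ d (o.plusApex Γ - q) *
      inner ℝ ((o.plus Γ).grad (o.plusApex Γ)) v := by
    intro v
    have e1 := h4 v
    have e2 := h4 0
    have e3 := (o.plus Γ).bary_sub_bary (o.plusApex Γ) v 0
    rw [sub_zero] at e3
    rw [inner_sub_right] at e1 e2
    rw [inner_zero_right] at e2
    rw [← e3]
    linear_combination e1 - e2
  have h6 := o.inner_ν Γ.toFace h2 h3 hq
  have h7 := o.inner_ν_ne_zero Γ.toFace h2 h3 hq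
  refine ⟨inner ℝ d (o.plusApex Γ - q) / inner ℝ (o.ν Γ.toFace) (o.plusApex Γ - q), ?_⟩
  rw [← sub_eq_iff_eq_add', ← hd]
  refine ext_inner_right ℝ fun v => ?_
  rw [inner_smul_left, h6 v, h5 v]
  simp only [conj_trivial]
  field_simp

/-- A piecewise constant field whose fluxes are concentrated on the faces containing a ridge `σ`
that meets `Ω` is conservative if these fluxes are continuous. -/
lemma Orientation.isConservative_of_ridge (hN : 0 < N) (hΩ : IsOpen Ω) {o : T.Orientation}
    {σ : Finset (Euc N)} (hσΩ : (convexHull ℝ (σ : Set (Euc N)) ∩ Ω).Nonempty)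
    {C : T.Cell → Euc N}
    (hsupp : ∀ K : T.Cell, ∀ p ∈ K.1, (¬ σ ⊆ K.1 ∨ p ∈ σ) → inner ℝ (K.grad p) (C K) = 0)
    (hcont : ∀ Γ : T.InteriorFace, σ ⊆ Γ.1 →
      inner ℝ (o.ν Γ.toFace) (C (o.plus Γ)) = inner ℝ (o.ν Γ.toFace) (C (o.minus Γ))) :
    o.IsConservative C := by
  classical
  refine ⟨fun Γ => ?_, fun K p hp hΓ => hsupp K p hp ?_⟩
  · by_cases hσΓ : σ ⊆ Γ.1
    · exact hcont Γ hσΓ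
    · obtain ⟨q, hq⟩ := nonempty_of_mem_faces Γ.2.1.1
      obtain ⟨-, h2, h3⟩ := o.plusApex_spec Γ
      obtain ⟨-, h2', h3'⟩ := o.minusApex_spec Γ
      rw [o.inner_ν Γ.toFace h2 h3 hq (C (o.plus Γ)), o.inner_ν Γ.toFace h2' h3' hq (C (o.minus Γ)),
        hsupp _ _ h2, hsupp _ _ h2',
        mul_zero, mul_zero]
      · by_contra! hcon
        exact hσΓ fun r hr => ((h3' r).1 (hcon.1 hr)).resolve_left fun h => hcon.2 (h ▸ hr)
      · by_contra! hcon
        exact hσΓ fun r hr => ((h3 r).1 (hcon.1 hr)).resolve_left fun h => hcon.2 (h ▸ hr)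
  · by_contra! hcon
    have hf : K.1.erase p ∈ T.faces ∧ (K.1.erase p).card = N := by
      convert! K.erase_mem_faces hN hp
    have hσK : σ ⊆ K.1.erase p := fun r hr => Finset.mem_erase.2
      ⟨fun h => hcon.2 (h ▸ hr), hcon.1 hr⟩
    -- The face opposite to `p` contains `σ`, so it meets `Ω` and is interior.
    obtain ⟨Γ, hΓ'⟩ := exists_interiorFace hΩ hf.1 hf.2
      (hσΩ.mono (inter_subset_inter_left _ (convexHull_mono (by exact_mod_cast hσK))))
    exact hΓ Γ (by rw [hΓ'])

end

/-! ### Differential operators on the polynomials of the finite element spaces -/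

noncomputable section

lemma _root_.pderiv_affine {F : Type} [NormedAddCommGroup F] [NormedSpace ℝ F] (i : Fin N)
    (L : Euc N →L[ℝ] F) (b : F) (x : Euc N) :
    pderiv i (fun y => L y + b) x = L (EuclideanSpace.single i 1) := by
  rw [pderiv, fderiv_add_const, L.fderiv]

lemma _root_.pderiv_inner_add (i : Fin N) (a : Euc N) (b : ℝ) (x : Euc N) :
    pderiv i (fun y => inner ℝ a y + b) x = a i := by
  have := pderiv_affine i (innerSL ℝ a) b x
  simp only [innerSL_apply_apply] at this
  rw [this, EuclideanSpace.inner_single_right]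
  simp

lemma _root_.divergence_add_smul (a : Euc N) (b : ℝ) (x : Euc N) :
    divergence (fun y => a + b • y) x = N * b := by
  have h : ∀ i, pderiv i (fun y => a + b • y) x = b • EuclideanSpace.single i 1 := by
    intro i
    have := pderiv_affine i (b • ContinuousLinearMap.id ℝ (Euc N)) a x
    simp only [add_comm _ a] at this
    exact this
  simp [divergence, h]

lemma _root_.curl2_inner_add (a : Euc 2) (b : ℝ) (x : Euc 2) :
    curl2 (fun y => inner ℝ a y + b) x = !₂[a 1, -a 0] := by
  rw [curl2, pderiv_inner_add, pderiv_inner_add]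

/-- The cross product with a fixed vector. -/
def crossCLM (b : Euc 3) : Euc 3 →L[ℝ] Euc 3 :=
  LinearMap.toContinuousLinearMap
    { toFun := fun x => WithLp.toLp 2 (crossProduct b.ofLp x.ofLp)
      map_add' := fun x y => by simp
      map_smul' := fun r x => by simp }

lemma crossCLM_apply (b x : Euc 3) :
    crossCLM b x = WithLp.toLp 2 (crossProduct b.ofLp x.ofLp) := rfl

lemma _root_.curl3_add_cross (a b : Euc 3) (x : Euc 3) :
    curl3 (fun y => a + WithLp.toLp 2 (crossProduct b.ofLp y.ofLp)) x = (2 : ℝ) • b := by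
  have h : ∀ i, pderiv i (fun y => a + WithLp.toLp 2 (crossProduct b.ofLp y.ofLp)) x =
      crossCLM b (EuclideanSpace.single i 1) := by
    intro i
    have := pderiv_affine i (crossCLM b) a x
    simp only [add_comm _ a] at this
    exact this
  rw [curl3, h, h, h]
  ext i
  fin_cases i <;> simp [crossCLM_apply, cross_apply] <;> ring


/-- What the velocity equations require of the vorticity space `W` and of its curl. -/
structure VorticitySpace (o : T.Orientation) {F : Type} [NormedAddCommGroup F]
    [InnerProductSpace ℝ F] (W : Set (T.Cell → Euc N → F)) (curl : (Euc N → F) → Euc N → Euc N) where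
  space : Submodule ℝ (T.Cell → Euc N → F)
  coe_space : (space : Set (T.Cell → Euc N → F)) = W
  finiteDimensional : FiniteDimensional ℝ space
  continuous_apply : ∀ (w : space) (K : T.Cell), Continuous (w.1 K)
  rot : space →ₗ[ℝ] (T.Cell → Euc N)
  curl_eq : ∀ (w : space) (K : T.Cell) (x : Euc N), curl (w.1 K) x = rot w K
  eq_zero : ∀ w : space, (∀ K : T.Cell, ∀ x ∈ K.carrier, w.1 K x = 0) → w = 0
  exists_ridge : ∀ σ ∈ T.faces, σ.card + 1 = N →
    (convexHull ℝ (σ : Set (Euc N)) ∩ Ω).Nonempty →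
    ∃ η : space, o.IsConservative (rot η) ∧ (∃ K, rot η K ≠ 0) ∧
      ∀ K : T.Cell, ∀ p ∈ K.1, (¬ σ ⊆ K.1 ∨ p ∈ σ) → inner ℝ (K.grad p) (rot η K) = 0

/-- An affine map that vanishes on an element vanishes. -/
lemma Cell.affine_eq_zero (K : T.Cell) {F : Type} [NormedAddCommGroup F] [NormedSpace ℝ F]
    (L : Euc N →L[ℝ] F) (b : F) (h : ∀ x ∈ K.carrier, L x + b = 0) (x : Euc N) : L x + b = 0 := by
  have : L x + b = ∑ p ∈ K.1, K.bary p x • (L p + b) := by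
    simp only [smul_add, Finset.sum_add_distrib, ← Finset.sum_smul, K.sum_bary, one_smul]
    conv_lhs => rw [← K.sum_bary_smul x]
    rw [map_sum]
    simp only [map_smul]
  rw [this]
  exact Finset.sum_eq_zero fun p hp => by rw [h p (K.subset_carrier hp), smul_zero]

lemma finiteDimensional_of_forall_exists {F P : Type} [AddCommGroup F] [Module ℝ F]
    [AddCommGroup P] [Module ℝ P] [FiniteDimensional ℝ P] (L : P →ₗ[ℝ] (Euc N → F))
    (S : Submodule ℝ (T.Cell → Euc N → F)) (h : ∀ w ∈ S, ∀ K, ∃ z, w K = L z) :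
    FiniteDimensional ℝ S := by
  let M : (T.Cell → P) →ₗ[ℝ] (T.Cell → Euc N → F) :=
    LinearMap.pi fun K => L ∘ₗ LinearMap.proj K
  have hle : S ≤ LinearMap.range M := by
    intro w hw
    choose z hz using h w hw
    exact ⟨z, funext fun K => (hz K).symm⟩
  exact Submodule.finiteDimensional_of_le hle

end

/-! ### The vorticity space in two dimensions: hat functions -/

noncomputable section TwoDimensional
variable {Ω : Set (Euc 2)} {T : SimplicialMesh Ω}

/-- The space `W_h` in two dimensions, as a subspace. -/
def Wh2Submodule (T : SimplicialMesh Ω) : Submodule ℝ (T.Cell → Euc 2 → ℝ) where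
  carrier := T.Wh2
  add_mem' := by
    rintro v w ⟨hv1, hv2, hv3⟩ ⟨hw1, hw2, hw3⟩
    refine ⟨fun K => ?_, fun p K K' h h' => ?_, fun p K h h' => ?_⟩
    · obtain ⟨a, b, h⟩ := hv1 K
      obtain ⟨a', b', h'⟩ := hw1 K
      exact ⟨a + a', b + b', fun x => by
        simp only [Pi.add_apply, h, h', inner_add_left]; ring⟩
    · simp only [Pi.add_apply, hv2 p K K' h h', hw2 p K K' h h']
    · simp only [Pi.add_apply, hv3 p K h h', hw3 p K h h', add_zero]
  zero_mem' := ⟨fun K => ⟨0, 0, fun x => by simp⟩, fun _ _ _ _ _ => rfl, fun _ _ _ _ => rfl⟩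
  smul_mem' := by
    rintro r v ⟨hv1, hv2, hv3⟩
    refine ⟨fun K => ?_, fun p K K' h h' => ?_, fun p K h h' => ?_⟩
    · obtain ⟨a, b, h⟩ := hv1 K
      exact ⟨r • a, r * b, fun x => by
        simp only [Pi.smul_apply, smul_eq_mul, h, real_inner_smul_left]; ring⟩
    · simp only [Pi.smul_apply, hv2 p K K' h h']
    · simp only [Pi.smul_apply, hv3 p K h h', smul_zero]

/-- The hat function of a vertex. -/
def hat (T : SimplicialMesh Ω) (p : Euc 2) : T.Cell → Euc 2 → ℝ := fun K x => K.bary p x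

lemma hat_mem_Wh2 (hΩ : IsOpen Ω) {p : Euc 2} (hp : p ∈ Ω) : T.hat p ∈ T.Wh2 := by
  classical
  refine ⟨fun K => ⟨K.grad p, K.bary p 0, K.bary_eq p⟩, fun q K K' h h' => ?_,
    fun q K h h' => ?_⟩
  · simp only [hat, K.bary_eq_ite h, K'.bary_eq_ite h']
  · rw [hat, K.bary_vertex_of_ne h]
    rintro rfl
    rw [hΩ.frontier_eq] at h'
    exact h'.2 hp

lemma curl2_hat (p : Euc 2) (K : T.Cell) (x : Euc 2) :
    curl2 (T.hat p K) x = !₂[K.grad p 1, -K.grad p 0] := by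
  have : T.hat p K = fun y => inner ℝ (K.grad p) y + K.bary p 0 := funext (K.bary_eq p)
  rw [this, curl2_inner_add]

/-- The two-dimensional vorticity space. -/
def vorticitySpace2 (hΩ : IsOpen Ω) (o : T.Orientation) : VorticitySpace o T.Wh2 curl2 where
  space := T.Wh2Submodule
  coe_space := rfl
  finiteDimensional := by
    let L : (Euc 2 × ℝ) →ₗ[ℝ] (Euc 2 → ℝ) :=
      { toFun := fun z x => inner ℝ z.1 x + z.2
        map_add' := fun z z' => by ext x; simp [inner_add_left]; ring
        map_smul' := fun r z => by ext x; simp [inner_smul_left]; ring }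
    refine finiteDimensional_of_forall_exists L _ fun w hw K => ?_
    obtain ⟨a, b, h⟩ := hw.1 K
    exact ⟨(a, b), funext h⟩
  continuous_apply := fun w K => by
    obtain ⟨a, b, h⟩ := w.2.1 K
    rw [funext h]; fun_prop
  rot :=
    { toFun := fun w K => curl2 (w.1 K) 0
      map_add' := fun v w => by
        ext1 K
        obtain ⟨a, b, h⟩ := v.2.1 K
        obtain ⟨a', b', h'⟩ := w.2.1 K
        have hs : (v + w).1 K = fun y => inner ℝ (a + a') y + (b + b') := by
          ext y
          change v.1 K y + w.1 K y = _
          rw [h, h', inner_add_left]; ring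
        rw [Pi.add_apply, hs, funext h, funext h', curl2_inner_add, curl2_inner_add,
          curl2_inner_add]
        ext i
        fin_cases i <;> simp; ring
      map_smul' := fun r v => by
        ext1 K
        obtain ⟨a, b, h⟩ := v.2.1 K
        have hs : (r • v).1 K = fun y => inner ℝ (r • a) y + r * b := by
          ext y
          change r * v.1 K y = _
          rw [h, real_inner_smul_left]; ring
        rw [Pi.smul_apply, hs, funext h, curl2_inner_add, curl2_inner_add]
        ext i
        fin_cases i <;> simp }
  curl_eq := fun w K x => by
    obtain ⟨a, b, h⟩ := w.2.1 K
    change curl2 (w.1 K) x = curl2 (w.1 K) 0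
    rw [funext h, curl2_inner_add, curl2_inner_add]
  eq_zero := fun w hw => by
    ext K x
    obtain ⟨a, b, h⟩ := w.2.1 K
    have := K.affine_eq_zero (innerSL ℝ a) b (fun y hy => by
      rw [innerSL_apply_apply, ← h]; exact hw K y hy) x
    rw [innerSL_apply_apply, ← h] at this
    exact this
  exists_ridge := fun σ hσ hσc hσΩ => by
    obtain ⟨p, rfl⟩ := Finset.card_eq_one.1 (show σ.card = 1 by omega)
    have hpΩ : p ∈ Ω := by
      obtain ⟨x, hx, hxΩ⟩ := hσΩ
      have : x = p := by simpa using hx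
      exact this ▸ hxΩ
    refine ⟨⟨T.hat p, hat_mem_Wh2 hΩ hpΩ⟩, ?_⟩
    simp only [LinearMap.coe_mk, AddHom.coe_mk, curl2_hat]
    have hsupp : ∀ K : T.Cell, ∀ q ∈ K.1, (¬ {p} ⊆ K.1 ∨ q ∈ ({p} : Finset (Euc 2))) →
        inner ℝ (K.grad q) (!₂[K.grad p 1, -K.grad p 0] : Euc 2) = 0 := by
      rintro K q hq (h | h)
      · rw [Finset.singleton_subset_iff] at h
        rw [K.grad_of_notMem h]
        simp [PiLp.inner_apply, Fin.sum_univ_two]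
      · rw [Finset.mem_singleton.1 h]
        simp [PiLp.inner_apply, Fin.sum_univ_two]; ring
    refine ⟨Orientation.isConservative_of_ridge (by norm_num) hΩ hσΩ hsupp fun Γ _ => ?_, ?_, hsupp⟩
    -- The two gradients differ by a multiple of `ν`, and `ν` rotated by a right angle is orthogonal
    -- to `ν`.
    · obtain ⟨c, hc⟩ := o.exists_grad_eq_add_smul_ν Γ p
      rw [hc]
      simp [PiLp.inner_apply, Fin.sum_univ_two]; ring
    · obtain ⟨K, hK⟩ := exists_cell_superset hσ
      refine ⟨K, fun h0 => ?_⟩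
      have hpK : p ∈ K.1 := hK (Finset.mem_singleton_self p)
      have hg : K.grad p = 0 := by
        have h1 := congrFun (congrArg WithLp.ofLp h0) 0
        have h2 := congrFun (congrArg WithLp.ofLp h0) 1
        ext i
        fin_cases i
        · simpa using h2
        · simpa using h1
      obtain ⟨q, hq, hqp⟩ := Finset.exists_mem_ne (s := K.1) (by rw [K.2.2]; omega) p
      have h1 := K.bary_sub_bary p p q
      rw [hg, inner_zero_left, K.bary_self hpK, K.bary_vertex_of_ne hq hqp.symm] at h1
      norm_num at h1

end TwoDimensional

/-! ### The vorticity space in three dimensions: Whitney functions of edges -/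

noncomputable section ThreeDimensional
variable {Ω : Set (Euc 3)} {T : SimplicialMesh Ω}

lemma edgeIntegral_add {v w : Euc 3 → Euc 3} (hv : Continuous v) (hw : Continuous w)
    (p q : Euc 3) : edgeIntegral (v + w) p q = edgeIntegral v p q + edgeIntegral w p q := by
  have h : ∀ u : Euc 3 → Euc 3, Continuous u → IntervalIntegrable
      (fun t : ℝ => inner ℝ (u (p + t • (q - p))) (q - p)) volume 0 1 := fun u hu =>
    Continuous.intervalIntegrable (by fun_prop) _ _
  rw [edgeIntegral, edgeIntegral, edgeIntegral, ← intervalIntegral.integral_add (h v hv) (h w hw)]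
  simp only [Pi.add_apply, inner_add_left]

lemma edgeIntegral_smul (r : ℝ) (v : Euc 3 → Euc 3) (p q : Euc 3) :
    edgeIntegral (r • v) p q = r * edgeIntegral v p q := by
  rw [edgeIntegral, edgeIntegral, ← intervalIntegral.integral_const_mul]
  simp only [Pi.smul_apply, real_inner_smul_left]

lemma continuous_add_cross (a b : Euc 3) :
    Continuous fun x : Euc 3 => a + WithLp.toLp 2 (crossProduct b.ofLp x.ofLp) :=
  continuous_const.add (crossCLM b).continuous

/-- The space `W_h` in three dimensions, as a subspace. -/
def Wh3Submodule (T : SimplicialMesh Ω) : Submodule ℝ (T.Cell → Euc 3 → Euc 3) where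
  carrier := T.Wh3
  add_mem' := by
    rintro v w ⟨hv1, hv2, hv3⟩ ⟨hw1, hw2, hw3⟩
    have hadd : ∀ K p q, edgeIntegral ((v + w) K) p q =
        edgeIntegral (v K) p q + edgeIntegral (w K) p q := by
      intro K p q
      obtain ⟨a, b, h⟩ := hv1 K
      obtain ⟨a', b', h'⟩ := hw1 K
      exact edgeIntegral_add (by rw [funext h]; exact continuous_add_cross a b)
        (by rw [funext h']; exact continuous_add_cross a' b') p q
    refine ⟨fun K => ?_, fun p q K K' h1 h2 h3 h4 => ?_, fun p q K h1 h2 h3 => ?_⟩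
    · obtain ⟨a, b, h⟩ := hv1 K
      obtain ⟨a', b', h'⟩ := hw1 K
      exact ⟨a + a', b + b', fun x => by
        simp only [Pi.add_apply, h, h', WithLp.ofLp_add, map_add, LinearMap.add_apply,
          WithLp.toLp_add]
        abel⟩
    · rw [hadd, hadd, hv2 p q K K' h1 h2 h3 h4, hw2 p q K K' h1 h2 h3 h4]
    · rw [hadd, hv3 p q K h1 h2 h3, hw3 p q K h1 h2 h3, add_zero]
  zero_mem' := ⟨fun K => ⟨0, 0, fun x => by simp⟩, fun _ _ _ _ _ _ _ _ => rfl,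
    fun _ _ _ _ _ _ => by simp [edgeIntegral]⟩
  smul_mem' := by
    rintro r v ⟨hv1, hv2, hv3⟩
    have hsmul : ∀ K p q, edgeIntegral ((r • v) K) p q = r * edgeIntegral (v K) p q :=
      fun K p q => edgeIntegral_smul r (v K) p q
    refine ⟨fun K => ?_, fun p q K K' h1 h2 h3 h4 => ?_, fun p q K h1 h2 h3 => ?_⟩
    · obtain ⟨a, b, h⟩ := hv1 K
      exact ⟨r • a, r • b, fun x => by
        simp only [Pi.smul_apply, h, WithLp.ofLp_smul, map_smul, LinearMap.smul_apply,
          WithLp.toLp_smul, smul_add]⟩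
    · rw [hsmul, hsmul, hv2 p q K K' h1 h2 h3 h4]
    · rw [hsmul, hv3 p q K h1 h2 h3, mul_zero]

/-- The Whitney function of the edge from `p` to `q`. -/
def whitney (T : SimplicialMesh Ω) (p q : Euc 3) : T.Cell → Euc 3 → Euc 3 :=
  fun K x => K.bary p x • K.grad q - K.bary q x • K.grad p

/-- The linear part is the identity `(a × b) × x = (a · x) b - (b · x) a`. -/
lemma whitney_eq (p q : Euc 3) (K : T.Cell) (x : Euc 3) :
    T.whitney p q K x = (K.bary p 0 • K.grad q - K.bary q 0 • K.grad p) +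
      WithLp.toLp 2 (crossProduct
        (WithLp.toLp 2 (crossProduct (K.grad p).ofLp (K.grad q).ofLp) : Euc 3).ofLp x.ofLp) := by
  rw [whitney, K.bary_eq p x, K.bary_eq q x]
  ext i
  fin_cases i <;>
    simp [cross_apply, PiLp.inner_apply, Fin.sum_univ_three] <;> ring

-- Along an edge the terms linear in `t` cancel, so the integrand is constant. For `p ≠ q` the
-- Whitney function is thus dual to its own edge, with a sign for the direction.
open Classical in
lemma edgeIntegral_whitney (p q : Euc 3) (K : T.Cell) {r s : Euc 3} (hr : r ∈ K.1) (hs : s ∈ K.1) :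
    edgeIntegral (T.whitney p q K) r s =
      (if p = r then 1 else 0) * (if q = s then 1 else 0) -
        (if q = r then 1 else 0) * (if p = s then 1 else 0) := by
  have h : ∀ t : ℝ, inner ℝ (T.whitney p q K (r + t • (s - r))) (s - r) =
      (if p = r then 1 else 0) * (if q = s then 1 else 0) -
        (if q = r then 1 else 0) * (if p = s then (1 : ℝ) else 0) := by
    intro t
    rw [whitney, inner_sub_left, real_inner_smul_left, real_inner_smul_left,
      K.inner_grad_sub q hs hr, K.inner_grad_sub p hs hr, K.bary_add_smul, K.bary_add_smul,
      K.bary_eq_ite hr, K.bary_eq_ite hr, K.bary_eq_ite hs, K.bary_eq_ite hs]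
    ring
  rw [edgeIntegral]
  simp only [h]
  simp

lemma whitney_mem_Wh3 (hΩ : IsOpen Ω) {p q : Euc 3} (h : (segment ℝ p q ∩ Ω).Nonempty) :
    T.whitney p q ∈ T.Wh3 := by
  classical
  refine ⟨fun K => ⟨_, _, whitney_eq p q K⟩, fun r s K K' h1 h2 h3 h4 => ?_,
    fun r s K h1 h2 h3 => ?_⟩
  · rw [edgeIntegral_whitney p q K h1 h2, edgeIntegral_whitney p q K' h3 h4]
  · obtain ⟨x, hx, hxΩ⟩ := h
    have hne : ¬ segment ℝ p q ⊆ frontier Ω := fun hsub => by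
      have := hsub hx
      rw [hΩ.frontier_eq] at this
      exact this.2 hxΩ
    rw [edgeIntegral_whitney p q K h1 h2]
    have e1 : ¬ (p = r ∧ q = s) := by
      rintro ⟨rfl, rfl⟩; exact hne h3
    have e2 : ¬ (q = r ∧ p = s) := by
      rintro ⟨rfl, rfl⟩; rw [segment_symm] at h3; exact hne h3
    rcases not_and_or.1 e1 with e1 | e1 <;> rcases not_and_or.1 e2 with e2 | e2 <;> simp [e1, e2]

/-- The three-dimensional vorticity space. -/
def vorticitySpace3 (hΩ : IsOpen Ω) (o : T.Orientation) : VorticitySpace o T.Wh3 curl3 where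
  space := T.Wh3Submodule
  coe_space := rfl
  finiteDimensional := by
    let L : (Euc 3 × Euc 3) →ₗ[ℝ] (Euc 3 → Euc 3) :=
      { toFun := fun z x => z.1 + WithLp.toLp 2 (crossProduct z.2.ofLp x.ofLp)
        map_add' := fun z z' => by
          ext1 x
          simp only [Prod.fst_add, Prod.snd_add, Pi.add_apply, WithLp.ofLp_add, map_add,
            LinearMap.add_apply, WithLp.toLp_add]
          abel
        map_smul' := fun r z => by
          ext1 x
          simp only [Prod.smul_fst, Prod.smul_snd, Pi.smul_apply, WithLp.ofLp_smul, map_smul,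
            LinearMap.smul_apply, WithLp.toLp_smul, smul_add, RingHom.id_apply] }
    refine finiteDimensional_of_forall_exists L _ fun w hw K => ?_
    obtain ⟨a, b, h⟩ := hw.1 K
    exact ⟨(a, b), funext h⟩
  continuous_apply := fun w K => by
    obtain ⟨a, b, h⟩ := w.2.1 K
    rw [funext h]; exact continuous_add_cross a b
  rot :=
    { toFun := fun w K => curl3 (w.1 K) 0
      map_add' := fun v w => by
        ext1 K
        obtain ⟨a, b, h⟩ := v.2.1 K
        obtain ⟨a', b', h'⟩ := w.2.1 K
        have hs : (v + w).1 K = fun y : Euc 3 => (a + a') +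
            WithLp.toLp 2 (crossProduct (b + b').ofLp y.ofLp) := by
          ext1 y
          change v.1 K y + w.1 K y = _
          rw [h, h']
          simp only [WithLp.ofLp_add, map_add, LinearMap.add_apply, WithLp.toLp_add]
          abel
        rw [Pi.add_apply, hs, funext h, funext h', curl3_add_cross, curl3_add_cross,
          curl3_add_cross, smul_add]
      map_smul' := fun r v => by
        ext1 K
        obtain ⟨a, b, h⟩ := v.2.1 K
        have hs : (r • v).1 K = fun y : Euc 3 => r • a +
            WithLp.toLp 2 (crossProduct (r • b).ofLp y.ofLp) := by
          ext1 y
          change r • v.1 K y = _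
          rw [h]
          simp only [WithLp.ofLp_smul, map_smul, LinearMap.smul_apply, WithLp.toLp_smul, smul_add]
        rw [Pi.smul_apply, hs, funext h, curl3_add_cross, curl3_add_cross, RingHom.id_apply,
          smul_comm] }
  curl_eq := fun w K x => by
    obtain ⟨a, b, h⟩ := w.2.1 K
    change curl3 (w.1 K) x = curl3 (w.1 K) 0
    rw [funext h, curl3_add_cross, curl3_add_cross]
  eq_zero := fun w hw => by
    refine Subtype.ext (funext fun K => funext fun x => ?_)
    obtain ⟨a, b, h⟩ := w.2.1 K
    have := K.affine_eq_zero (crossCLM b) a (fun y hy => by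
      rw [crossCLM_apply, add_comm, ← h]; exact hw K y hy) x
    rw [crossCLM_apply, add_comm, ← h] at this
    exact this
  exists_ridge := fun σ hσ hσc hσΩ => by
    classical
    obtain ⟨p, q, hpq, rfl⟩ := Finset.card_eq_two.1 (show σ.card = 2 by omega)
    have hseg : (segment ℝ p q ∩ Ω).Nonempty := by
      simpa [Finset.coe_insert, convexHull_pair] using hσΩ
    refine ⟨⟨T.whitney p q, whitney_mem_Wh3 hΩ hseg⟩, ?_⟩
    have hrot : ∀ K : T.Cell, curl3 (T.whitney p q K) 0 =
        (2 : ℝ) • (WithLp.toLp 2 (crossProduct (K.grad p).ofLp (K.grad q).ofLp) : Euc 3) := by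
      intro K
      rw [funext (whitney_eq p q K), curl3_add_cross]
    simp only [LinearMap.coe_mk, AddHom.coe_mk, hrot]
    have hsupp : ∀ K : T.Cell, ∀ r ∈ K.1,
        (¬ ({p, q} : Finset (Euc 3)) ⊆ K.1 ∨ r ∈ ({p, q} : Finset (Euc 3))) →
        inner ℝ (K.grad r) ((2 : ℝ) •
          (WithLp.toLp 2 (crossProduct (K.grad p).ofLp (K.grad q).ofLp) : Euc 3)) = 0 := by
      rintro K r hr (h | h)
      · have : p ∉ K.1 ∨ q ∉ K.1 := by
          by_contra! hcon
          exact h (Finset.insert_subset hcon.1 (Finset.singleton_subset_iff.2 hcon.2))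
        rcases this with h | h <;> rw [K.grad_of_notMem h] <;> simp
      · rw [Finset.mem_insert, Finset.mem_singleton] at h
        rcases h with rfl | rfl <;>
          simp [PiLp.inner_apply, Fin.sum_univ_three, cross_apply] <;> ring
    refine ⟨Orientation.isConservative_of_ridge (by norm_num) hΩ hσΩ hsupp fun Γ _ => ?_, ?_, hsupp⟩
    -- Adding multiples of `ν` to both factors changes their cross product only by vectors
    -- orthogonal to `ν`.
    · obtain ⟨c, hc⟩ := o.exists_grad_eq_add_smul_ν Γ p
      obtain ⟨c', hc'⟩ := o.exists_grad_eq_add_smul_ν Γ q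
      rw [hc, hc']
      simp [PiLp.inner_apply, Fin.sum_univ_three, cross_apply]; ring
    · obtain ⟨K, hK⟩ := exists_cell_superset hσ
      refine ⟨K, fun h0 => ?_⟩
      have hpK : p ∈ K.1 := hK (by simp)
      have hqK : q ∈ K.1 := hK (by simp)
      obtain ⟨r, hr, hrpq⟩ := Finset.exists_mem_notMem_of_card_lt_card
        (s := {p, q}) (t := K.1) (by rw [K.2.2, Finset.card_pair hpq]; omega)
      have hrp : p ≠ r := by rintro rfl; simp at hrpq
      have hrq : q ≠ r := by rintro rfl; simp at hrpq
      have h1 := K.inner_grad_sub p hpK hr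
      have h2 := K.inner_grad_sub p hqK hr
      have h3 := K.inner_grad_sub q hpK hr
      have h4 := K.inner_grad_sub q hqK hr
      simp only [if_true, if_neg hrp, if_neg hrq, if_neg hpq, if_neg hpq.symm, sub_zero] at h1 h2 h3 h4
      have hz : ∀ i, (crossProduct (K.grad p).ofLp (K.grad q).ofLp) i = 0 := by
        intro i
        have := congrFun (congrArg WithLp.ofLp h0) i
        simpa using this
      have z0 := hz 0
      have z1 := hz 1
      have z2 := hz 2
      simp [cross_apply] at z0 z1 z2
      simp only [PiLp.inner_apply, Fin.sum_univ_three, RCLike.inner_apply, conj_trivial,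
        PiLp.sub_apply] at h1 h2 h3 h4
      set A := K.grad p
      set B := K.grad q
      refine one_ne_zero (α := ℝ) ?_
      -- With `P = p - r` and `Q = q - r` this is `(A × B) · (P × Q) = (A · P)(B · Q) - (A · Q)(B ·
      -- P)`: the left side is zero by assumption, the right side is one.
      linear_combination -((q 0 - r 0) * B 0 + (q 1 - r 1) * B 1 + (q 2 - r 2) * B 2) * h1 - h4 +
        ((p 0 - r 0) * B 0 + (p 1 - r 1) * B 1 + (p 2 - r 2) * B 2) * h2 +
        ((p 1 - r 1) * (q 2 - r 2) - (p 2 - r 2) * (q 1 - r 1)) * z0 +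
        ((p 2 - r 2) * (q 0 - r 0) - (p 0 - r 0) * (q 2 - r 2)) * z1 +
        ((p 0 - r 0) * (q 1 - r 1) - (p 1 - r 1) * (q 0 - r 0)) * z2

end ThreeDimensional
noncomputable section

/-! ### Integrals of elementwise continuous functions -/

lemma Cell.integrableOn (K : T.Cell) {f : Euc N → ℝ} (hf : Continuous f) :
    IntegrableOn f K.carrier :=
  hf.continuousOn.integrableOn_compact K.isCompact_carrier

lemma integral_add {f g : T.Cell → Euc N → ℝ} (hf : ∀ K, Continuous (f K))
    (hg : ∀ K, Continuous (g K)) :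
    T.integral (fun K x => f K x + g K x) = T.integral f + T.integral g := by
  simp only [integral, ← Finset.sum_add_distrib]
  exact Finset.sum_congr rfl fun K _ =>
    MeasureTheory.integral_add (K.integrableOn (hf K)) (K.integrableOn (hg K))

lemma integral_const_mul (c : ℝ) (f : T.Cell → Euc N → ℝ) :
    T.integral (fun K x => c * f K x) = c * T.integral f := by
  simp only [integral, Finset.mul_sum]
  exact Finset.sum_congr rfl fun K _ => MeasureTheory.integral_const_mul _ _

lemma integral_const (c : T.Cell → ℝ) : T.integral (fun K _ => c K) = ∑ K, K.vol * c K := by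
  simp only [integral, setIntegral_const, smul_eq_mul, Cell.vol, measureReal_def]

lemma eq_zero_of_integral_eq_zero {f : T.Cell → Euc N → ℝ} (hf : ∀ K, Continuous (f K))
    (h0 : ∀ K x, 0 ≤ f K x) (h : T.integral f = 0) (K : T.Cell) :
    ∀ x ∈ K.carrier, f K x = 0 := by
  have hK := (Finset.sum_eq_zero_iff_of_nonneg fun K _ =>
    setIntegral_nonneg K.isCompact_carrier.measurableSet fun x _ => h0 K x).1 h K
    (Finset.mem_univ K)
  have hae := (setIntegral_eq_zero_iff_of_nonneg_ae (Filter.Eventually.of_forall (h0 K))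
    (K.integrableOn (hf K))).1 hK
  exact Measure.eqOn_of_ae_eq hae (hf K).continuousOn continuousOn_const
    K.subset_closure_interior

/-! ### The space `V_h` -/

/-- Normal components are constant on faces and areas are positive, so the degrees of freedom may be
read off at vertices. In this form the conditions are visibly linear. -/
lemma mem_Vh_iff {o : T.Orientation} {v : T.Cell → Euc N → Euc N} : v ∈ T.Vh o ↔
    (∀ K, ∃ (a : Euc N) (b : ℝ), ∀ x, v K x = a + b • x) ∧
    (∀ (Γ : T.Face) (K K' : T.Cell), Γ.1 ⊆ K.1 → Γ.1 ⊆ K'.1 → ∀ q ∈ Γ.1,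
      inner ℝ (v K q) (o.ν Γ) = inner ℝ (v K' q) (o.ν Γ)) ∧
    (∀ (Γ : T.Face) (K : T.Cell), Γ.1 ⊆ K.1 → Γ.carrier ⊆ frontier Ω → ∀ q ∈ Γ.1,
      inner ℝ (v K q) (o.ν Γ) = 0) := by
  refine ⟨fun h => ⟨h.1, fun Γ K K' hK hK' q hq => inner_ν_eq_of_mem_Vh h Γ hK hK' hq,
    fun Γ K hK hΓ q hq => inner_ν_eq_zero_of_mem_Vh h Γ hΓ hK hq⟩, fun ⟨h1, h2, h3⟩ =>
    ⟨h1, fun Γ K K' hK hK' => ?_, fun Γ K hK hΓ => ?_⟩⟩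
  · obtain ⟨q, hq⟩ := nonempty_of_mem_faces Γ.2.1
    obtain ⟨a, b, hab⟩ := h1 K
    obtain ⟨a', b', hab'⟩ := h1 K'
    rw [Γ.integral_eq_of_forall_eq fun x hx => o.inner_affine_ν_eq Γ hab hq hx,
      Γ.integral_eq_of_forall_eq fun x hx => o.inner_affine_ν_eq Γ hab' hq hx,
      h2 Γ K K' hK hK' q hq]
  · obtain ⟨q, hq⟩ := nonempty_of_mem_faces Γ.2.1
    obtain ⟨a, b, hab⟩ := h1 K
    rw [Γ.integral_eq_of_forall_eq fun x hx => o.inner_affine_ν_eq Γ hab hq hx,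
      h3 Γ K hK hΓ q hq, mul_zero]

/-- The space `V_h`, as a subspace. -/
def VhSubmodule (o : T.Orientation) : Submodule ℝ (T.Cell → Euc N → Euc N) where
  carrier := T.Vh o
  zero_mem' := mem_Vh_iff.2 ⟨fun K => ⟨0, 0, fun x => by simp⟩, by simp, by simp⟩
  add_mem' := by
    intro v w hv hw
    obtain ⟨hv1, hv2, hv3⟩ := mem_Vh_iff.1 hv
    obtain ⟨hw1, hw2, hw3⟩ := mem_Vh_iff.1 hw
    refine mem_Vh_iff.2 ⟨fun K => ?_, fun Γ K K' hK hK' q hq => ?_, fun Γ K hK hΓ q hq => ?_⟩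
    · obtain ⟨a, b, h⟩ := hv1 K
      obtain ⟨a', b', h'⟩ := hw1 K
      exact ⟨a + a', b + b', fun x => by rw [Pi.add_apply, Pi.add_apply, h, h']; module⟩
    · simp only [Pi.add_apply, inner_add_left, hv2 Γ K K' hK hK' q hq, hw2 Γ K K' hK hK' q hq]
    · simp only [Pi.add_apply, inner_add_left, hv3 Γ K hK hΓ q hq, hw3 Γ K hK hΓ q hq, add_zero]
  smul_mem' := by
    intro r v hv
    obtain ⟨hv1, hv2, hv3⟩ := mem_Vh_iff.1 hv
    refine mem_Vh_iff.2 ⟨fun K => ?_, fun Γ K K' hK hK' q hq => ?_, fun Γ K hK hΓ q hq => ?_⟩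
    · obtain ⟨a, b, h⟩ := hv1 K
      exact ⟨r • a, r * b, fun x => by rw [Pi.smul_apply, Pi.smul_apply, h]; module⟩
    · simp only [Pi.smul_apply, inner_smul_left, hv2 Γ K K' hK hK' q hq]
    · simp only [Pi.smul_apply, inner_smul_left, hv3 Γ K hK hΓ q hq, mul_zero]

instance (o : T.Orientation) : FiniteDimensional ℝ (VhSubmodule o) := by
  let L : (Euc N × ℝ) →ₗ[ℝ] (Euc N → Euc N) :=
    { toFun := fun z x => z.1 + z.2 • x
      map_add' := fun z z' => by
        ext1 x
        simp only [Prod.fst_add, Prod.snd_add, Pi.add_apply]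
        module
      map_smul' := fun r z => by
        ext1 x
        simp only [Prod.smul_fst, Prod.smul_snd, Pi.smul_apply, RingHom.id_apply, smul_eq_mul]
        module }
  refine finiteDimensional_of_forall_exists L _ fun v hv K => ?_
  obtain ⟨a, b, h⟩ := hv.1 K
  exact ⟨(a, b), funext h⟩

lemma continuous_of_mem_Vh {o : T.Orientation} {v : T.Cell → Euc N → Euc N} (hv : v ∈ T.Vh o)
    (K : T.Cell) : Continuous (v K) := by
  obtain ⟨a, b, h⟩ := hv.1 K
  rw [funext h]
  fun_prop

/-- The divergence of the elements of `V_h`, which is piecewise constant. -/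
def divVh (o : T.Orientation) : VhSubmodule o →ₗ[ℝ] T.Qh where
  toFun v K := divergence (v.1 K) 0
  map_add' v w := by
    ext1 K
    obtain ⟨a, b, h⟩ := v.2.1 K
    obtain ⟨a', b', h'⟩ := w.2.1 K
    have hs : (v + w).1 K = fun x => (a + a') + (b + b') • x := by
      ext1 x
      change v.1 K x + w.1 K x = _
      rw [h, h']
      module
    rw [Pi.add_apply, hs, funext h, funext h', divergence_add_smul, divergence_add_smul,
      divergence_add_smul, mul_add]
  map_smul' r v := by
    ext1 K
    obtain ⟨a, b, h⟩ := v.2.1 K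
    have hs : (r • v).1 K = fun x => r • a + (r * b) • x := by
      ext1 x
      change r • v.1 K x = _
      rw [h]
      module
    rw [Pi.smul_apply, hs, funext h, divergence_add_smul, divergence_add_smul, RingHom.id_apply,
      smul_eq_mul, mul_left_comm]

lemma divergence_eq_divVh {o : T.Orientation} (v : VhSubmodule o) (K : T.Cell) (x : Euc N) :
    divergence (v.1 K) x = divVh o v K := by
  obtain ⟨a, b, h⟩ := v.2.1 K
  change divergence (v.1 K) x = divergence (v.1 K) 0
  rw [funext h, divergence_add_smul, divergence_add_smul]

lemma exists_forall_eq_of_divVh_eq_zero (hN : 0 < N) {o : T.Orientation} {v : VhSubmodule o}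
    {K : T.Cell} (h : divVh o v K = 0) : ∃ a, ∀ x, v.1 K x = a := by
  obtain ⟨a, b, hab⟩ := v.2.1 K
  rw [← divergence_eq_divVh v K 0, funext hab, divergence_add_smul] at h
  have hb : b = 0 := (mul_eq_zero.1 h).resolve_left (by exact_mod_cast hN.ne')
  exact ⟨a, fun x => by rw [hab, hb, zero_smul, add_zero]⟩

/-! ### The velocity equations -/

namespace VorticitySpace
variable {o : T.Orientation} {F : Type} [NormedAddCommGroup F] [InnerProductSpace ℝ F]
  {W : Set (T.Cell → Euc N → F)} {curl : (Euc N → F) → Euc N → Euc N}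

/-- The bilinear form of the velocity equations. -/
def form (S : VorticitySpace o W curl) (mu lam : ℝ) :
    (S.space × VhSubmodule o) →ₗ[ℝ] Module.Dual ℝ (S.space × VhSubmodule o) :=
  LinearMap.mk₂ ℝ (fun x y => T.integral fun K z =>
      (mu * inner ℝ (S.rot x.1 K) (y.2.1 K z) + (mu + lam) * divVh o x.2 K * divVh o y.2 K) +
        (inner ℝ (x.1.1 K z) (y.1.1 K z) - inner ℝ (x.2.1 K z) (S.rot y.1 K)))
    (fun x x' y => by
      have c1 := fun K => S.continuous_apply x.1 K
      have c2 := fun K => S.continuous_apply x'.1 K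
      have c3 := fun K => S.continuous_apply y.1 K
      have c4 := fun K => continuous_of_mem_Vh x.2.2 K
      have c5 := fun K => continuous_of_mem_Vh x'.2.2 K
      have c6 := fun K => continuous_of_mem_Vh y.2.2 K
      rw [← integral_add (fun K => by fun_prop) (fun K => by fun_prop)]
      congr 1
      ext K z
      simp only [Prod.fst_add, Prod.snd_add, map_add, Submodule.coe_add, Pi.add_apply,
        inner_add_left]
      ring)
    (fun c x y => by
      rw [smul_eq_mul, ← integral_const_mul]
      congr 1
      ext K z
      simp only [Prod.smul_fst, Prod.smul_snd, map_smul, Submodule.coe_smul, Pi.smul_apply,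
        real_inner_smul_left, smul_eq_mul]
      ring)
    (fun x y y' => by
      have c1 := fun K => S.continuous_apply y.1 K
      have c2 := fun K => S.continuous_apply y'.1 K
      have c3 := fun K => S.continuous_apply x.1 K
      have c4 := fun K => continuous_of_mem_Vh y.2.2 K
      have c5 := fun K => continuous_of_mem_Vh y'.2.2 K
      have c6 := fun K => continuous_of_mem_Vh x.2.2 K
      rw [← integral_add (fun K => by fun_prop) (fun K => by fun_prop)]
      congr 1
      ext K z
      simp only [Prod.fst_add, Prod.snd_add, map_add, Submodule.coe_add, Pi.add_apply,
        inner_add_right]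
      ring)
    (fun c x y => by
      rw [smul_eq_mul, ← integral_const_mul]
      congr 1
      ext K z
      simp only [Prod.smul_fst, Prod.smul_snd, map_smul, Submodule.coe_smul, Pi.smul_apply,
        real_inner_smul_right, smul_eq_mul]
      ring)

lemma form_apply (S : VorticitySpace o W curl) (mu lam : ℝ) (x y : S.space × VhSubmodule o) :
    S.form mu lam x y = T.integral fun K z =>
      (mu * inner ℝ (S.rot x.1 K) (y.2.1 K z) + (mu + lam) * divVh o x.2 K * divVh o y.2 K) +
        (inner ℝ (x.1.1 K z) (y.1.1 K z) - inner ℝ (x.2.1 K z) (S.rot y.1 K)) := rfl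

/-- The functional on the test functions that is given by a pressure. -/
def pressure (S : VorticitySpace o W curl) :
    T.Qh →ₗ[ℝ] Module.Dual ℝ (S.space × VhSubmodule o) :=
  LinearMap.mk₂ ℝ (fun q y => T.integral fun K _ => q K * divVh o y.2 K)
    (fun q q' y => by
      simp only [integral_const, ← Finset.sum_add_distrib, Pi.add_apply]
      exact Finset.sum_congr rfl fun K _ => by ring)
    (fun c q y => by
      rw [smul_eq_mul, ← integral_const_mul]
      simp only [Pi.smul_apply, smul_eq_mul, mul_assoc])
    (fun q y y' => by
      simp only [integral_const, ← Finset.sum_add_distrib, Prod.snd_add, map_add, Pi.add_apply]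
      exact Finset.sum_congr rfl fun K _ => by ring)
    (fun c q y => by
      rw [smul_eq_mul, ← integral_const_mul]
      simp only [Prod.smul_snd, map_smul, Pi.smul_apply, smul_eq_mul, mul_left_comm])

/-- The functional on the test functions that is given by a force. -/
def force (S : VorticitySpace o W curl) (g : T.Cell → Euc N) :
    Module.Dual ℝ (S.space × VhSubmodule o) where
  toFun y := T.integral fun K z => inner ℝ (g K) (y.2.1 K z)
  map_add' y y' := by
    have c4 := fun K => continuous_of_mem_Vh y.2.2 K
    have c5 := fun K => continuous_of_mem_Vh y'.2.2 K
    rw [← integral_add (fun K => by fun_prop) (fun K => by fun_prop)]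
    congr 1
    ext K z
    simp only [Prod.snd_add, Submodule.coe_add, Pi.add_apply, inner_add_right]
  map_smul' c y := by
    rw [RingHom.id_apply, smul_eq_mul, ← integral_const_mul]
    congr 1
    ext K z
    simp only [Prod.smul_snd, Submodule.coe_smul, Pi.smul_apply, real_inner_smul_right]

theorem form_injective (S : VorticitySpace o W curl) (hN : N = 2 ∨ N = 3) (hΩ : IsOpen Ω)
    (hsc : IsSimplyConnected Ω) (hL : HasLipschitzBoundary Ω) {mu lam : ℝ} (hmu : 0 < mu)
    (hlam : 0 < lam + mu) : Function.Injective (S.form mu lam) := by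
  have hN0 : 0 < N := by omega
  rw [← LinearMap.ker_eq_bot, LinearMap.ker_eq_bot']
  rintro ⟨w, u⟩ hx
  have hxy : ∀ y, S.form mu lam (w, u) y = 0 := fun y => by rw [hx]; rfl
  -- The factor `mu` makes the two curl terms cancel; weighted squares of the vorticity and of the
  -- divergence remain.
  have hE := hxy (mu • w, u)
  rw [form_apply] at hE
  have hE' : T.integral (fun K z => (lam + mu) * (divVh o u K) ^ 2 + mu * ‖w.1 K z‖ ^ 2) = 0 := by
    rw [← hE]
    congr 1
    ext K z
    simp only [map_smul, Pi.smul_apply, Submodule.coe_smul, real_inner_smul_right,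
      real_inner_self_eq_norm_sq, real_inner_comm (u.1 K z)]
    ring
  have c1 := fun K => S.continuous_apply w K
  have hzero := eq_zero_of_integral_eq_zero (fun K => by fun_prop)
    (fun K z => by positivity) hE'
  have hw : w = 0 := S.eq_zero w fun K x hx => by
    have h1 := hzero K x hx
    have h2 : mu * ‖w.1 K x‖ ^ 2 = 0 := by
      nlinarith [mul_nonneg hlam.le (sq_nonneg (divVh o u K)),
        mul_nonneg hmu.le (sq_nonneg ‖w.1 K x‖)]
    simpa [hmu.ne'] using h2
  have hdiv : ∀ K, divVh o u K = 0 := fun K => by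
    obtain ⟨x, hx⟩ := K.interior_nonempty
    have h1 := hzero K x (interior_subset hx)
    have h2 : (lam + mu) * (divVh o u K) ^ 2 = 0 := by
      nlinarith [mul_nonneg hlam.le (sq_nonneg (divVh o u K)),
        mul_nonneg hmu.le (sq_nonneg ‖w.1 K x‖)]
    simpa [hlam.ne'] using h2
  choose U hU using fun K => exists_forall_eq_of_divVh_eq_zero hN0 (hdiv K)
  have hcons := isConservative_of_mem_Vh hN0 u.2 hU
  -- The second equation, with zero vorticity, says that `U` is orthogonal to every curl, in
  -- particular to those circulating around ridges.
  have hU0 : ∀ K, U K = 0 := hcons.eq_zero_of_orthogonal hN hΩ hsc hL fun σ hσ hσc hσΩ => by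
    obtain ⟨η, h1, h2, h3⟩ := S.exists_ridge σ hσ hσc hσΩ
    refine ⟨S.rot η, h1, h2, h3, ?_⟩
    have h4 := hxy (η, 0)
    rw [form_apply] at h4
    have h5 : T.integral (fun K _ => - inner ℝ (U K) (S.rot η K)) = 0 := by
      rw [← h4]
      congr 1
      ext K z
      simp [hw, hU]
    rw [integral_const] at h5
    simpa using h5
  have hu : u = 0 := Subtype.ext (funext fun K => funext fun x => by rw [hU, hU0]; rfl)
  rw [hw, hu]
  rfl

/-- The velocity equations are uniquely solvable, and the velocity is continuous in the
pressure. -/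
theorem exists_velocity (S : VorticitySpace o W curl) (hN : N = 2 ∨ N = 3) (hΩ : IsOpen Ω)
    (hsc : IsSimplyConnected Ω) (hL : HasLipschitzBoundary Ω) {mu lam : ℝ} (hmu : 0 < mu)
    (hlam : 0 < lam + mu) (g : T.Cell → Euc N) :
    ∃ (w : T.Qh → T.Cell → Euc N → F) (u : T.Qh → T.Cell → Euc N → Euc N),
      (∀ q, w q ∈ W ∧ u q ∈ T.Vh o ∧
        T.VelocityScheme o W curl mu lam (fun r => r) g q (w q) (u q)) ∧
      ∀ K x, Continuous fun q => u q K x := by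
  have := S.finiteDimensional
  -- Trial and test space coincide, so uniqueness gives existence.
  let B := LinearEquiv.ofInjectiveOfFinrankEq (S.form mu lam)
    (S.form_injective hN hΩ hsc hL hmu hlam) (Subspace.dual_finrank_eq).symm
  let x : T.Qh → S.space × VhSubmodule o := fun q => B.symm (S.pressure q + S.force g)
  have hx : ∀ q y, S.form mu lam (x q) y = S.pressure q y + S.force g y := fun q y => by
    have : S.form mu lam (x q) = S.pressure q + S.force g := B.apply_symm_apply _
    rw [this]; rfl
  have hW : ∀ q, (x q).1.1 ∈ W := fun q => S.coe_space.subset (x q).1.2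
  refine ⟨fun q => (x q).1.1, fun q => (x q).2.1, fun q => ⟨hW q, (x q).2.2, ?_, ?_⟩, ?_⟩
  · intro v hv
    let v' : VhSubmodule o := ⟨v, hv⟩
    have h := hx q (0, v')
    have c := fun K => continuous_of_mem_Vh hv K
    have h1 : S.form mu lam (x q) (0, v') = T.integral fun K z =>
        mu * inner ℝ (S.rot (x q).1 K) (v K z) + (mu + lam) * divVh o (x q).2 K * divVh o v' K := by
      rw [form_apply]
      congr 1
      ext K z
      simp [v']
    have h2 : S.pressure q (0, v') = T.integral fun K _ => q K * divVh o v' K := rfl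
    have h3 : S.force g (0, v') = T.integral fun K z => inner ℝ (g K) (v K z) := rfl
    rw [← h3, ← sub_eq_iff_eq_add'.2 h, h1, h2, sub_eq_add_neg, ← neg_one_mul,
      ← integral_const_mul, ← integral_add (fun K => by fun_prop) (fun K => by fun_prop)]
    congr 1
    ext K z
    rw [S.curl_eq, divergence_eq_divVh, divergence_eq_divVh v']
    ring
  · intro η hη
    let η' : S.space := ⟨η, by rw [← SetLike.mem_coe, S.coe_space]; exact hη⟩
    have h := hx q (η', 0)
    have h2 : S.pressure q (η', 0) = T.integral fun K _ => q K * divVh o 0 K := rfl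
    have h3 : S.force g (η', 0) = T.integral fun K z => inner ℝ (g K) (0 : Euc N) := rfl
    have h4 : S.pressure q (η', 0) + S.force g (η', 0) = 0 := by
      rw [h2, h3]
      simp [integral]
    rw [h4, form_apply] at h
    rw [← h]
    congr 1
    ext K z
    rw [S.curl_eq η']
    simp [η']
  · intro K z
    -- The value of the velocity at a point is an affine function of `q` on a finite-dimensional
    -- space.
    let e : (S.space × VhSubmodule o) →ₗ[ℝ] Euc N :=
      LinearMap.proj z ∘ₗ LinearMap.proj K ∘ₗ (VhSubmodule o).subtype ∘ₗ LinearMap.snd ℝ _ _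
    have he : (fun q => (x q).2.1 K z) =
        fun q => (e ∘ₗ B.symm.toLinearMap ∘ₗ S.pressure) q + e (B.symm (S.force g)) := by
      ext1 q
      change e (B.symm (S.pressure q + S.force g)) = _
      rw [map_add, map_add]; rfl
    change Continuous (fun q => (x q).2.1 K z)
    rw [he]
    exact (LinearMap.continuous_of_finiteDimensional _).add continuous_const

end VorticitySpace
end
end SimplicialMesh

/-! ### The upwind scheme: minimum principle, positivity and continuity -/

section Upwind
variable {C G : Type*} [Fintype C] [DecidableEq C] [Fintype G]

/-- The matrix of the upwind scheme with cell volumes `V` and fluxes `s`, acting on test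
functions. -/
noncomputable def upwindMatrix (m p : G → C) (V : C → ℝ) (s : G → ℝ) : Matrix C C ℝ :=
  Matrix.of fun K L => (if K = L then V K else 0) -
    ∑ Γ, ((if m Γ = K then max (s Γ) 0 else 0) + (if p Γ = K then min (s Γ) 0 else 0)) *
      ((if p Γ = L then 1 else 0) - (if m Γ = L then 1 else 0))

lemma upwindMatrix_mulVec (m p : G → C) (V : C → ℝ) (s : G → ℝ) (φ : C → ℝ) (K : C) :
    (upwindMatrix m p V s).mulVec φ K = V K * φ K -
      ∑ Γ, ((if m Γ = K then max (s Γ) 0 else 0) + (if p Γ = K then min (s Γ) 0 else 0)) *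
        (φ (p Γ) - φ (m Γ)) := by
  simp only [Matrix.mulVec, dotProduct, upwindMatrix, Matrix.of_apply, sub_mul,
    Finset.sum_sub_distrib, Finset.sum_mul]
  congr 1
  · simp
  · rw [Finset.sum_comm]
    refine Finset.sum_congr rfl fun Γ _ => ?_
    simp only [mul_assoc, sub_mul, ← Finset.mul_sum, Finset.sum_sub_distrib]
    simp

/-- The scheme is recovered by pairing with the density, so the density solves the transposed
system. -/
lemma dotProduct_upwindMatrix_mulVec (m p : G → C) (V : C → ℝ) (s : G → ℝ) (ρ φ : C → ℝ) :
    ∑ K, ρ K * (upwindMatrix m p V s).mulVec φ K = ∑ K, V K * (ρ K * φ K) -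
      ∑ Γ, (ρ (m Γ) * max (s Γ) 0 + ρ (p Γ) * min (s Γ) 0) * (φ (p Γ) - φ (m Γ)) := by
  simp only [upwindMatrix_mulVec, mul_sub (ρ _), Finset.sum_sub_distrib, Finset.mul_sum]
  congr 1
  · exact Finset.sum_congr rfl fun K _ => by ring
  · rw [Finset.sum_comm]
    refine Finset.sum_congr rfl fun Γ _ => ?_
    simp only [← mul_assoc, ← Finset.sum_mul, mul_add, Finset.sum_add_distrib]
    simp

/-- At an element where `φ` is minimal, the upwind weights and the differences that they multiply
have matching signs, so the flux sum is nonnegative and the minimum inherits the sign of the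
right-hand side. -/
lemma nonneg_of_upwindMatrix_mulVec_nonneg (m p : G → C) {V : C → ℝ} (hV : ∀ K, 0 < V K)
    (s : G → ℝ) {φ : C → ℝ} (h : ∀ K, 0 ≤ (upwindMatrix m p V s).mulVec φ K) (K : C) :
    0 ≤ φ K := by
  obtain ⟨K₀, -, hK₀⟩ := Finset.exists_min_image Finset.univ φ ⟨K, Finset.mem_univ K⟩
  refine le_trans ?_ (hK₀ K (Finset.mem_univ K))
  have h1 := h K₀
  rw [upwindMatrix_mulVec] at h1
  have h2 : 0 ≤ ∑ Γ, ((if m Γ = K₀ then max (s Γ) 0 else 0) +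
      (if p Γ = K₀ then min (s Γ) 0 else 0)) * (φ (p Γ) - φ (m Γ)) := by
    refine Finset.sum_nonneg fun Γ _ => ?_
    rw [add_mul]
    refine add_nonneg ?_ ?_
    · split_ifs with hm
      · exact mul_nonneg (le_max_right _ _)
          (sub_nonneg.2 (hm ▸ hK₀ (p Γ) (Finset.mem_univ _)))
      · rw [zero_mul]
    · split_ifs with hp
      · exact mul_nonneg_of_nonpos_of_nonpos (min_le_right _ _)
          (sub_nonpos.2 (hp ▸ hK₀ (m Γ) (Finset.mem_univ _)))
      · rw [zero_mul]
  exact nonneg_of_mul_nonneg_right (by linarith) (hV K₀)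

/-- The minimum principle, applied to a difference and to its negative, gives injectivity. -/
lemma isUnit_det_upwindMatrix (m p : G → C) {V : C → ℝ} (hV : ∀ K, 0 < V K) (s : G → ℝ) :
    IsUnit (upwindMatrix m p V s).det := by
  rw [← Matrix.isUnit_iff_isUnit_det, ← Matrix.mulVec_injective_iff_isUnit]
  intro φ ψ h
  have h1 := nonneg_of_upwindMatrix_mulVec_nonneg m p hV s (φ := φ - ψ)
    (fun K => by rw [Matrix.mulVec_sub]; simp [h])
  have h2 := nonneg_of_upwindMatrix_mulVec_nonneg m p hV s (φ := ψ - φ)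
    (fun K => by rw [Matrix.mulVec_sub]; simp [h])
  funext K
  have h3 := h1 K
  have h4 := h2 K
  simp only [Pi.sub_apply] at h3 h4
  linarith

/-- The upwind scheme has a positive solution, which depends continuously on the fluxes. -/
theorem exists_continuous_upwind_solution (m p : G → C) {V : C → ℝ} (hV : ∀ K, 0 < V K)
    {r : C → ℝ} (hr : ∀ K, 0 < r K) :
    ∃ R : (G → ℝ) → C → ℝ, Continuous R ∧ (∀ s K, 0 < R s K) ∧ ∀ s (φ : C → ℝ),
      ∑ K, V K * (R s K * φ K) - ∑ Γ, (R s (m Γ) * max (s Γ) 0 + R s (p Γ) * min (s Γ) 0) *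
        (φ (p Γ) - φ (m Γ)) = ∑ K, V K * (r K * φ K) := by
  let A := upwindMatrix m p V
  let R : (G → ℝ) → C → ℝ := fun s => Matrix.vecMul (fun K => V K * r K) (A s)⁻¹
  have hR : ∀ s φ, ∑ K, R s K * (A s).mulVec φ K = ∑ K, V K * (r K * φ K) := fun s φ => by
    change R s ⬝ᵥ (A s).mulVec φ = _
    rw [Matrix.dotProduct_mulVec, Matrix.vecMul_vecMul,
      Matrix.nonsing_inv_mul _ (isUnit_det_upwindMatrix m p hV s), Matrix.vecMul_one]
    exact Finset.sum_congr rfl fun K _ => mul_assoc _ _ _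
  refine ⟨R, ?_, fun s K => ?_, fun s φ => ?_⟩
  · have hA : Continuous A := by
      refine continuous_matrix fun K L => ?_
      simp only [A, upwindMatrix, Matrix.of_apply]
      refine continuous_const.sub (continuous_finsetSum _ fun Γ _ => Continuous.mul ?_ continuous_const)
      refine Continuous.add ?_ ?_ <;> split_ifs <;> fun_prop
    have hinv : Continuous fun s => (A s)⁻¹ := by
      simp only [Matrix.inv_def, Ring.inverse_eq_inv']
      exact (hA.matrix_det.inv₀ fun s => (isUnit_det_upwindMatrix m p hV s).ne_zero).smul
        hA.matrix_adjugate
    exact Continuous.matrix_vecMul continuous_const hinv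
  -- Tested with this column of the inverse, the scheme expresses `R s K` as a weighted sum of `φ`,
  -- which is nonnegative and not zero.
  · let φ := (A s)⁻¹.mulVec (Pi.single K 1)
    have hφ : (A s).mulVec φ = Pi.single K 1 := by
      rw [Matrix.mulVec_mulVec, Matrix.mul_nonsing_inv _ (isUnit_det_upwindMatrix m p hV s),
        Matrix.one_mulVec]
    have h0 : ∀ L, 0 ≤ φ L := nonneg_of_upwindMatrix_mulVec_nonneg m p hV s fun L => by
      change 0 ≤ (A s).mulVec φ L
      rw [hφ]
      exact (Pi.single_nonneg.2 zero_le_one : (0 : C → ℝ) ≤ Pi.single K 1) L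
    have hne : ∃ L, φ L ≠ 0 := by
      by_contra! hcon
      have : φ = 0 := funext hcon
      rw [this, Matrix.mulVec_zero] at hφ
      have := congrFun hφ K
      simp at this
    have h1 := hR s φ
    rw [hφ] at h1
    have h2 : ∑ L, R s L * (Pi.single K 1 : C → ℝ) L = R s K := by
      simp [Pi.single_apply]
    rw [← h2, h1]
    obtain ⟨L, hL⟩ := hne
    exact Finset.sum_pos' (fun L _ => mul_nonneg (hV L).le (mul_nonneg (hr L).le (h0 L)))
      ⟨L, Finset.mem_univ L, mul_pos (hV L) (mul_pos (hr L) (lt_of_le_of_ne (h0 L) hL.symm))⟩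
  · rw [← dotProduct_upwindMatrix_mulVec, ← hR]

end Upwind

/-! ### One time step and the iteration -/

namespace SimplicialMesh
variable {N : ℕ} {Ω : Set (Euc N)} {T : SimplicialMesh Ω}

noncomputable section

/-- The integrand is constant on each face, and the nonnegative factor `dt * area` passes through
`max` and `min`. The scheme thereby takes the form of the abstract upwind scheme with fluxes `s`. -/
lemma upwindTerm_eq {o : T.Orientation} {u : T.Cell → Euc N → Euc N} (hu : u ∈ T.Vh o)
    (x : T.InteriorFace → Euc N) (hx : ∀ Γ, x Γ ∈ Γ.1) {dt : ℝ} (hdt : 0 ≤ dt) (ρ φ : T.Qh)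
    {s : T.InteriorFace → ℝ} (hs : ∀ Γ, s Γ = dt * Γ.toFace.area *
      inner ℝ (u (o.minus Γ) (x Γ)) (o.ν Γ.toFace)) :
    dt * T.upwindTerm o ρ u φ = ∑ Γ, (ρ (o.minus Γ) * max (s Γ) 0 +
      ρ (o.plus Γ) * min (s Γ) 0) * (φ (o.plus Γ) - φ (o.minus Γ)) := by
  rw [upwindTerm, Finset.mul_sum]
  refine Finset.sum_congr rfl fun Γ _ => ?_
  obtain ⟨a, b, hab⟩ := hu.1 (o.minus Γ)
  have hpos : 0 ≤ dt * Γ.toFace.area := mul_nonneg hdt Γ.toFace.area_pos.le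
  rw [Γ.toFace.integral_eq_of_forall_eq fun y hy => by
    rw [o.inner_affine_ν_eq Γ.toFace hab (hx Γ) hy], hs,
    ← mul_zero (dt * Γ.toFace.area), ← mul_max_of_nonneg _ _ hpos, ← mul_min_of_nonneg _ _ hpos,
    mul_zero]
  ring

/-- One time step of the numerical method. -/
theorem VorticitySpace.exists_step {o : T.Orientation} {F : Type} [NormedAddCommGroup F]
    [InnerProductSpace ℝ F] {W : Set (T.Cell → Euc N → F)} {curl : (Euc N → F) → Euc N → Euc N}
    (S : VorticitySpace o W curl) (hN : N = 2 ∨ N = 3) (hΩ : IsOpen Ω)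
    (hsc : IsSimplyConnected Ω) (hL : HasLipschitzBoundary Ω) {mu lam a γ dt : ℝ} (hmu : 0 < mu)
    (hlam : 0 < lam + mu) (hγ : 0 ≤ γ) (hdt : 0 ≤ dt) (g : T.Cell → Euc N) {ρ' : T.Qh}
    (hρ' : ∀ K, 0 < ρ' K) :
    ∃ (ρ : T.Qh) (w : T.Cell → Euc N → F) (u : T.Cell → Euc N → Euc N),
      (∀ K, 0 < ρ K) ∧ w ∈ W ∧ u ∈ T.Vh o ∧ T.ContinuityScheme o dt ρ' ρ u ∧
        T.VelocityScheme o W curl mu lam (fun r => a * r ^ γ) g ρ w u := by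
  obtain ⟨w, u, hwu, hcont⟩ := S.exists_velocity hN hΩ hsc hL hmu hlam g
  obtain ⟨R, hR, hRpos, hReq⟩ := exists_continuous_upwind_solution o.minus o.plus
    (fun K : T.Cell => K.vol_pos) hρ'
  choose x hx using fun Γ : T.InteriorFace => nonempty_of_mem_faces Γ.2.1.1
  let s : T.Qh → T.InteriorFace → ℝ := fun q Γ => dt * Γ.toFace.area *
    inner ℝ (u q (o.minus Γ) (x Γ)) (o.ν Γ.toFace)
  have hs : Continuous s := continuous_pi fun Γ =>
    continuous_const.mul ((hcont _ _).inner continuous_const)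
  -- On negative densities the real power has its conventional value. Only continuity matters there,
  -- since a fixed point is a value of `R` and hence positive.
  let P : T.Qh → T.Qh := fun ρ K => a * ρ K ^ γ
  have hP : Continuous P := continuous_pi fun K =>
    continuous_const.mul ((_root_.continuous_apply K).rpow_const fun _ => Or.inr hγ)
  -- The test function 1 gives conservation of mass, which bounds each value because all are
  -- positive.
  have hbound : ∀ s K, R s K ≤ (∑ L : T.Cell, L.vol * ρ' L) / K.vol := fun s K => by
    have h1 := hReq s 1
    simp only [Pi.one_apply, sub_self, mul_zero, Finset.sum_const_zero, sub_zero, mul_one] at h1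
    rw [le_div_iff₀ K.vol_pos, ← h1, mul_comm]
    exact Finset.single_le_sum (f := fun L : T.Cell => L.vol * R s L)
      (fun L _ => (mul_pos L.vol_pos (hRpos s L)).le) (Finset.mem_univ K)
  obtain ⟨ρ, hρ⟩ := exists_fixedPoint_of_bounded (F := fun ρ : T.Qh => R (s (P ρ)))
    (hR.comp (hs.comp hP)) ⟨∑ K : T.Cell, (∑ L : T.Cell, L.vol * ρ' L) / K.vol, fun ρ => by
      have h0 : ∀ K : T.Cell, 0 ≤ (∑ L : T.Cell, L.vol * ρ' L) / K.vol := fun K =>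
        (hRpos (s (P ρ)) K).le.trans (hbound _ K)
      refine (pi_norm_le_iff_of_nonneg (Finset.sum_nonneg fun K _ => h0 K)).2 fun K => ?_
      rw [Real.norm_of_nonneg (hRpos _ K).le]
      exact (hbound _ K).trans (Finset.single_le_sum (fun K _ => h0 K) (Finset.mem_univ K))⟩
  obtain ⟨hw, hu, hvel⟩ := hwu (P ρ)
  refine ⟨ρ, w (P ρ), u (P ρ), fun K => hρ ▸ hRpos _ K, hw, hu, fun φ => ?_, hvel⟩
  have h1 := hReq (s (P ρ)) φ
  simp only [hρ] at h1
  rw [upwindTerm_eq hu x hx hdt ρ φ (s := s (P ρ)) fun Γ => rfl, integral_const, integral_const]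
  exact h1

theorem VorticitySpace.exists_isNumericalSolution {o : T.Orientation} {F : Type}
    [NormedAddCommGroup F] [InnerProductSpace ℝ F] {W : Set (T.Cell → Euc N → F)}
    {curl : (Euc N → F) → Euc N → Euc N}
    (S : VorticitySpace o W curl) (hN : N = 2 ∨ N = 3) (hΩ : IsOpen Ω)
    (hsc : IsSimplyConnected Ω) (hL : HasLipschitzBoundary Ω) {mu lam a γ dt : ℝ} (hmu : 0 < mu)
    (hlam : 0 < lam + mu) (hγ : 0 ≤ γ) (hdt : 0 ≤ dt) (M : ℕ) (f : ℝ → Euc N → Euc N)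
    {ρ0 : T.Qh} (hρ0 : ∀ K, 0 < ρ0 K) :
    ∃ (ρ : ℕ → T.Qh) (w : ℕ → T.Cell → Euc N → F) (u : ℕ → T.Cell → Euc N → Euc N),
      T.IsNumericalSolution o W curl mu lam a γ dt M f ρ0 ρ w u ∧
        ∀ m : ℕ, 1 ≤ m → m ≤ M → ∀ K, 0 < ρ m K := by
  choose ρn wn un hpos hstep using fun (m : ℕ) (ρ' : {ρ : T.Qh // ∀ K, 0 < ρ K}) =>
    S.exists_step (a := a) hN hΩ hsc hL hmu hlam hγ hdt (T.discreteForce dt f m) ρ'.2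
  -- Positivity is carried along in the recursion because each step requires it of the previous
  -- density.
  let x : ℕ → {ρ : T.Qh // ∀ K, 0 < ρ K} := fun m =>
    Nat.rec ⟨ρ0, hρ0⟩ (fun k ρ' => ⟨ρn (k + 1) ρ', hpos (k + 1) ρ'⟩) m
  -- At `m = 0` the truncated subtraction produces a vorticity and a velocity that enter no
  -- equation.
  refine ⟨fun m => (x m).1, fun m => wn m (x (m - 1)), fun m => un m (x (m - 1)),
    ⟨rfl, fun m hm _ => ?_⟩, fun m _ _ => (x m).2⟩
  obtain ⟨k, rfl⟩ := Nat.exists_eq_add_of_le' hm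
  exact hstep (k + 1) (x k)

end
end SimplicialMesh

theorem lemma3p2
    (mu lam a γ : ℝ) (hmu : 0 < mu) (hlam : 0 < lam + mu) (ha : 0 < a) (hγ : 1 < γ)
    (tEnd dt : ℝ) (M : ℕ) (htEnd : 0 < tEnd) (hdt : 0 < dt) (hM : M * dt = tEnd) :
    (∀ (Ω : Set (Euc 2)), IsOpen Ω → Bornology.IsBounded Ω → IsSimplyConnected Ω →
      HasLipschitzBoundary Ω →
      ∀ (T : SimplicialMesh Ω) (o : T.Orientation)
        (f : ℝ → Euc 2 → Euc 2) (ρ0 : T.Qh),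
        MemLp (Function.uncurry f) 2 (volume.restrict (Ioo 0 tEnd ×ˢ Ω)) →
        (∀ K, 0 < ρ0 K) →
        ∃ (ρ : ℕ → T.Qh) (w : ℕ → T.Cell → Euc 2 → ℝ) (u : ℕ → T.Cell → Euc 2 → Euc 2),
          T.IsNumericalSolution o T.Wh2 curl2 mu lam a γ dt M f ρ0 ρ w u ∧
          ∀ m : ℕ, 1 ≤ m → m ≤ M → ∀ K, 0 < ρ m K) ∧
    (∀ (Ω : Set (Euc 3)), IsOpen Ω → Bornology.IsBounded Ω → IsSimplyConnected Ω →
      HasLipschitzBoundary Ω →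
      ∀ (T : SimplicialMesh Ω) (o : T.Orientation)
        (f : ℝ → Euc 3 → Euc 3) (ρ0 : T.Qh),
        MemLp (Function.uncurry f) 2 (volume.restrict (Ioo 0 tEnd ×ˢ Ω)) →
        (∀ K, 0 < ρ0 K) →
        ∃ (ρ : ℕ → T.Qh) (w : ℕ → T.Cell → Euc 3 → Euc 3) (u : ℕ → T.Cell → Euc 3 → Euc 3),
          T.IsNumericalSolution o T.Wh3 curl3 mu lam a γ dt M f ρ0 ρ w u ∧
          ∀ m : ℕ, 1 ≤ m → m ≤ M → ∀ K, 0 < ρ m K) := by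

  refine ⟨fun Ω hΩ _ hsc hL T o f ρ0 _ hρ0 => ?_, fun Ω hΩ _ hsc hL T o f ρ0 _ hρ0 => ?_⟩
  · exact (SimplicialMesh.vorticitySpace2 hΩ o).exists_isNumericalSolution (Or.inl rfl) hΩ hsc hL
      hmu hlam (zero_le_one.trans hγ.le) hdt.le M f hρ0
  · exact (SimplicialMesh.vorticitySpace3 hΩ o).exists_isNumericalSolution (Or.inr rfl) hΩ hsc hL
      hmu hlam (zero_le_one.trans hγ.le) hdt.le M f hρ0
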